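/- Let $\mathfrak g=\mathfrak g_{\bar 0}\oplus\mathfrak g_{\bar 1}$ be a finite-dimensional complex basic Lie superalgebra (simple, with $\mathfrak g_{\bar 0}$ reductive, and with a nondegenerate even supersymmetric invariant bilinear form), and let $\mathfrak g_C$ be a real form of $\mathfrak g$, i.e. the fixed points of an involutive antilinear automorphism $C$ of $\mathfrak g$ (so $\mathfrak g_C$ is a noncomplex real basic Lie superalgebra). Let $\theta$ be a Cartan involution of the reductive real Lie algebra $\mathfrak g_{\bar 0 C}$, extended complex linearly to $\mathfrak g_{\bar 0}$. A triple $(\mathfrak g_C,\mathfrak h_{\bar 0},\Delta^+)$ consists of $\mathfrak g_C$, a maximally compact $\theta$-stable Cartan subalgebra $\mathfrak h_{\bar 0}=\mathfrak t_{\bar 0}\oplus\mathfrak a_{\bar 0}$ of $\mathfrak g_{\bar 0 C}$ with complexification $\mathfrak h$, and a positive system $\Delta^+$ of the root system $\Delta=\Delta_{\bar 0}\cup\Delta_{\bar 1}$ of $(\mathfrak g,\mathfrak h)$ whose even part $\Delta^+_{\bar 0}=\Delta^+\cap\Delta_{\bar 0}$ takes $i\mathfrak t_{\bar 0}$ before $\mathfrak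 a_{\bar 0}$. The even vertices of its Vogan diagram are the simple roots of $\Delta^+_{\bar 0}$. The painted ones are those $\alpha$ with $\theta\alpha=\alpha$ that are noncompact ($\theta=-1$ on $\mathfrak g_\alpha$); odd vertices are never painted. The associated diagram automorphism is the action of $\theta$ on the even vertices. The even parts are the connected components of the Dynkin diagram of $\Delta^+_{\bar 0}$, i.e. they correspond to the simple ideals of $\mathfrak g_{\bar 0}$. Let a triple $(\mathfrak g_C,\mathfrak h_{\bar 0},\Delta^+)$ be given. Then there is a simple system $\Pi'$ of $\Delta$, with positive system $\Delta^{+\prime}$, such that $(\mathfrak g_C,\mathfrak h_{\bar 0},\Delta^{+\prime})$ is a triple and the following hold. 1. If $\mathfrak g$ is of type $A(m,n)$, or of type $D(m,n)=\mathfrak{osp}(2m|2n)$ with $m\ge 3$, then the Vogan diagram of $(\mathfrak g_C,\mathfrak h_{\bar 0},\Delta^{+\prime})$ has at most two painted vertices. If $\mathfrak g$ is of type $D(2,n)$, then it has at most three painted vertices, and at most two of them belong to $\Pi'$. 2. If $\mathfrak g$ is of type $D(2,1;\alpha)$, $\alpha\in\mathbb C\setminus\{0,-1\}$, then it has at most three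 painted vertices. 3. Suppose that the diagram automorphism associated with $(\mathfrak g_C,\mathfrak h_{\bar 0},\Delta^{+\prime})$ is the identity. Let $\alpha_1,\dots,\alpha_l$ be the even vertices, with coroots $h_1,\dots,h_l$ and Cartan matrix $A=(\alpha_k(h_j))_{jk}$. Then each even part contains at most one painted vertex. Moreover, let $\epsilon=\mathrm{diag}(\epsilon_{11},\dots,\epsilon_{ll})$ be any positive diagonal matrix for which $\epsilon A$ is symmetric, let $\langle\cdot,\cdot\rangle$ be the bilinear form on the real span of the $\alpha_k$ with $\langle\alpha_j,\alpha_k\rangle=(\epsilon A)_{jk}$, and let $\omega_1,\dots,\omega_l$ be the dual basis in that span normalized by $\omega_j(h_k)=\delta_{jk}/\epsilon_{kk}$. If $\alpha_i$ is the painted vertex of an even part, then there is no $\alpha_{i'}$ in the same even part with $\langle\omega_i-\omega_{i'},\omega_{i'}\rangle>0$. -/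

import Mathlib

open Module

noncomputable section

/-! ### Lie superalgebras -/

/-- A Lie superalgebra `𝔤 = 𝔤₀ ⊕ 𝔤₁`, given by its homogeneous components: the even part `𝔤₀` is a
Lie algebra, the odd part `𝔤₁` is a `𝔤₀`-module (`[x, a] = ⁅x, a⁆ = -[a, x]` for `x` even and `a`
odd), and the bracket of two odd elements is a symmetric bilinear map into `𝔤₀`. The last two fields
are the super Jacobi identity for the parities (even, odd, odd) and (odd, odd, odd); the parities
(even, even, even) and (even, even, odd) are the axioms of a Lie algebra and of a module. -/
structure LieSuperalgebra (R 𝔤₀ 𝔤₁ : Type*) [CommRing R] [LieRing 𝔤₀] [LieAlgebra R 𝔤₀]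
    [AddCommGroup 𝔤₁] [Module R 𝔤₁] [LieRingModule 𝔤₀ 𝔤₁] [LieModule R 𝔤₀ 𝔤₁] where
  /-- the bracket of two odd elements -/
  odd : 𝔤₁ →ₗ[R] 𝔤₁ →ₗ[R] 𝔤₀
  odd_symm : ∀ a b, odd a b = odd b a
  lie_odd : ∀ (x : 𝔤₀) (a b : 𝔤₁), ⁅x, odd a b⁆ = odd ⁅x, a⁆ b + odd a ⁅x, b⁆
  jacobi : ∀ a b c : 𝔤₁, ⁅odd a b, c⁆ + ⁅odd b c, a⁆ + ⁅odd c a, b⁆ = 0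

namespace LieSuperalgebra

variable {𝔤₀ 𝔤₁ : Type*} [LieRing 𝔤₀] [LieAlgebra ℂ 𝔤₀]
  [AddCommGroup 𝔤₁] [Module ℂ 𝔤₁] [LieRingModule 𝔤₀ 𝔤₁] [LieModule ℂ 𝔤₀ 𝔤₁]
  {𝔨₀ 𝔨₁ : Type*} [LieRing 𝔨₀] [LieAlgebra ℂ 𝔨₀]
  [AddCommGroup 𝔨₁] [Module ℂ 𝔨₁] [LieRingModule 𝔨₀ 𝔨₁] [LieModule ℂ 𝔨₀ 𝔨₁]

/-- `I₀ ⊕ I₁` is a graded ideal. -/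
structure IsGradedIdeal (S : LieSuperalgebra ℂ 𝔤₀ 𝔤₁) (I₀ : Submodule ℂ 𝔤₀)
    (I₁ : Submodule ℂ 𝔤₁) : Prop where
  even_even : ∀ (x : 𝔤₀), ∀ y ∈ I₀, ⁅x, y⁆ ∈ I₀
  even_odd : ∀ (x : 𝔤₀), ∀ a ∈ I₁, ⁅x, a⁆ ∈ I₁
  odd_even : ∀ x ∈ I₀, ∀ a : 𝔤₁, ⁅x, a⁆ ∈ I₁
  odd_odd : ∀ (a : 𝔤₁), ∀ b ∈ I₁, S.odd a b ∈ I₀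

/-- Simple: the bracket is not zero, and the only graded ideals are `0` and `𝔤`. -/
structure IsSimple (S : LieSuperalgebra ℂ 𝔤₀ 𝔤₁) : Prop where
  not_abelian : ¬ ((∀ x y : 𝔤₀, ⁅x, y⁆ = 0) ∧ (∀ (x : 𝔤₀) (a : 𝔤₁), ⁅x, a⁆ = 0) ∧
    ∀ a b : 𝔤₁, S.odd a b = 0)
  eq_bot_or_eq_top : ∀ (I₀ : Submodule ℂ 𝔤₀) (I₁ : Submodule ℂ 𝔤₁), S.IsGradedIdeal I₀ I₁ →
    (I₀ = ⊥ ∧ I₁ = ⊥) ∨ (I₀ = ⊤ ∧ I₁ = ⊤)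

/-- `B₀ ⊕ B₁` is an even supersymmetric invariant nondegenerate bilinear form. The remaining cases
of invariance follow from the ones listed and supersymmetry. -/
structure IsInvariantForm (S : LieSuperalgebra ℂ 𝔤₀ 𝔤₁) (B₀ : LinearMap.BilinForm ℂ 𝔤₀)
    (B₁ : LinearMap.BilinForm ℂ 𝔤₁) : Prop where
  symm_even : ∀ x y, B₀ x y = B₀ y x
  skew_odd : ∀ a b, B₁ a b = -B₁ b a
  invariant_even : ∀ x y z, B₀ ⁅x, y⁆ z = B₀ x ⁅y, z⁆
  invariant_odd : ∀ x a b, B₁ ⁅x, a⁆ b = B₀ x (S.odd a b)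
  nondegenerate_even : B₀.Nondegenerate
  nondegenerate_odd : B₁.Nondegenerate

/-- A basic (classical) complex Lie superalgebra: simple, with reductive even part, and with a
nondegenerate even supersymmetric invariant bilinear form. -/
structure IsBasic (S : LieSuperalgebra ℂ 𝔤₀ 𝔤₁) : Prop where
  simple : S.IsSimple
  reductive : LieAlgebra.HasCentralRadical ℂ 𝔤₀
  form : ∃ B₀ B₁, S.IsInvariantForm B₀ B₁

/-- `(φ₀, φ₁)` is a homomorphism of Lie superalgebras. -/
structure IsHom (S : LieSuperalgebra ℂ 𝔤₀ 𝔤₁) (T : LieSuperalgebra ℂ 𝔨₀ 𝔨₁)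
    (φ₀ : 𝔤₀ →ₗ⁅ℂ⁆ 𝔨₀) (φ₁ : 𝔤₁ →ₗ[ℂ] 𝔨₁) : Prop where
  map_lie : ∀ x a, φ₁ ⁅x, a⁆ = ⁅φ₀ x, φ₁ a⁆
  map_odd : ∀ a b, φ₀ (S.odd a b) = T.odd (φ₁ a) (φ₁ b)

/-- Isomorphic Lie superalgebras. -/
def Iso (S : LieSuperalgebra ℂ 𝔤₀ 𝔤₁) (T : LieSuperalgebra ℂ 𝔨₀ 𝔨₁) : Prop :=
  ∃ (φ₀ : 𝔤₀ →ₗ⁅ℂ⁆ 𝔨₀) (φ₁ : 𝔤₁ →ₗ[ℂ] 𝔨₁), S.IsHom T φ₀ φ₁ ∧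
    Function.Bijective φ₀ ∧ Function.Bijective φ₁

end LieSuperalgebra

/-! ### Matrix Lie superalgebras: `sl(m|n)` and `osp(M|2n)` -/

section Models

attribute [local instance 100] LieRing.ofAssociativeRing

/-- A sub-superspace of an associative algebra that is closed under the supercommutator. -/
structure SuperSub (𝒜 : Type*) [Ring 𝒜] [Algebra ℂ 𝒜] where
  even : LieSubalgebra ℂ 𝒜
  odd : Submodule ℂ 𝒜
  even_odd : ∀ x ∈ even, ∀ a ∈ odd, x * a - a * x ∈ odd
  odd_odd : ∀ a ∈ odd, ∀ b ∈ odd, a * b + b * a ∈ even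

namespace SuperSub

variable {𝒜 : Type*} [Ring 𝒜] [Algebra ℂ 𝒜]

instance (U : SuperSub 𝒜) : LieRingModule U.even U.odd where
  bracket x a := ⟨x * a - a * x, U.even_odd x x.2 a a.2⟩
  add_lie x y a := by ext; simp; noncomm_ring
  lie_add x a b := by ext; simp; noncomm_ring
  leibniz_lie x y a := by ext; simp [LieRing.of_associative_ring_bracket]; noncomm_ring

theorem coe_lie (U : SuperSub 𝒜) (x : U.even) (a : U.odd) :
    ((⁅x, a⁆ : U.odd) : 𝒜) = x * a - a * x := rfl

instance (U : SuperSub 𝒜) : LieModule ℂ U.even U.odd where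
  smul_lie t x a := by ext; simp [coe_lie, smul_sub]
  lie_smul t x a := by ext; simp [coe_lie, smul_sub]

/-- The Lie superalgebra with the supercommutator as bracket. -/
def toLieSuperalgebra (U : SuperSub 𝒜) : LieSuperalgebra ℂ U.even U.odd where
  odd := LinearMap.mk₂ ℂ (fun a b => ⟨a * b + b * a, U.odd_odd a a.2 b b.2⟩)
    (fun a b c => by ext; simp; noncomm_ring)
    (fun t a b => by ext; simp)
    (fun a b c => by ext; simp; noncomm_ring)
    (fun t a b => by ext; simp)
  odd_symm a b := by ext; simp [add_comm]
  lie_odd x a b := by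
    ext; simp [LieRing.of_associative_ring_bracket, coe_lie]; noncomm_ring
  jacobi a b c := by
    ext; simp [coe_lie]; noncomm_ring

end SuperSub

theorem comm_aux {𝒜 : Type*} [Ring 𝒜] {g x y : 𝒜} (h1 : g * x = x * g) (h3 : g * y = y * g) :
    g * (x * y - y * x) = (x * y - y * x) * g := by
  rw [mul_sub, sub_mul, ← mul_assoc, h1, mul_assoc, h3, ← mul_assoc, ← mul_assoc, h3, mul_assoc y,
    h1, ← mul_assoc]

theorem comm_anti_aux {𝒜 : Type*} [Ring 𝒜] {g x y : 𝒜} (h1 : g * x = x * g)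
    (h3 : g * y = -(y * g)) : g * (x * y - y * x) = -((x * y - y * x) * g) := by
  rw [mul_sub, ← mul_assoc, h1, mul_assoc, h3, ← mul_assoc, h3, neg_mul, mul_assoc y, h1]
  noncomm_ring

theorem anti_anti_aux {𝒜 : Type*} [Ring 𝒜] {g x y : 𝒜} (h1 : g * x = -(x * g))
    (h3 : g * y = -(y * g)) : g * (x * y + y * x) = (x * y + y * x) * g := by
  rw [mul_add, ← mul_assoc, h1, neg_mul, mul_assoc, h3, ← mul_assoc, h3, neg_mul, mul_assoc y, h1]
  noncomm_ring

section Matrices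

variable (p q : Type) [Fintype p] [DecidableEq p] [Fintype q] [DecidableEq q]

/-- The parity operator `diag(1, -1)` of `ℂ^{p|q}`. A matrix is even if it commutes with it (it is
block diagonal) and odd if it anticommutes with it (its diagonal blocks vanish). The supertrace of
`X` is the trace of `parityOp * X`. -/
def parityOp : Matrix (p ⊕ q) (p ⊕ q) ℂ := Matrix.fromBlocks 1 0 0 (-1)

theorem parityOp_mul_self : parityOp p q * parityOp p q = 1 := by
  simp [parityOp, Matrix.fromBlocks_multiply]

theorem parityOp_transpose : (parityOp p q).transpose = parityOp p q := by
  have _ := parityOp_mul_self p q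
  simp [parityOp, Matrix.fromBlocks_transpose]

/-- `sl(p|q)`: the matrices of supertrace zero (automatic for odd ones). -/
def slSuper : SuperSub (Matrix (p ⊕ q) (p ⊕ q) ℂ) where
  even :=
    { carrier := {X | parityOp p q * X = X * parityOp p q ∧ (parityOp p q * X).trace = 0}
      add_mem' := by
        rintro X Y ⟨h1, h2⟩ ⟨h3, h4⟩
        exact ⟨by rw [mul_add, add_mul, h1, h3], by rw [mul_add, Matrix.trace_add, h2, h4, add_zero]⟩
      zero_mem' := by simp
      smul_mem' := by
        rintro c X ⟨h1, h2⟩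
        exact ⟨by simp [h1], by simp [h2]⟩
      lie_mem' := by
        rintro X Y ⟨h1, -⟩ ⟨h3, -⟩
        refine ⟨comm_aux h1 h3, ?_⟩
        rw [LieRing.of_associative_ring_bracket, mul_sub, Matrix.trace_sub, ← mul_assoc, h1,
          mul_assoc, Matrix.trace_mul_comm, mul_assoc, sub_self] }
  odd :=
    { carrier := {X | parityOp p q * X = -(X * parityOp p q)}
      add_mem' := by
        intro X Y h1 h3
        simp only [Set.mem_ofPred_eq] at *
        rw [mul_add, add_mul, h1, h3, neg_add]
      zero_mem' := by simp
      smul_mem' := by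
        intro c X h1
        simp only [Set.mem_ofPred_eq] at *
        simp [h1] }
  even_odd := by
    rintro X ⟨h1, -⟩ Y h3
    exact comm_anti_aux h1 h3
  odd_odd := by
    rintro X h1 Y (h3 : _ = _)
    refine ⟨anti_anti_aux h1 h3, ?_⟩
    rw [mul_add, Matrix.trace_add, ← mul_assoc, h1, neg_mul, mul_assoc, Matrix.trace_neg,
      Matrix.trace_mul_comm, mul_assoc, neg_add_cancel]

/-- The Gram matrix of the supersymmetric form on `ℂ^{p|2q}`: symmetric on the even part and
symplectic on the odd part. -/
def ospGram : Matrix (p ⊕ (q ⊕ q)) (p ⊕ (q ⊕ q)) ℂ := Matrix.fromBlocks 1 0 0 (Matrix.J q ℂ)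

/-- `osp(p|2q)`: the homogeneous `X` with `(X u, v) + (-1)^{|X||u|} (u, X v) = 0` for the
supersymmetric form of Gram matrix `ospGram`. -/
def ospSuper : SuperSub (Matrix (p ⊕ (q ⊕ q)) (p ⊕ (q ⊕ q)) ℂ) where
  even :=
    { carrier := {X | parityOp p (q ⊕ q) * X = X * parityOp p (q ⊕ q) ∧
        X.transpose * ospGram p q + ospGram p q * X = 0}
      add_mem' := by
        rintro X Y ⟨h1, h2⟩ ⟨h3, h4⟩
        refine ⟨by rw [mul_add, add_mul, h1, h3], ?_⟩
        rw [Matrix.transpose_add, add_mul, mul_add, add_add_add_comm, h2, h4, add_zero]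
      zero_mem' := by simp
      smul_mem' := by
        rintro c X ⟨h1, h2⟩
        refine ⟨by simp [h1], ?_⟩
        rw [Matrix.transpose_smul, smul_mul_assoc, mul_smul_comm, ← smul_add, h2, smul_zero]
      lie_mem' := by
        rintro X Y ⟨h1, h2⟩ ⟨h3, h4⟩
        refine ⟨comm_aux h1 h3, ?_⟩
        rw [add_eq_zero_iff_eq_neg] at h2 h4 ⊢
        rw [LieRing.of_associative_ring_bracket, Matrix.transpose_sub, Matrix.transpose_mul,
          Matrix.transpose_mul, sub_mul, mul_assoc, h2, mul_assoc, h4, mul_neg, mul_neg,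
          ← mul_assoc, ← mul_assoc, h2, h4]
        noncomm_ring }
  odd :=
    { carrier := {X | parityOp p (q ⊕ q) * X = -(X * parityOp p (q ⊕ q)) ∧
        X.transpose * ospGram p q + parityOp p (q ⊕ q) * ospGram p q * X = 0}
      add_mem' := by
        rintro X Y ⟨h1, h2⟩ ⟨h3, h4⟩
        refine ⟨by rw [mul_add, add_mul, h1, h3, neg_add], ?_⟩
        rw [Matrix.transpose_add, add_mul, mul_add, add_add_add_comm, h2, h4, add_zero]
      zero_mem' := by simp
      smul_mem' := by
        rintro c X ⟨h1, h2⟩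
        refine ⟨by simp [h1], ?_⟩
        rw [Matrix.transpose_smul, smul_mul_assoc, mul_smul_comm, ← smul_add, h2, smul_zero] }
  even_odd := by
    rintro X ⟨h1, h2⟩ Y ⟨h3, h4⟩
    refine ⟨comm_anti_aux h1 h3, ?_⟩
    have h5 := congrArg Matrix.transpose h1
    rw [Matrix.transpose_mul, Matrix.transpose_mul, parityOp_transpose] at h5
    rw [add_eq_zero_iff_eq_neg] at h2 h4
    rw [Matrix.transpose_sub, Matrix.transpose_mul, Matrix.transpose_mul]
    have e1 : Y.transpose * X.transpose * ospGram p q =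
        parityOp p (q ⊕ q) * ospGram p q * (Y * X) := by
      rw [mul_assoc, h2, mul_neg, ← mul_assoc, h4, neg_mul, neg_neg, mul_assoc _ Y X]
    have e2 : X.transpose * Y.transpose * ospGram p q =
        parityOp p (q ⊕ q) * ospGram p q * (X * Y) := by
      rw [mul_assoc, h4, mul_neg, ← mul_assoc, ← mul_assoc, h5, mul_assoc (parityOp p (q ⊕ q)), h2]
      noncomm_ring
    rw [sub_mul, e1, e2]
    noncomm_ring
  odd_odd := by
    rintro X ⟨h1, h2⟩ Y ⟨h3, h4⟩
    refine ⟨anti_anti_aux h1 h3, ?_⟩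
    have h0 := parityOp_mul_self p (q ⊕ q)
    have h5 := congrArg Matrix.transpose h1
    have h6 := congrArg Matrix.transpose h3
    rw [Matrix.transpose_neg, Matrix.transpose_mul, Matrix.transpose_mul,
      parityOp_transpose] at h5 h6
    rw [eq_neg_iff_add_eq_zero, add_comm, ← eq_neg_iff_add_eq_zero] at h5 h6
    rw [add_eq_zero_iff_eq_neg] at h2 h4
    have key : ∀ U V : Matrix (p ⊕ (q ⊕ q)) (p ⊕ (q ⊕ q)) ℂ,
        U.transpose * ospGram p q = -(parityOp p (q ⊕ q) * ospGram p q * U) →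
        V.transpose * ospGram p q = -(parityOp p (q ⊕ q) * ospGram p q * V) →
        parityOp p (q ⊕ q) * V.transpose = -(V.transpose * parityOp p (q ⊕ q)) →
        V.transpose * U.transpose * ospGram p q = -(ospGram p q * (V * U)) := by
      intro U V hU hV hV'
      have hV'' : V.transpose * parityOp p (q ⊕ q) = -(parityOp p (q ⊕ q) * V.transpose) := by
        rw [hV', neg_neg]
      rw [mul_assoc, hU, mul_neg, ← mul_assoc, ← mul_assoc, hV'', neg_mul, neg_mul, neg_neg,
        mul_assoc (parityOp p (q ⊕ q)), hV, mul_neg, neg_mul, ← mul_assoc, ← mul_assoc, h0,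
        one_mul, mul_assoc]
    rw [Matrix.transpose_add, Matrix.transpose_mul, Matrix.transpose_mul, add_mul,
      key X Y h2 h4 h6, key Y X h4 h2 h5]
    noncomm_ring

end Matrices

/-! ### The exceptional family `D(2,1;α)` -/

/-- `sl₂ ⊕ sl₂ ⊕ sl₂`. -/
abbrev D21Even : Type :=
  LieAlgebra.SpecialLinear.sl (Fin 2) ℂ × LieAlgebra.SpecialLinear.sl (Fin 2) ℂ ×
    LieAlgebra.SpecialLinear.sl (Fin 2) ℂ

/-- `ℂ² ⊗ ℂ² ⊗ ℂ²`, a tensor being given by its coordinates. -/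
def D21Odd : Type := Fin 2 → Fin 2 → Fin 2 → ℂ

instance : AddCommGroup D21Odd := inferInstanceAs (AddCommGroup (Fin 2 → Fin 2 → Fin 2 → ℂ))

instance : Module ℂ D21Odd := inferInstanceAs (Module ℂ (Fin 2 → Fin 2 → Fin 2 → ℂ))

namespace D21

theorem add_apply (u v : D21Odd) (i j k : Fin 2) : (u + v) i j k = u i j k + v i j k := rfl

theorem smul_apply (t : ℂ) (u : D21Odd) (i j k : Fin 2) : (t • u) i j k = t * u i j k := rfl

theorem zero_apply (i j k : Fin 2) : (0 : D21Odd) i j k = 0 := rfl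

/-- Each factor `sl₂` acts on its own tensor factor `ℂ²`. -/
def act (x : D21Even) (u : D21Odd) : D21Odd := fun i j k =>
  (∑ a, x.1.1 i a * u a j k) + (∑ a, x.2.1.1 j a * u i a k) + ∑ a, x.2.2.1 k a * u i j a

theorem act_apply (x : D21Even) (u : D21Odd) (i j k : Fin 2) :
    act x u i j k = (∑ a, x.1.1 i a * u a j k) + (∑ a, x.2.1.1 j a * u i a k) +
      ∑ a, x.2.2.1 k a * u i j a := rfl

instance : LieRingModule D21Even D21Odd where
  bracket := act
  add_lie x y u := by
    funext i j k
    simp [add_apply, act_apply, Fin.sum_univ_two]; ring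
  lie_add x u v := by
    funext i j k
    simp [add_apply, act_apply, Fin.sum_univ_two]; ring
  leibniz_lie x y u := by
    funext i j k
    simp [add_apply, act_apply, Fin.sum_univ_two, LieRing.of_associative_ring_bracket,
      Matrix.mul_apply]
    ring

theorem lie_apply (x : D21Even) (u : D21Odd) (i j k : Fin 2) :
    (⁅x, u⁆ : D21Odd) i j k = (∑ a, x.1.1 i a * u a j k) + (∑ a, x.2.1.1 j a * u i a k) +
      ∑ a, x.2.2.1 k a * u i j a := rfl

instance : LieModule ℂ D21Even D21Odd where
  smul_lie t x u := by
    funext i j k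
    simp [lie_apply, smul_apply, Fin.sum_univ_two]; ring
  lie_smul t x u := by
    funext i j k
    simp [lie_apply, smul_apply, Fin.sum_univ_two]; ring

/-- The matrix of the symplectic form `ψ` on `ℂ²`. -/
def psi : Matrix (Fin 2) (Fin 2) ℂ := !![0, 1; -1, 0]

/-- The element `z ↦ ∑ M i j (ψ(eⱼ, z) eᵢ + ψ(eᵢ, z) eⱼ)` of `sl₂`; for `M = x yᵀ` this is
`z ↦ ψ(y, z) x - ψ(z, x) y`. -/
def toSl : Matrix (Fin 2) (Fin 2) ℂ →ₗ[ℂ] LieAlgebra.SpecialLinear.sl (Fin 2) ℂ where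
  toFun M := ⟨(M + M.transpose) * psi, by
    change Matrix.trace ((M + M.transpose) * psi) = 0
    simp [psi, Matrix.trace, Matrix.mul_apply, Fin.sum_univ_two]; ring⟩
  map_add' M N := by ext; simp [add_mul, add_add_add_comm]
  map_smul' t M := by ext; simp [← smul_add]

theorem toSl_zero (M : Matrix (Fin 2) (Fin 2) ℂ) (i : Fin 2) :
    (toSl M).1 i 0 = -(M i 1 + M 1 i) := by
  simp [toSl, psi, Matrix.mul_apply, Fin.sum_univ_two]

theorem toSl_one (M : Matrix (Fin 2) (Fin 2) ℂ) (i : Fin 2) :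
    (toSl M).1 i 1 = M i 0 + M 0 i := by
  simp [toSl, psi, Matrix.mul_apply, Fin.sum_univ_two]

/-- Contractions of `u ⊗ v` by `ψ` in all but one of the three tensor factors. -/
def contract₁ : D21Odd →ₗ[ℂ] D21Odd →ₗ[ℂ] Matrix (Fin 2) (Fin 2) ℂ :=
  LinearMap.mk₂ ℂ (fun u v => Matrix.of fun i i' =>
      ∑ j, ∑ j', ∑ k, ∑ k', psi j j' * psi k k' * (u i j k * v i' j' k'))
    (fun u v w => by
      ext; simp only [add_apply, add_mul, mul_add, Finset.sum_add_distrib, Matrix.of_apply,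
        Matrix.add_apply])
    (fun t u v => by
      ext; simp only [smul_apply, Matrix.of_apply, Matrix.smul_apply, smul_eq_mul, Finset.mul_sum,
        mul_assoc, mul_left_comm t])
    (fun u v w => by
      ext; simp only [add_apply, mul_add, Finset.sum_add_distrib, Matrix.of_apply,
        Matrix.add_apply])
    (fun t u v => by
      ext; simp only [smul_apply, Matrix.of_apply, Matrix.smul_apply, smul_eq_mul, Finset.mul_sum,
        mul_assoc, mul_left_comm t])

/-- See `contract₁`. -/
def contract₂ : D21Odd →ₗ[ℂ] D21Odd →ₗ[ℂ] Matrix (Fin 2) (Fin 2) ℂ :=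
  LinearMap.mk₂ ℂ (fun u v => Matrix.of fun j j' =>
      ∑ i, ∑ i', ∑ k, ∑ k', psi i i' * psi k k' * (u i j k * v i' j' k'))
    (fun u v w => by
      ext; simp only [add_apply, add_mul, mul_add, Finset.sum_add_distrib, Matrix.of_apply,
        Matrix.add_apply])
    (fun t u v => by
      ext; simp only [smul_apply, Matrix.of_apply, Matrix.smul_apply, smul_eq_mul, Finset.mul_sum,
        mul_assoc, mul_left_comm t])
    (fun u v w => by
      ext; simp only [add_apply, mul_add, Finset.sum_add_distrib, Matrix.of_apply,
        Matrix.add_apply])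
    (fun t u v => by
      ext; simp only [smul_apply, Matrix.of_apply, Matrix.smul_apply, smul_eq_mul, Finset.mul_sum,
        mul_assoc, mul_left_comm t])

/-- See `contract₁`. -/
def contract₃ : D21Odd →ₗ[ℂ] D21Odd →ₗ[ℂ] Matrix (Fin 2) (Fin 2) ℂ :=
  LinearMap.mk₂ ℂ (fun u v => Matrix.of fun k k' =>
      ∑ i, ∑ i', ∑ j, ∑ j', psi i i' * psi j j' * (u i j k * v i' j' k'))
    (fun u v w => by
      ext; simp only [add_apply, add_mul, mul_add, Finset.sum_add_distrib, Matrix.of_apply,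
        Matrix.add_apply])
    (fun t u v => by
      ext; simp only [smul_apply, Matrix.of_apply, Matrix.smul_apply, smul_eq_mul, Finset.mul_sum,
        mul_assoc, mul_left_comm t])
    (fun u v w => by
      ext; simp only [add_apply, mul_add, Finset.sum_add_distrib, Matrix.of_apply,
        Matrix.add_apply])
    (fun t u v => by
      ext; simp only [smul_apply, Matrix.of_apply, Matrix.smul_apply, smul_eq_mul, Finset.mul_sum,
        mul_assoc, mul_left_comm t])

theorem contract₁_apply (u v : D21Odd) (i i' : Fin 2) : contract₁ u v i i' =
    u i 0 0 * v i' 1 1 - u i 0 1 * v i' 1 0 - u i 1 0 * v i' 0 1 + u i 1 1 * v i' 0 0 := by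
  simp [contract₁, psi, Fin.sum_univ_two]; ring

theorem contract₂_apply (u v : D21Odd) (j j' : Fin 2) : contract₂ u v j j' =
    u 0 j 0 * v 1 j' 1 - u 0 j 1 * v 1 j' 0 - u 1 j 0 * v 0 j' 1 + u 1 j 1 * v 0 j' 0 := by
  simp [contract₂, psi, Fin.sum_univ_two]; ring

theorem contract₃_apply (u v : D21Odd) (k k' : Fin 2) : contract₃ u v k k' =
    u 0 0 k * v 1 1 k' - u 0 1 k * v 1 0 k' - u 1 0 k * v 0 1 k' + u 1 1 k * v 0 0 k' := by
  simp [contract₃, psi, Fin.sum_univ_two]; ring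

theorem toSl_contract₁_symm (u v : D21Odd) :
    toSl (contract₁ u v) = toSl (contract₁ v u) := by
  apply Subtype.ext
  ext i j; fin_cases j
  · exact (toSl_zero _ i).trans (Eq.trans (by simp only [contract₁_apply]; ring)
      (toSl_zero _ i).symm)
  · exact (toSl_one _ i).trans (Eq.trans (by simp only [contract₁_apply]; ring)
      (toSl_one _ i).symm)

theorem toSl_contract₂_symm (u v : D21Odd) :
    toSl (contract₂ u v) = toSl (contract₂ v u) := by
  apply Subtype.ext
  ext i j; fin_cases j
  · exact (toSl_zero _ i).trans (Eq.trans (by simp only [contract₂_apply]; ring)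
      (toSl_zero _ i).symm)
  · exact (toSl_one _ i).trans (Eq.trans (by simp only [contract₂_apply]; ring)
      (toSl_one _ i).symm)

theorem toSl_contract₃_symm (u v : D21Odd) :
    toSl (contract₃ u v) = toSl (contract₃ v u) := by
  apply Subtype.ext
  ext i j; fin_cases j
  · exact (toSl_zero _ i).trans (Eq.trans (by simp only [contract₃_apply]; ring)
      (toSl_zero _ i).symm)
  · exact (toSl_one _ i).trans (Eq.trans (by simp only [contract₃_apply]; ring)
      (toSl_one _ i).symm)

theorem sl_apply_one_one (x : LieAlgebra.SpecialLinear.sl (Fin 2) ℂ) : x.1 1 1 = -x.1 0 0 := by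
  have h : x.1.trace = 0 := x.2
  rw [Matrix.trace_fin_two] at h; linear_combination h

theorem lie_toSl_contract₁ (x : D21Even) (u v : D21Odd) :
    ⁅x.1, toSl (contract₁ u v)⁆ = toSl (contract₁ ⁅x, u⁆ v) + toSl (contract₁ u ⁅x, v⁆) := by
  have hx := sl_apply_one_one x.1
  have hy := sl_apply_one_one x.2.1
  have hz := sl_apply_one_one x.2.2
  apply Subtype.ext
  rw [LieSubalgebra.coe_bracket, LieRing.of_associative_ring_bracket]
  change _ = (toSl _).1 + (toSl _).1
  ext i j
  rw [Matrix.sub_apply, Matrix.mul_apply, Matrix.mul_apply, Matrix.add_apply]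
  simp only [Fin.sum_univ_two]
  fin_cases i <;> fin_cases j <;>
    simp only [Fin.zero_eta, Fin.mk_one, toSl_zero, toSl_one, contract₁_apply, lie_apply,
      Fin.sum_univ_two, hx, hy, hz] <;> ring

theorem lie_toSl_contract₂ (x : D21Even) (u v : D21Odd) :
    ⁅x.2.1, toSl (contract₂ u v)⁆ = toSl (contract₂ ⁅x, u⁆ v) + toSl (contract₂ u ⁅x, v⁆) := by
  have hx := sl_apply_one_one x.1
  have hy := sl_apply_one_one x.2.1
  have hz := sl_apply_one_one x.2.2
  apply Subtype.ext
  rw [LieSubalgebra.coe_bracket, LieRing.of_associative_ring_bracket]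
  change _ = (toSl _).1 + (toSl _).1
  ext i j
  rw [Matrix.sub_apply, Matrix.mul_apply, Matrix.mul_apply, Matrix.add_apply]
  simp only [Fin.sum_univ_two]
  fin_cases i <;> fin_cases j <;>
    simp only [Fin.zero_eta, Fin.mk_one, toSl_zero, toSl_one, contract₂_apply, lie_apply,
      Fin.sum_univ_two, hx, hy, hz] <;> ring

theorem lie_toSl_contract₃ (x : D21Even) (u v : D21Odd) :
    ⁅x.2.2, toSl (contract₃ u v)⁆ = toSl (contract₃ ⁅x, u⁆ v) + toSl (contract₃ u ⁅x, v⁆) := by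
  have hx := sl_apply_one_one x.1
  have hy := sl_apply_one_one x.2.1
  have hz := sl_apply_one_one x.2.2
  apply Subtype.ext
  rw [LieSubalgebra.coe_bracket, LieRing.of_associative_ring_bracket]
  change _ = (toSl _).1 + (toSl _).1
  ext i j
  rw [Matrix.sub_apply, Matrix.mul_apply, Matrix.mul_apply, Matrix.add_apply]
  simp only [Fin.sum_univ_two]
  fin_cases i <;> fin_cases j <;>
    simp only [Fin.zero_eta, Fin.mk_one, toSl_zero, toSl_one, contract₃_apply, lie_apply,
      Fin.sum_univ_two, hx, hy, hz] <;> ring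

/-- The bracket of two odd elements of `D(2,1;α)`: for decomposable tensors,
`[x₁ ⊗ x₂ ⊗ x₃, y₁ ⊗ y₂ ⊗ y₃] = (σ₁ ψ(x₂,y₂) ψ(x₃,y₃) p(x₁,y₁), σ₂ ψ(x₁,y₁) ψ(x₃,y₃) p(x₂,y₂),
σ₃ ψ(x₁,y₁) ψ(x₂,y₂) p(x₃,y₃))` with `p(x,y) z = ψ(y,z) x - ψ(z,x) y` and
`(σ₁, σ₂, σ₃) = (-(1 + α), 1, α)`. -/
def oddBracket (α : ℂ) : D21Odd →ₗ[ℂ] D21Odd →ₗ[ℂ] D21Even :=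
  LinearMap.mk₂ ℂ
    (fun u v =>
      ((-(1 + α)) • toSl (contract₁ u v), toSl (contract₂ u v), α • toSl (contract₃ u v)))
    (fun u v w => by simp only [map_add, LinearMap.add_apply, smul_add, Prod.mk_add_mk])
    (fun t u v => by
      simp only [map_smul, LinearMap.smul_apply, Prod.smul_mk, smul_comm t])
    (fun u v w => by simp only [map_add, smul_add, Prod.mk_add_mk])
    (fun t u v => by simp only [map_smul, Prod.smul_mk, smul_comm t])

theorem oddBracket_apply (α : ℂ) (u v : D21Odd) : oddBracket α u v =
    ((-(1 + α)) • toSl (contract₁ u v), toSl (contract₂ u v), α • toSl (contract₃ u v)) := rfl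

theorem oddBracket_lie_apply (α : ℂ) (u v w : D21Odd) (i j k : Fin 2) :
    (⁅oddBracket α u v, w⁆ : D21Odd) i j k =
      (∑ a, -(1 + α) * (toSl (contract₁ u v)).1 i a * w a j k) +
      (∑ a, (toSl (contract₂ u v)).1 j a * w i a k) +
      ∑ a, α * (toSl (contract₃ u v)).1 k a * w i j a := rfl

/-- The Lie superalgebra `D(2,1;α)`. -/
def superalgebra (α : ℂ) : LieSuperalgebra ℂ D21Even D21Odd where
  odd := oddBracket α
  odd_symm u v := by
    rw [oddBracket_apply, oddBracket_apply, toSl_contract₁_symm, toSl_contract₂_symm,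
      toSl_contract₃_symm]
  lie_odd x u v := by
    simp only [oddBracket_apply]
    refine Prod.ext ?_ (Prod.ext ?_ ?_)
    · change ⁅x.1, (-(1 + α)) • toSl (contract₁ u v)⁆ = (-(1 + α)) • _ + (-(1 + α)) • _
      rw [lie_smul, lie_toSl_contract₁, smul_add]
    · exact lie_toSl_contract₂ x u v
    · change ⁅x.2.2, α • toSl (contract₃ u v)⁆ = α • _ + α • _
      rw [lie_smul, lie_toSl_contract₃, smul_add]
  jacobi u v w := by
    funext i j k
    rw [add_apply, add_apply, zero_apply]
    simp only [oddBracket_lie_apply, Fin.sum_univ_two]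
    fin_cases i <;> fin_cases j <;> fin_cases k <;>
      simp only [Fin.zero_eta, Fin.mk_one, toSl_zero, toSl_one, contract₁_apply, contract₂_apply,
        contract₃_apply] <;> ring

end D21

end Models

namespace LieSuperalgebra

/-! ### Types, real forms, Cartan involutions, roots -/

section Vogan

variable {𝔤₀ 𝔤₁ : Type*} [LieRing 𝔤₀] [LieAlgebra ℂ 𝔤₀]
  [AddCommGroup 𝔤₁] [Module ℂ 𝔤₁] [LieRingModule 𝔤₀ 𝔤₁] [LieModule ℂ 𝔤₀ 𝔤₁]

/-- `𝔤` is of type `A(m,n)`: it is the quotient of `sl(m+1|n+1)` by the scalar matrices in it (there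
are nonzero ones only for `m = n`). -/
def IsTypeA (S : LieSuperalgebra ℂ 𝔤₀ 𝔤₁) (m n : ℕ) : Prop :=
  ∃ (φ₀ : (slSuper (Fin (m + 1)) (Fin (n + 1))).even →ₗ⁅ℂ⁆ 𝔤₀)
    (φ₁ : (slSuper (Fin (m + 1)) (Fin (n + 1))).odd →ₗ[ℂ] 𝔤₁),
    (slSuper (Fin (m + 1)) (Fin (n + 1))).toLieSuperalgebra.IsHom S φ₀ φ₁ ∧
    Function.Surjective φ₀ ∧ Function.Bijective φ₁ ∧
    ∀ X, φ₀ X = 0 ↔ ∃ c : ℂ, X.1 = c • 1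

/-- `𝔤` is of type `D(m,n)`: it is isomorphic to `osp(2m|2n)`. -/
def IsTypeD (S : LieSuperalgebra ℂ 𝔤₀ 𝔤₁) (m n : ℕ) : Prop :=
  S.Iso (ospSuper (Fin (2 * m)) (Fin n)).toLieSuperalgebra

/-- `𝔤` is of type `D(2,1;α)`. -/
def IsTypeD21 (S : LieSuperalgebra ℂ 𝔤₀ 𝔤₁) (α : ℂ) : Prop :=
  S.Iso (D21.superalgebra α)

/-- A real form of `𝔤`, given by its conjugation: an involutive antilinear automorphism of the Lie
superalgebra `𝔤`. The real Lie superalgebra itself is the set of fixed points. -/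
structure RealForm (S : LieSuperalgebra ℂ 𝔤₀ 𝔤₁) where
  conj₀ : 𝔤₀ →ₛₗ[starRingEnd ℂ] 𝔤₀
  conj₁ : 𝔤₁ →ₛₗ[starRingEnd ℂ] 𝔤₁
  conj₀_conj₀ : ∀ x, conj₀ (conj₀ x) = x
  conj₁_conj₁ : ∀ a, conj₁ (conj₁ a) = a
  conj_lie : ∀ x y, conj₀ ⁅x, y⁆ = ⁅conj₀ x, conj₀ y⁆
  conj_lie_odd : ∀ x a, conj₁ ⁅x, a⁆ = ⁅conj₀ x, conj₁ a⁆
  conj_odd_odd : ∀ a b, conj₀ (S.odd a b) = S.odd (conj₁ a) (conj₁ b)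

/-- `α` is an even root of `(𝔤, 𝔥)`. -/
def evenRoots (𝔥 : LieSubalgebra ℂ 𝔤₀) : Set (Dual ℂ 𝔥) :=
  {α | α ≠ 0 ∧ LieModule.weightSpace 𝔤₀ (α : 𝔥 → ℂ) ≠ ⊥}

/-- The odd roots of `(𝔤, 𝔥)`. -/
def oddRoots (𝔤₁ : Type*) [AddCommGroup 𝔤₁] [Module ℂ 𝔤₁] [LieRingModule 𝔤₀ 𝔤₁]
    [LieModule ℂ 𝔤₀ 𝔤₁] (𝔥 : LieSubalgebra ℂ 𝔤₀) : Set (Dual ℂ 𝔥) :=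
  {α | α ≠ 0 ∧ LieModule.weightSpace 𝔤₁ (α : 𝔥 → ℂ) ≠ ⊥}

/-- The positive systems of a set of roots are those given by a real linear functional that does
not vanish on any root. -/
def IsPositiveSystem {V : Type*} [AddCommGroup V] [Module ℝ V] (Δ P : Set V) : Prop :=
  ∃ f : V →ₗ[ℝ] ℝ, (∀ α ∈ Δ, f α ≠ 0) ∧ P = {α | α ∈ Δ ∧ 0 < f α}

/-- The simple system of a positive system: the positive roots that are not the sum of two positive
roots. -/
def simpleSystem {V : Type*} [AddCommGroup V] (P : Set V) : Set V :=
  {α | α ∈ P ∧ ∀ β ∈ P, ∀ γ ∈ P, α ≠ β + γ}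

/-- The even vertices of the Vogan diagram of a triple with positive system `P`: the simple roots
of the positive system of even roots in `P`. -/
def evenSimple (𝔥 : LieSubalgebra ℂ 𝔤₀) (P : Set (Dual ℂ 𝔥)) : Set (Dual ℂ 𝔥) :=
  simpleSystem (P ∩ evenRoots 𝔥)

/-- `θ α = α`, where `(θ α)(H) = α(θ H)`: the root is imaginary. -/
def IsImaginary (θ : 𝔤₀ →ₗ⁅ℂ⁆ 𝔤₀) (𝔥 : LieSubalgebra ℂ 𝔤₀) (α : Dual ℂ 𝔥) : Prop :=
  ∀ H H' : 𝔥, (H' : 𝔤₀) = θ H → α H' = α H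

/-- The painted vertices of the Vogan diagram: the even simple roots that are fixed by `θ` and
noncompact, i.e. whose root space lies in the `-1` eigenspace of `θ`. Odd vertices are not painted. -/
def painted (θ : 𝔤₀ →ₗ⁅ℂ⁆ 𝔤₀) (𝔥 : LieSubalgebra ℂ 𝔤₀) (P : Set (Dual ℂ 𝔥)) :
    Set (Dual ℂ 𝔥) :=
  {α | α ∈ evenSimple 𝔥 P ∧ IsImaginary θ 𝔥 α ∧
    ∀ x ∈ LieModule.weightSpace 𝔤₀ (α : 𝔥 → ℂ), θ x = -x}

/-- The automorphism of the Vogan diagram induced by `θ` is the identity. -/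
def TrivialAutomorphism (θ : 𝔤₀ →ₗ⁅ℂ⁆ 𝔤₀) (𝔥 : LieSubalgebra ℂ 𝔤₀) (P : Set (Dual ℂ 𝔥)) : Prop :=
  ∀ α ∈ evenSimple 𝔥 P, IsImaginary θ 𝔥 α

namespace RealForm

variable {S : LieSuperalgebra ℂ 𝔤₀ 𝔤₁}

/-- `θ` is (the complex linear extension of) a Cartan involution of the even part of the real form,
a reductive real Lie algebra: an involution such that `-κ(x, θ x) > 0` for every real `x` outside
the center, `κ` being the Killing form. -/
structure IsCartanInvolution (C : S.RealForm) (θ : 𝔤₀ →ₗ⁅ℂ⁆ 𝔤₀) : Prop where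
  involutive : ∀ x, θ (θ x) = x
  comm_conj : ∀ x, θ (C.conj₀ x) = C.conj₀ (θ x)
  definite : ∀ x, C.conj₀ x = x → x ∉ LieAlgebra.center ℂ 𝔤₀ → 0 < -(killingForm ℂ 𝔤₀ x (θ x)).re

/-- `𝔥` is the complexification of a `θ`-stable Cartan subalgebra of the even part of the real
form. -/
structure IsStableCartan (C : S.RealForm) (θ : 𝔤₀ →ₗ⁅ℂ⁆ 𝔤₀) (𝔥 : LieSubalgebra ℂ 𝔤₀) : Prop where
  cartan : 𝔥.IsCartanSubalgebra
  conj_mem : ∀ x ∈ 𝔥, C.conj₀ x ∈ 𝔥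
  theta_mem : ∀ x ∈ 𝔥, θ x ∈ 𝔥

/-- The compact part `𝔱₀` of the real Cartan subalgebra `𝔥₀ = 𝔱₀ ⊕ 𝔞₀`. -/
def compactPart (C : S.RealForm) (θ : 𝔤₀ →ₗ⁅ℂ⁆ 𝔤₀) (𝔥 : LieSubalgebra ℂ 𝔤₀) :
    Submodule ℝ 𝔤₀ where
  carrier := {x | x ∈ 𝔥 ∧ C.conj₀ x = x ∧ θ x = x}
  add_mem' := by
    rintro x y ⟨h1, h2, h3⟩ ⟨h4, h5, h6⟩
    exact ⟨add_mem h1 h4, by rw [map_add, h2, h5], by rw [map_add, h3, h6]⟩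
  zero_mem' := ⟨zero_mem _, map_zero _, map_zero _⟩
  smul_mem' := by
    rintro t x ⟨h1, h2, h3⟩
    rw [← Complex.coe_smul]
    exact ⟨𝔥.smul_mem _ h1, by rw [map_smulₛₗ, h2, Complex.conj_ofReal],
      by rw [map_smul, h3]⟩

/-- `𝔥₀` is a maximally compact `θ`-stable Cartan subalgebra: its compact dimension is as large as
possible. -/
structure IsMaximallyCompact (C : S.RealForm) (θ : 𝔤₀ →ₗ⁅ℂ⁆ 𝔤₀) (𝔥 : LieSubalgebra ℂ 𝔤₀) :
    Prop extends C.IsStableCartan θ 𝔥 where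
  maximal : ∀ 𝔥' : LieSubalgebra ℂ 𝔤₀, C.IsStableCartan θ 𝔥' →
    finrank ℝ (C.compactPart θ 𝔥') ≤ finrank ℝ (C.compactPart θ 𝔥)

/-- The even roots in `P` are the positive ones for a lexicographic order that takes `i𝔱₀` before
`𝔞₀`: the values on `i𝔱₀` decide, and only for roots that vanish on `i𝔱₀` those on `𝔞₀`. As there are
finitely many roots, the lexicographic comparison along a basis of `i𝔱₀` is the comparison of the
values at one element `T` of `i𝔱₀` at which no root vanishes that does not vanish on `i𝔱₀`. -/
def TakesCompactFirst (C : S.RealForm) (θ : 𝔤₀ →ₗ⁅ℂ⁆ 𝔤₀) (𝔥 : LieSubalgebra ℂ 𝔤₀)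
    (P : Set (Dual ℂ 𝔥)) : Prop :=
  ∃ T A : 𝔥, (C.conj₀ T = -T ∧ θ T = T) ∧ (C.conj₀ A = A ∧ θ A = -A) ∧
    (∀ α ∈ evenRoots 𝔥, (α T).re = 0 →
      ∀ T' : 𝔥, C.conj₀ T' = -T' → θ T' = T' → α T' = 0) ∧
    ∀ α ∈ evenRoots 𝔥, α ∈ P ↔ (0 < (α T).re ∨ ((α T).re = 0 ∧ 0 < (α A).re))

/-- A triple `(𝔤_C, 𝔥₀, Δ⁺)`, to which a Vogan diagram is attached: `𝔥₀` is a maximally compact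
`θ`-stable Cartan subalgebra of the even part of the real form, and `Δ⁺` is a positive system of the
roots of `(𝔤, 𝔥)` whose even part takes `i𝔱₀` before `𝔞₀`. -/
structure IsTriple (C : S.RealForm) (θ : 𝔤₀ →ₗ⁅ℂ⁆ 𝔤₀) (𝔥 : LieSubalgebra ℂ 𝔤₀)
    (P : Set (Dual ℂ 𝔥)) : Prop where
  maximallyCompact : C.IsMaximallyCompact θ 𝔥
  positive : IsPositiveSystem (evenRoots 𝔥 ∪ oddRoots 𝔤₁ 𝔥) P
  compactFirst : C.TakesCompactFirst θ 𝔥 P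

end RealForm

/-! ### Even parts and the normalized dual basis -/

/-- `H` is the coroot of the even root `α`: it lies in `[𝔤_α, 𝔤_{-α}]` and `α(H) = 2`. -/
def IsCoroot (𝔥 : LieSubalgebra ℂ 𝔤₀) (α : Dual ℂ 𝔥) (H : 𝔥) : Prop :=
  α H = 2 ∧ ∃ e ∈ LieModule.weightSpace 𝔤₀ (α : 𝔥 → ℂ),
    ∃ f ∈ LieModule.weightSpace 𝔤₀ ((-α : Dual ℂ 𝔥) : 𝔥 → ℂ), ⁅e, f⁆ = (H : 𝔤₀)

/-- Two even simple roots belong to the same even part, i.e. to the same simple ideal of `𝔤₀`: they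
lie in the same connected component of the Dynkin diagram of `𝔤₀`. -/
def SamePart (𝔥 : LieSubalgebra ℂ 𝔤₀) (P : Set (Dual ℂ 𝔥)) : Dual ℂ 𝔥 → Dual ℂ 𝔥 → Prop :=
  Relation.ReflTransGen fun α β =>
    α ∈ evenSimple 𝔥 P ∧ β ∈ evenSimple 𝔥 P ∧ ∃ H, IsCoroot 𝔥 α H ∧ β H ≠ 0

/-- Let `A = (α_k(h_j))_{j,k}` be the Cartan matrix of the even simple roots (`h_j` the coroots).
`ε` is a positive diagonal matrix such that `S = ε A` is symmetric, `B` is the bilinear form with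
Gram matrix `S` in the even simple roots, and the `ω_j` are the elements of the real span of the
even simple roots with `⟨ω_j, α_k⟩ = ω_j(h_k) = δ_{jk} / ε_{kk}`. -/
structure IsNormalizedDualBasis (𝔥 : LieSubalgebra ℂ 𝔤₀) (P : Set (Dual ℂ 𝔥))
    (ε : Dual ℂ 𝔥 → ℝ) (B : LinearMap.BilinForm ℝ (Dual ℂ 𝔥)) (ω : Dual ℂ 𝔥 → Dual ℂ 𝔥) :
    Prop where
  pos : ∀ α ∈ evenSimple 𝔥 P, 0 < ε α
  symm : ∀ α ∈ evenSimple 𝔥 P, ∀ β ∈ evenSimple 𝔥 P, B α β = B β α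
  gram : ∀ α ∈ evenSimple 𝔥 P, ∀ β ∈ evenSimple 𝔥 P, ∀ H, IsCoroot 𝔥 α H →
    ((B α β : ℝ) : ℂ) = ε α * β H
  mem_span : ∀ α ∈ evenSimple 𝔥 P, ω α ∈ Submodule.span ℝ (evenSimple 𝔥 P)
  dual_self : ∀ α ∈ evenSimple 𝔥 P, ∀ H, IsCoroot 𝔥 α H → ω α H = 1 / ε α
  dual_ne : ∀ α ∈ evenSimple 𝔥 P, ∀ β ∈ evenSimple 𝔥 P, α ≠ β → ∀ H, IsCoroot 𝔥 β H → ω α H = 0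

end Vogan

end LieSuperalgebra

end

/-! This is the theorem of Borel and de Siebenthal for the reductive algebra `𝔤₀`, followed by a
count of simple ideals and, for `D(2,n)`, a rearrangement of the odd roots.

An even root fixed by `θ` is compact or noncompact. This parity is additive, because the bracket of
root vectors for two roots whose sum is a root does not vanish. Hence there are `θ`-fixed vectors
`v` in the real span of the even roots whose inner products with the fixed roots are integers, odd
exactly at the noncompact ones (`parityVectors_nonempty`), and among them there is a shortest one
(`exists_minimal_parityVector`). Since `v` is `θ`-fixed, an element of `i𝔱₀` represents it. A
positive system that looks at `v` before anything else therefore still takes `i𝔱₀` before `𝔞₀`, and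
it makes `v` dominant (`exists_isAdapted`).

Let `i` be a fixed simple root with dual vector `ω i`. Then `v - 2 ω i` has the same parities as
`v`, and minimality of `v` gives `(v - ω i, ω i) ≤ 0` (`minimal_dual_le`). If `i` is painted, then
`v - ω i` is dominant. A second painted `j` in the same component would give `(v - ω i, ω i) ≥ (ω j,
ω i) > 0`, a contradiction (`eq_of_odd_of_connected`). For any fixed `j` one gets `(ω i, ω j) ≤ (v,
ω j) ≤ (ω j, ω j)`, which is the required inequality (`dual_sub_dual_le`).

The numerical bounds count components: each component needs a simple ideal of its own
(`encard_le_card_of_not_samePart`). There are at most two such ideals for `A(m,n)` and for `D(m,n)`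
with `m ≥ 3`, and at most three for `D(2,n)`, where `so(4)` splits, and for `D(2,1;α)`.

For `D(2,n)` let `α` be a simple root of one of the two `sl₂` in `so(4)`. Its coroot kills all even
roots except `±α` and has only the eigenvalues `±1` on `𝔤₁`. A large multiple of evaluation at this
coroot, added to the functional, does not change the positive even roots but makes `α` a sum of two
positive odd roots. So `α` is not in `Π'`, and only two other parts are left
(`IsTypeD.exists_functional`).

The root theory rests on a splitting of `𝔤₀` into its center and an ideal with nondegenerate Killing
form. Definiteness of the Cartan involution makes the radical of the Killing form central, and the
invariant form on `𝔤₀` makes the sum direct. -/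

open Module

noncomputable section

/-! ### Finite root sets in a real vector space with a semidefinite form -/

/-- A finite set `R = -R` of nonzero vectors, on whose span the semidefinite form `b` is definite,
such that `α - β ∈ R` for any distinct `α, β ∈ R` that make an acute angle. -/
structure IsRootSet {V : Type*} [AddCommGroup V] [Module ℝ V] (b : LinearMap.BilinForm ℝ V)
    (R : Set V) : Prop where
  finite : R.Finite
  symm : ∀ x y, b x y = b y x
  nonneg : ∀ x, 0 ≤ b x x
  definite : ∀ x ∈ Submodule.span ℝ R, b x x = 0 → x = 0
  ne_zero : ∀ α ∈ R, α ≠ 0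
  neg_mem : ∀ α ∈ R, -α ∈ R
  sub_mem : ∀ α ∈ R, ∀ β ∈ R, 0 < b α β → α ≠ β → α - β ∈ R

namespace IsRootSet

open LieSuperalgebra (simpleSystem)

variable {V : Type*} [AddCommGroup V] [Module ℝ V] {b : LinearMap.BilinForm ℝ V} {R : Set V}

/-- The positive roots with respect to a linear functional. -/
def posRoots (R : Set V) (f : V →ₗ[ℝ] ℝ) : Set V := {α | α ∈ R ∧ 0 < f α}

/-- The simple roots with respect to a linear functional. -/
def simpleRoots (R : Set V) (f : V →ₗ[ℝ] ℝ) : Set V := simpleSystem (posRoots R f)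

variable {f : V →ₗ[ℝ] ℝ}

theorem simpleRoots_subset : simpleRoots R f ⊆ R := fun _ h => h.1.1

theorem pos_of_mem_simpleRoots {α : V} (h : α ∈ simpleRoots R f) : 0 < f α := h.1.2

/-- A positive root that is not simple splits into two positive roots at which `f` is smaller, and
there are only finitely many positive roots. -/
theorem posRoots_induction (hR : IsRootSet b R) {p : V → Prop}
    (simple : ∀ α ∈ simpleRoots R f, p α)
    (add : ∀ β ∈ posRoots R f, ∀ γ ∈ posRoots R f, β + γ ∈ posRoots R f → p β → p γ → p (β + γ)) :
    ∀ β ∈ posRoots R f, p β := by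
  have hfin : (posRoots R f).Finite := hR.finite.subset fun _ h => h.1
  let r : V → V → Prop := fun x y => f x < f y
  have : IsStrictOrder V r :=
    { irrefl := fun x => lt_irrefl (f x)
      trans := fun _ _ _ h1 h2 => lt_trans (show f _ < f _ from h1) h2 }
  have hwf : (posRoots R f).WellFoundedOn r := hfin.wellFoundedOn
  intro β hβ
  refine hwf.induction hβ fun α hα ih => ?_
  by_cases hs : α ∈ simpleRoots R f
  · exact simple α hs
  · have : ∃ β ∈ posRoots R f, ∃ γ ∈ posRoots R f, α = β + γ := by
      by_contra hcon
      push Not at hcon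
      exact hs ⟨hα, hcon⟩
    obtain ⟨β, hβ, γ, hγ, rfl⟩ := this
    have h1 := hβ.2
    have h2 := hγ.2
    refine add β hβ γ hγ hα (ih β hβ ?_) (ih γ hγ ?_) <;> simp only [r, map_add] <;> linarith

theorem mem_closure_simpleRoots (hR : IsRootSet b R) :
    ∀ β ∈ posRoots R f, β ∈ AddSubmonoid.closure (simpleRoots R f) :=
  hR.posRoots_induction (fun _ h => AddSubmonoid.subset_closure h)
    fun _ _ _ _ _ h1 h2 => add_mem h1 h2

theorem pos_or_neg_mem (hR : IsRootSet b R) (hf : ∀ α ∈ R, f α ≠ 0) {α : V} (hα : α ∈ R) :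
    α ∈ posRoots R f ∨ -α ∈ posRoots R f := by
  rcases lt_or_gt_of_ne (hf α hα) with h | h
  · exact Or.inr ⟨hR.neg_mem α hα, by rw [map_neg]; linarith⟩
  · exact Or.inl ⟨hα, h⟩

theorem span_simpleRoots (hR : IsRootSet b R) (hf : ∀ α ∈ R, f α ≠ 0) :
    Submodule.span ℝ (simpleRoots R f) = Submodule.span ℝ R := by
  apply le_antisymm (Submodule.span_mono simpleRoots_subset)
  have key : ∀ β ∈ posRoots R f, β ∈ Submodule.span ℝ (simpleRoots R f) :=
    hR.posRoots_induction (fun _ h => Submodule.subset_span h)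
      fun _ _ _ _ _ h1 h2 => add_mem h1 h2
  rw [Submodule.span_le]
  intro α hα
  rcases hR.pos_or_neg_mem hf hα with h | h
  · exact key α h
  · exact (Submodule.neg_mem_iff _).1 (key _ h)

/-- Otherwise the difference of the two would be a root, and adding it or its negative to one of
them would write a simple root as a sum of two positive roots. -/
theorem obtuse (hR : IsRootSet b R) (hf : ∀ α ∈ R, f α ≠ 0) {α β : V}
    (hα : α ∈ simpleRoots R f) (hβ : β ∈ simpleRoots R f) (hne : α ≠ β) : b α β ≤ 0 := by
  by_contra! h
  have hm := hR.sub_mem α hα.1.1 β hβ.1.1 h hne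
  rcases hR.pos_or_neg_mem hf hm with h1 | h1
  · exact hα.2 β hβ.1 _ h1 (by abel)
  · exact hβ.2 α hα.1 _ h1 (by abel)

/-- A dominant combination of simple roots has nonnegative coefficients. Linear independence is not
assumed here; it is a consequence. Split the combination as `u - w` by the signs of the
coefficients. Dominance gives `(u - w, w) ≥ 0`, obtuseness gives `(u, w) ≤ 0`, so `w = 0`. -/
theorem coeff_nonneg (hR : IsRootSet b R) (hf : ∀ α ∈ R, f α ≠ 0) {s : Finset V}
    (hs : ∀ k ∈ s, k ∈ simpleRoots R f) {y : V → ℝ}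
    (hy : ∀ k ∈ s, 0 ≤ b (∑ i ∈ s, y i • i) k) : ∀ k ∈ s, 0 ≤ y k := by
  set u := ∑ i ∈ s, (y i)⁺ • i with hu
  set w := ∑ i ∈ s, (y i)⁻ • i with hw
  have hv : ∑ i ∈ s, y i • i = u - w := by
    rw [hu, hw, ← Finset.sum_sub_distrib]
    exact Finset.sum_congr rfl fun i _ => by rw [← sub_smul, posPart_sub_negPart]
  have hmem : w ∈ Submodule.span ℝ R :=
    Submodule.sum_mem _ fun i hi => Submodule.smul_mem _ _
      (Submodule.subset_span (simpleRoots_subset (hs i hi)))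
  have h1 : 0 ≤ b (u - w) w := by
    rw [← hv, hw, map_sum]
    refine Finset.sum_nonneg fun k hk => ?_
    rw [map_smul, smul_eq_mul]
    exact mul_nonneg (negPart_nonneg _) (hy k hk)
  have h2 : b u w ≤ 0 := by
    rw [hu, hw, map_sum b, LinearMap.sum_apply]
    refine Finset.sum_nonpos fun i hi => ?_
    rw [map_sum]
    refine Finset.sum_nonpos fun j hj => ?_
    rw [map_smul, map_smul, LinearMap.smul_apply, smul_eq_mul, smul_eq_mul]
    by_cases hij : i = j
    · subst hij
      have : (y i)⁻ * (y i)⁺ = 0 := by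
        rcases le_total 0 (y i) with h | h
        · rw [negPart_of_nonneg h, zero_mul]
        · rw [posPart_of_nonpos h, mul_zero]
      rw [← mul_assoc, this, zero_mul]
    · have := hR.obtuse hf (hs i hi) (hs j hj) hij
      have h3 := mul_nonneg (negPart_nonneg (y j)) (posPart_nonneg (y i))
      rw [← mul_assoc]
      exact mul_nonpos_of_nonneg_of_nonpos h3 this
  have h3 : b w w = 0 := by
    rw [map_sub, LinearMap.sub_apply] at h1
    exact le_antisymm (by linarith) (hR.nonneg w)
  -- Since `f` is positive at every simple root, `f w = 0` forces each negative part to vanish.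
  have h4 : f w = 0 := by rw [hR.definite w hmem h3, map_zero]
  rw [hw, map_sum] at h4
  have h5 := (Finset.sum_eq_zero_iff_of_nonneg fun i hi => by
    rw [map_smul, smul_eq_mul]
    exact mul_nonneg (negPart_nonneg _) (pos_of_mem_simpleRoots (hs i hi)).le).1 h4
  intro k hk
  have h6 := h5 k hk
  rw [map_smul, smul_eq_mul, mul_eq_zero] at h6
  exact negPart_eq_zero.1 (h6.resolve_right (pos_of_mem_simpleRoots (hs k hk)).ne')

/-- The zero vector is dominant, so the coefficients of a relation are nonnegative, and so are those
of its negative. -/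
theorem linearIndependent (hR : IsRootSet b R) (hf : ∀ α ∈ R, f α ≠ 0) :
    LinearIndependent ℝ ((↑) : simpleRoots R f → V) := by
  change LinearIndepOn ℝ id (simpleRoots R f)
  rw [linearIndepOn_iff']
  intro s g hs h0 i hi
  simp only [id] at h0
  have key : ∀ g : V → ℝ, ∑ i ∈ s, g i • i = 0 → 0 ≤ g i := fun g h =>
    hR.coeff_nonneg hf (fun k hk => hs hk) (fun k _ => by rw [h, map_zero]; simp) i hi
  refine le_antisymm ?_ (key g h0)
  have := key (-g) (by simp [h0])
  simpa using this

/-- `ω` is a family dual to the simple roots. -/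
structure IsDualFamily (b : LinearMap.BilinForm ℝ V) (S : Set V) (ω : V → V) : Prop where
  mem_span : ∀ i ∈ S, ω i ∈ Submodule.span ℝ S
  self : ∀ i ∈ S, b (ω i) i = 1
  ne : ∀ i ∈ S, ∀ k ∈ S, i ≠ k → b (ω i) k = 0

/-- The form is definite, hence nondegenerate, on the span of the simple roots, so the coordinate
functionals of this basis are represented by vectors of the span. -/
theorem exists_isDualFamily (hR : IsRootSet b R) (hf : ∀ α ∈ R, f α ≠ 0) :
    ∃ ω, IsDualFamily b (simpleRoots R f) ω := by
  classical
  have hli := hR.linearIndependent hf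
  have hfin : (simpleRoots R f).Finite := hR.finite.subset simpleRoots_subset
  have := hfin.to_subtype
  set W := Submodule.span ℝ (Set.range ((↑) : simpleRoots R f → V)) with hW
  have hWR : W ≤ Submodule.span ℝ R := by
    rw [hW, Subtype.range_coe]; exact Submodule.span_mono simpleRoots_subset
  have : FiniteDimensional ℝ W := FiniteDimensional.span_of_finite ℝ (Set.finite_range _)
  have hnd : (b.restrict W).Nondegenerate := by
    refine ⟨fun x hx => ?_, fun x hx => ?_⟩ <;>
    · exact Subtype.ext (hR.definite x (hWR x.2) (hx x))
  let B : Basis (simpleRoots R f) ℝ W := Basis.span hli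
  let ω : V → V := fun i => if h : i ∈ simpleRoots R f then
    (((b.restrict W).toDual hnd).symm (B.coord ⟨i, h⟩) : V) else 0
  have key : ∀ i (hi : i ∈ simpleRoots R f) k (hk : k ∈ simpleRoots R f),
      b (ω i) k = B.coord ⟨i, hi⟩ (B ⟨k, hk⟩) := by
    intro i hi k hk
    have h1 := LinearMap.BilinForm.apply_toDual_symm_apply (hB := hnd) (B.coord ⟨i, hi⟩)
      (B ⟨k, hk⟩)
    rw [← h1]
    simp only [ω, dif_pos hi, LinearMap.BilinForm.restrict_apply]
    exact congrArg _ (Subtype.ext_iff.1 (Basis.span_apply hli ⟨k, hk⟩)).symm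
  refine ⟨ω, fun i hi => ?_, fun i hi => ?_, fun i hi k hk hne => ?_⟩
  · simp only [ω, dif_pos hi]
    have hWS : W ≤ Submodule.span ℝ (simpleRoots R f) := by rw [hW, Subtype.range_coe]
    exact hWS (((b.restrict W).toDual hnd).symm (B.coord ⟨i, hi⟩)).2
  · rw [key i hi i hi]; simp
  · rw [key i hi k hk]
    simp only [Basis.coord_apply, Basis.repr_self]
    rw [Finsupp.single_apply, if_neg]
    simpa using Ne.symm hne

/-! ### Coefficients, dominance and dual vectors -/

section Dual

variable {ω : V → V} (hR : IsRootSet b R) (hf : ∀ α ∈ R, f α ≠ 0)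
  (hω : IsDualFamily b (simpleRoots R f) ω) {s : Finset V} (hs : (s : Set V) = simpleRoots R f)

include hω hs in
theorem sum_dual {v : V} (hv : v ∈ Submodule.span ℝ (simpleRoots R f)) :
    v = ∑ k ∈ s, b (ω k) v • k := by
  induction hv using Submodule.span_induction with
  | mem x hx =>
    have hx' : x ∈ s := by rw [← Finset.mem_coe, hs]; exact hx
    rw [Finset.sum_eq_single_of_mem x hx']
    · rw [hω.self x hx, one_smul]
    · intro k hk hne
      rw [← Finset.mem_coe, hs] at hk
      rw [hω.ne k hk x hx hne, zero_smul]
  | zero => simp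
  | add x y _ _ hx hy =>
    simp only [map_add, add_smul, Finset.sum_add_distrib]
    rw [← hx, ← hy]
  | smul c x _ hx =>
    simp only [map_smul, smul_assoc]
    rw [← Finset.smul_sum, ← hx]

include hR hf hω in
theorem dual_nonneg_of_dominant {v : V} (hv : v ∈ Submodule.span ℝ (simpleRoots R f))
    (hdom : ∀ k ∈ simpleRoots R f, 0 ≤ b v k) : ∀ k ∈ simpleRoots R f, 0 ≤ b (ω k) v := by
  have hfin : (simpleRoots R f).Finite := hR.finite.subset simpleRoots_subset
  have hs : (hfin.toFinset : Set V) = simpleRoots R f := hfin.coe_toFinset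
  intro k hk
  refine hR.coeff_nonneg hf (s := hfin.toFinset) (y := fun k => b (ω k) v)
    (fun k hk => by simpa using hk) (fun j hj => ?_) k (by simpa using hk)
  rw [← sum_dual hω hs hv]
  exact hdom j (by simpa using hj)

include hR hf hω in
-- Positivity of the coefficients spreads along edges. If the coefficient at `k` is positive and the
-- one at a neighbour `j` vanishes, then `(v, j)` is a sum of nonpositive terms with a negative one
-- at `k`, against dominance.
theorem dual_pos_of_dominant {v : V} (hv : v ∈ Submodule.span ℝ (simpleRoots R f))
    (hdom : ∀ k ∈ simpleRoots R f, 0 ≤ b v k) {i j : V} (hi : 0 < b (ω i) v)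
    (hij : Relation.ReflTransGen
      (fun x y => x ∈ simpleRoots R f ∧ y ∈ simpleRoots R f ∧ b x y ≠ 0) i j) :
    0 < b (ω j) v := by
  have hfin : (simpleRoots R f).Finite := hR.finite.subset simpleRoots_subset
  have hs : (hfin.toFinset : Set V) = simpleRoots R f := hfin.coe_toFinset
  have hnn := hR.dual_nonneg_of_dominant hf hω hv hdom
  induction hij with
  | refl => exact hi
  | @tail k j _ h ih =>
    obtain ⟨hk, hj, hne⟩ := h
    refine lt_of_le_of_ne (hnn j hj) fun h0 => ?_
    have hkj : k ≠ j := by rintro rfl; exact ih.ne h0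
    have h1 : b v j < 0 := by
      conv_lhs => rw [sum_dual hω hs hv]
      rw [map_sum, LinearMap.sum_apply]
      refine Finset.sum_neg' (fun m hm => ?_) ⟨k, by simpa using hk, ?_⟩
      · have hm' : m ∈ simpleRoots R f := by simpa using hm
        rw [map_smul, LinearMap.smul_apply, smul_eq_mul]
        by_cases hmj : m = j
        · rw [hmj, ← h0, zero_mul]
        · exact mul_nonpos_of_nonneg_of_nonpos (hnn m hm') (hR.obtuse hf hm' hj hmj)
      · rw [map_smul, LinearMap.smul_apply, smul_eq_mul]
        exact mul_neg_of_pos_of_neg ih (lt_of_le_of_ne (hR.obtuse hf hk hj hkj) hne)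
    exact absurd (hdom j hj) (not_le.2 h1)

include hω in
theorem dual_dominant {i : V} (hi : i ∈ simpleRoots R f) :
    ∀ k ∈ simpleRoots R f, 0 ≤ b (ω i) k := by
  intro k hk
  by_cases h : i = k
  · subst h; rw [hω.self i hi]; exact zero_le_one
  · rw [hω.ne i hi k hk h]

include hR hf hω in
theorem dual_dual_nonneg {i j : V} (hi : i ∈ simpleRoots R f) (hj : j ∈ simpleRoots R f) :
    0 ≤ b (ω i) (ω j) :=
  hR.dual_nonneg_of_dominant hf hω (hω.mem_span j hj) (dual_dominant hω hj) i hi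

include hR hω in
theorem dual_self_pos {i : V} (hi : i ∈ simpleRoots R f) : 0 < b (ω i) (ω i) := by
  refine lt_of_le_of_ne (hR.nonneg _) fun h => ?_
  have h1 := hR.definite _ (Submodule.span_mono simpleRoots_subset (hω.mem_span i hi)) h.symm
  have h2 := hω.self i hi
  rw [h1, map_zero] at h2
  simp at h2

include hR hf hω in
theorem dual_dual_pos {i j : V} (hi : i ∈ simpleRoots R f)
    (hij : Relation.ReflTransGen
      (fun x y => x ∈ simpleRoots R f ∧ y ∈ simpleRoots R f ∧ b x y ≠ 0) i j) :
    0 < b (ω j) (ω i) :=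
  hR.dual_pos_of_dominant hf hω (hω.mem_span i hi) (dual_dominant hω hi)
    (hR.dual_self_pos hω hi) hij

include hω in
theorem dual_natCast {i β : V} (hi : i ∈ simpleRoots R f)
    (hβ : β ∈ AddSubmonoid.closure (simpleRoots R f)) : ∃ n : ℕ, b (ω i) β = n := by
  induction hβ using AddSubmonoid.closure_induction with
  | mem x hx =>
    by_cases h : i = x
    · subst h; exact ⟨1, by rw [hω.self i hi, Nat.cast_one]⟩
    · exact ⟨0, by rw [hω.ne i hi x hx h, Nat.cast_zero]⟩
  | zero => exact ⟨0, by simp⟩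
  | add x y _ _ hx hy =>
    obtain ⟨n, hn⟩ := hx
    obtain ⟨m, hm⟩ := hy
    exact ⟨n + m, by rw [map_add, hn, hm, Nat.cast_add]⟩

include hR hf hω in
theorem dual_intCast {i β : V} (hi : i ∈ simpleRoots R f) (hβ : β ∈ R) :
    ∃ n : ℤ, b (ω i) β = n := by
  rcases hR.pos_or_neg_mem hf hβ with h | h
  · obtain ⟨n, hn⟩ := dual_natCast hω hi (hR.mem_closure_simpleRoots β h)
    exact ⟨n, by rw [hn, Int.cast_natCast]⟩
  · obtain ⟨n, hn⟩ := dual_natCast hω hi (hR.mem_closure_simpleRoots _ h)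
    rw [map_neg] at hn
    exact ⟨-n, by push_cast; linarith⟩

include hR in
theorem eq_of_forall_simple_eq {x y : V} (hx : x ∈ Submodule.span ℝ (simpleRoots R f))
    (hy : y ∈ Submodule.span ℝ (simpleRoots R f)) (h : ∀ k ∈ simpleRoots R f, b x k = b y k) :
    x = y := by
  have hm := Submodule.sub_mem _ hx hy
  have key : ∀ v ∈ Submodule.span ℝ (simpleRoots R f), b (x - y) v = 0 := by
    intro v hv
    induction hv using Submodule.span_induction with
    | mem k hk => rw [map_sub, LinearMap.sub_apply, h k hk, sub_self]
    | zero => simp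
    | add u w _ _ hu hw => rw [map_add, hu, hw, add_zero]
    | smul c u _ hu => rw [map_smul, hu, smul_zero]
  exact sub_eq_zero.1
    (hR.definite _ (Submodule.span_mono simpleRoots_subset hm) (key _ hm))

end Dual

end IsRootSet

namespace IsRootSet

variable {V : Type*} [AddCommGroup V] [Module ℝ V] {b : LinearMap.BilinForm ℝ V} {R : Set V}
  {f : V →ₗ[ℝ] ℝ}

/-! ### Root sets with an involution and a parity on the fixed roots -/

/-- The parity lives on the fixed roots only, so a parity vector has to be built from the simple
roots of this subsystem, which need not be simple in `R`. -/
theorem fixed (hR : IsRootSet b R) (θ : V →ₗ[ℝ] V) : IsRootSet b {β | β ∈ R ∧ θ β = β} where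
  finite := hR.finite.subset fun _ h => h.1
  symm := hR.symm
  nonneg := hR.nonneg
  definite x hx := hR.definite x (Submodule.span_mono (fun _ h => h.1) hx)
  ne_zero α hα := hR.ne_zero α hα.1
  neg_mem α hα := ⟨hR.neg_mem α hα.1, by rw [map_neg, hα.2]⟩
  sub_mem α hα β hβ h hne := ⟨hR.sub_mem α hα.1 β hβ.1 h hne, by rw [map_sub, hα.2, hβ.2]⟩

/-- The `θ`-fixed vectors whose inner products with the `θ`-fixed roots are integers, with the
parity prescribed by `p`. -/
def parityVectors (b : LinearMap.BilinForm ℝ V) (R : Set V) (θ : V →ₗ[ℝ] V) (p : V → Prop) :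
    Set V :=
  {v | v ∈ Submodule.span ℝ R ∧ θ v = v ∧ ∀ β ∈ R, θ β = β → ∃ n : ℤ, b v β = n ∧ (Odd n ↔ p β)}

/-- The sum of the dual vectors of the odd simple roots of the fixed subsystem has the right parity
at the simple roots. Additivity of `p` carries it to the positive fixed roots, and invariance under
negation to all fixed roots. -/
theorem parityVectors_nonempty (hR : IsRootSet b R) (hf : ∀ α ∈ R, f α ≠ 0) (θ : V →ₗ[ℝ] V)
    (p : V → Prop) (hneg : ∀ β ∈ R, θ β = β → (p (-β) ↔ p β))
    (hadd : ∀ β ∈ R, ∀ γ ∈ R, θ β = β → θ γ = γ → β + γ ∈ R → (p (β + γ) ↔ ¬(p β ↔ p γ))) :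
    (parityVectors b R θ p).Nonempty := by
  classical
  set R' : Set V := {β | β ∈ R ∧ θ β = β} with hR'def
  have hR' : IsRootSet b R' := hR.fixed θ
  have hf' : ∀ α ∈ R', f α ≠ 0 := fun α hα => hf α hα.1
  obtain ⟨ω, hω⟩ := hR'.exists_isDualFamily hf'
  have hfin : (simpleRoots R' f).Finite := hR'.finite.subset simpleRoots_subset
  set v := ∑ i ∈ hfin.toFinset, (if p i then (1 : ℝ) else 0) • ω i with hv
  have hvspan : v ∈ Submodule.span ℝ R' :=
    Submodule.sum_mem _ fun i hi => Submodule.smul_mem _ _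
      (Submodule.span_mono simpleRoots_subset (hω.mem_span i (by simpa using hi)))
  have hθv : θ v = v := by
    clear_value v
    clear hv
    induction hvspan using Submodule.span_induction with
    | mem x hx => exact hx.2
    | zero => simp
    | add x y _ _ hx hy => rw [map_add, hx, hy]
    | smul c x _ hx => rw [map_smul, hx]
  have hsimple : ∀ k ∈ simpleRoots R' f, b v k = if p k then 1 else 0 := by
    intro k hk
    have hk' : k ∈ hfin.toFinset := by simpa using hk
    rw [hv, map_sum, LinearMap.sum_apply, Finset.sum_eq_single_of_mem k hk']
    · rw [map_smul, LinearMap.smul_apply, hω.self k hk, smul_eq_mul, mul_one]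
    · intro i hi hne
      rw [map_smul, LinearMap.smul_apply, hω.ne i (by simpa using hi) k hk hne, smul_zero]
  have hpos : ∀ β ∈ posRoots R' f, ∃ n : ℤ, b v β = n ∧ (Odd n ↔ p β) := by
    refine hR'.posRoots_induction (fun α hα => ?_) fun β hβ γ hγ hβγ h1 h2 => ?_
    · rw [hsimple α hα]
      by_cases h : p α
      · exact ⟨1, by simp [h]⟩
      · exact ⟨0, by simp [h]⟩
    · obtain ⟨n, hn, hn'⟩ := h1
      obtain ⟨m, hm, hm'⟩ := h2
      refine ⟨n + m, by rw [map_add, hn, hm, Int.cast_add], ?_⟩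
      rw [hadd β hβ.1.1 γ hγ.1.1 hβ.1.2 hγ.1.2 hβγ.1.1, Int.odd_add, ← hn', ← hm',
        ← Int.not_odd_iff_even]
      tauto
  refine ⟨v, Submodule.span_mono (fun _ h => h.1) hvspan, hθv, fun β hβ hθβ => ?_⟩
  rcases hR'.pos_or_neg_mem hf' ⟨hβ, hθβ⟩ with h | h
  · exact hpos β h
  · obtain ⟨n, hn, hn'⟩ := hpos _ h
    refine ⟨-n, by rw [map_neg] at hn; push_cast; linarith, ?_⟩
    rw [← hneg β hβ hθβ, ← hn']
    exact odd_neg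

/-- The integrality and parity conditions cut out a closed subset of a Euclidean space, so some
point is nearest to the origin. The map `ρ` may have a kernel outside the span of the roots, so the
closed set is formed inside the image of the admissible subspace. -/
theorem exists_minimal_parityVector {E : Type*} [NormedAddCommGroup E] [InnerProductSpace ℝ E]
    [FiniteDimensional ℝ E] (ρ : V →ₗ[ℝ] E) (hρ : ∀ x y, b x y = inner ℝ (ρ x) (ρ y))
    (θ : V →ₗ[ℝ] V) (p : V → Prop) (hne : (parityVectors b R θ p).Nonempty) :
    ∃ v ∈ parityVectors b R θ p, ∀ w ∈ parityVectors b R θ p, b v v ≤ b w w := by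
  classical
  set W : Submodule ℝ V := Submodule.span ℝ R ⊓ LinearMap.ker (θ - LinearMap.id) with hW
  have hWmem : ∀ v, v ∈ W ↔ v ∈ Submodule.span ℝ R ∧ θ v = v := by
    intro v
    simp [hW, sub_eq_zero]
  let Z : V → Set ℝ := fun β => {x | ∃ n : ℤ, x = n ∧ (Odd n ↔ p β)}
  have hZ : ∀ β, IsClosed (Z β) := by
    intro β
    have : Z β = ((↑) : ℤ → ℝ) '' {n | Odd n ↔ p β} := by
      ext x; constructor
      · rintro ⟨n, rfl, h⟩; exact ⟨n, h, rfl⟩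
      · rintro ⟨n, h, rfl⟩; exact ⟨n, rfl, h⟩
    rw [this]
    exact Int.isClosedEmbedding_coe_real.isClosedMap _ (isClosed_discrete _)
  let K : Set E := (W.map ρ : Set E) ∩
    ⋂ β ∈ {β | β ∈ R ∧ θ β = β}, (fun e => inner ℝ e (ρ β)) ⁻¹' Z β
  have hK : IsClosed K := by
    refine (Submodule.closed_of_finiteDimensional _).inter
      (isClosed_biInter fun β _ => (hZ β).preimage (by fun_prop))
  have hmem : ∀ v ∈ W, (ρ v ∈ K ↔ v ∈ parityVectors b R θ p) := by
    intro v hv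
    have h1 := (hWmem v).1 hv
    simp only [K, Z, Set.mem_inter_iff, SetLike.mem_coe, Submodule.mem_map, Set.mem_iInter,
      Set.mem_preimage, parityVectors, Set.mem_ofPred_eq, ← hρ]
    constructor
    · rintro ⟨-, h⟩
      exact ⟨h1.1, h1.2, fun β hβ hθ => h β ⟨hβ, hθ⟩⟩
    · rintro ⟨-, -, h⟩
      exact ⟨⟨v, hv, rfl⟩, fun β hβ => h β hβ.1 hβ.2⟩
  have hKne : K.Nonempty := by
    obtain ⟨v, hv⟩ := hne
    exact ⟨ρ v, (hmem v ((hWmem v).2 ⟨hv.1, hv.2.1⟩)).2 hv⟩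
  obtain ⟨e, he, hmin⟩ := hK.exists_infDist_eq_dist hKne 0
  obtain ⟨v, hvW, rfl⟩ := he.1
  refine ⟨v, (hmem v hvW).1 he, fun w hw => ?_⟩
  have hwK : ρ w ∈ K := (hmem w ((hWmem w).2 ⟨hw.1, hw.2.1⟩)).2 hw
  have h1 : dist 0 (ρ v) ≤ dist 0 (ρ w) := hmin ▸ Metric.infDist_le_dist_of_mem hwK
  rw [dist_zero_left, dist_zero_left] at h1
  rw [hρ, hρ, real_inner_self_eq_norm_sq, real_inner_self_eq_norm_sq]
  exact pow_le_pow_left₀ (norm_nonneg _) h1 2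

/-! ### Shortest parity vectors and simple roots -/

section Involution

variable {ω : V → V} (hR : IsRootSet b R) (hf : ∀ α ∈ R, f α ≠ 0)
  (hω : IsDualFamily b (simpleRoots R f) ω) {θ : V →ₗ[ℝ] V} (hθθ : ∀ x, θ (θ x) = x)
  (hbθ : ∀ x y, b (θ x) (θ y) = b x y) (hθR : ∀ α ∈ R, θ α ∈ R)
  (hθS : ∀ k ∈ simpleRoots R f, θ k ∈ posRoots R f ∨ θ k = -k)

include hR hf hω hθθ hθS in
-- The involution need not permute the simple roots, but it preserves the coefficient at a fixed
-- simple root `i`. For `k ≠ i` with `θ k` positive, expand `θ k` in simple roots and apply `θ`. The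
-- coefficient of `k` at `i` is zero and equals a sum of nonnegative terms, one of which is the
-- coefficient of `θ k` at `i`.
theorem dual_apply_involution {i : V} (hi : i ∈ simpleRoots R f) (hθi : θ i = i) :
    ∀ k ∈ simpleRoots R f, b (ω i) (θ k) = b (ω i) k := by
  have hfin : (simpleRoots R f).Finite := hR.finite.subset simpleRoots_subset
  have hs : (hfin.toFinset : Set V) = simpleRoots R f := hfin.coe_toFinset
  have hne : ∀ k ∈ simpleRoots R f, θ k = -k → i ≠ k := by
    rintro k hk h rfl
    rw [hθi] at h
    have h2 : (2 : ℝ) • i = 0 := by rw [two_smul, ← eq_neg_iff_add_eq_zero]; exact h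
    exact hR.ne_zero i (simpleRoots_subset hi) ((smul_eq_zero.1 h2).resolve_left two_ne_zero)
  have hnn : ∀ k ∈ simpleRoots R f, 0 ≤ b (ω i) (θ k) := by
    intro k hk
    rcases hθS k hk with h | h
    · obtain ⟨n, hn⟩ := dual_natCast hω hi (hR.mem_closure_simpleRoots _ h)
      rw [hn]; exact Nat.cast_nonneg n
    · rw [h, map_neg, hω.ne i hi k hk (hne k hk h), neg_zero]
  intro k hk
  by_cases hik : i = k
  · rw [← hik, hθi]
  rw [hω.ne i hi k hk hik]
  rcases hθS k hk with h | h
  · have hspan : θ k ∈ Submodule.span ℝ (simpleRoots R f) := by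
      rw [hR.span_simpleRoots hf]; exact Submodule.subset_span h.1
    have h1 : k = ∑ j ∈ hfin.toFinset, b (ω j) (θ k) • θ j := by
      have := congrArg θ (sum_dual hω hs hspan)
      rw [hθθ, map_sum] at this
      simpa only [map_smul] using this
    have h2 : b (ω i) k = ∑ j ∈ hfin.toFinset, b (ω j) (θ k) * b (ω i) (θ j) := by
      conv_lhs => rw [h1]
      rw [map_sum]
      simp only [map_smul, smul_eq_mul]
    rw [hω.ne i hi k hk hik] at h2
    have h3 : ∀ j ∈ hfin.toFinset, 0 ≤ b (ω j) (θ k) * b (ω i) (θ j) := by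
      intro j hj
      have hj' : j ∈ simpleRoots R f := by simpa using hj
      obtain ⟨n, hn⟩ := dual_natCast hω hj' (hR.mem_closure_simpleRoots _ h)
      exact mul_nonneg (by rw [hn]; exact Nat.cast_nonneg n) (hnn j hj')
    -- Every term vanishes; in the one for `j = i` the second factor is `1` because `θ i = i`.
    have h4 := (Finset.sum_eq_zero_iff_of_nonneg h3).1 h2.symm i (by simpa using hi)
    rwa [hθi, hω.self i hi, mul_one] at h4
  · rw [h, map_neg, hω.ne i hi k hk hik, neg_zero]

include hR hf hω hθθ hbθ hθR hθS in
theorem involution_dual {i : V} (hi : i ∈ simpleRoots R f) (hθi : θ i = i) :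
    θ (ω i) = ω i := by
  have hmap : ∀ v ∈ Submodule.span ℝ (simpleRoots R f),
      θ v ∈ Submodule.span ℝ (simpleRoots R f) := by
    rw [hR.span_simpleRoots hf]
    intro v hv
    induction hv using Submodule.span_induction with
    | mem x hx => exact Submodule.subset_span (hθR x hx)
    | zero => simp
    | add x y _ _ hx hy => rw [map_add]; exact add_mem hx hy
    | smul c x _ hx => rw [map_smul]; exact Submodule.smul_mem _ _ hx
  refine hR.eq_of_forall_simple_eq (hmap _ (hω.mem_span i hi)) (hω.mem_span i hi) fun k hk => ?_
  rw [← hR.dual_apply_involution hf hω hθθ hθS hi hθi k hk, ← hbθ (ω i), hθθ]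

variable {p : V → Prop} {v : V} (hv : v ∈ parityVectors b R θ p)
  (hmin : ∀ w ∈ parityVectors b R θ p, b v v ≤ b w w)

include hR hf hω hθθ hbθ hθR hθS hv hmin in
-- The vector `v - 2 ω i` is again a parity vector: `ω i` is fixed by `θ` and integral on roots, so
-- the inner products change by even integers. Comparing the squared lengths gives the inequality.
theorem minimal_dual_le {i : V} (hi : i ∈ simpleRoots R f) (hθi : θ i = i) :
    b (v - ω i) (ω i) ≤ 0 := by
  have hθω := hR.involution_dual hf hω hθθ hbθ hθR hθS hi hθi
  have hw : v - (2 : ℝ) • ω i ∈ parityVectors b R θ p := by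
    refine ⟨Submodule.sub_mem _ hv.1 (Submodule.smul_mem _ _
      (Submodule.span_mono simpleRoots_subset (hω.mem_span i hi))),
      by rw [map_sub, map_smul, hv.2.1, hθω], fun β hβ hθβ => ?_⟩
    obtain ⟨n, hn, hn'⟩ := hv.2.2 β hβ hθβ
    obtain ⟨m, hm⟩ := hR.dual_intCast hf hω hi hβ
    refine ⟨n - 2 * m, ?_, ?_⟩
    · rw [map_sub, map_smul, LinearMap.sub_apply, LinearMap.smul_apply, hn, hm, smul_eq_mul]
      push_cast; ring
    · rw [← hn', Int.odd_sub]
      simp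
  have h1 := hmin _ hw
  simp only [map_sub, map_smul, LinearMap.sub_apply, LinearMap.smul_apply, smul_eq_mul] at h1 ⊢
  rw [hR.symm (ω i) v] at h1
  linarith

variable (hdom : ∀ α ∈ posRoots R f, 0 ≤ b v α)

include hv hdom in
theorem one_le_of_odd {i : V} (hi : i ∈ simpleRoots R f) (hθi : θ i = i) (hpi : p i) :
    1 ≤ b v i := by
  obtain ⟨n, hn, hn'⟩ := hv.2.2 i (simpleRoots_subset hi) hθi
  have h0 := hdom i hi.1
  rw [hn] at h0 ⊢
  have h1 : (0 : ℤ) ≤ n := by exact_mod_cast h0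
  obtain ⟨m, hm⟩ := hn'.2 hpi
  have : (1 : ℤ) ≤ n := by omega
  exact_mod_cast this

include hR hf hω hv hdom in
-- An odd nonnegative integer is at least `1`, so `v - ω i` is still dominant, and dominant vectors
-- have nonnegative inner products with the dual vectors.
theorem dual_le_of_odd {i j : V} (hi : i ∈ simpleRoots R f) (hθi : θ i = i) (hpi : p i)
    (hj : j ∈ simpleRoots R f) : b (ω i) (ω j) ≤ b v (ω j) := by
  have hspan : v - ω i ∈ Submodule.span ℝ (simpleRoots R f) :=
    Submodule.sub_mem _ (by rw [hR.span_simpleRoots hf]; exact hv.1) (hω.mem_span i hi)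
  have hd : ∀ k ∈ simpleRoots R f, 0 ≤ b (v - ω i) k := by
    intro k hk
    rw [map_sub, LinearMap.sub_apply]
    by_cases hik : i = k
    · subst hik
      have := one_le_of_odd hv hdom hi hθi hpi
      rw [hω.self i hi]; linarith
    · rw [hω.ne i hi k hk hik, sub_zero]; exact hdom k hk.1
  have h1 := hR.dual_nonneg_of_dominant hf hω hspan hd j hj
  rw [map_sub, hR.symm _ v, hR.symm _ (ω i)] at h1
  linarith

include hR hf hω hθθ hbθ hθR hθS hv hmin hdom in
/-- The inequality of Borel and de Siebenthal. -/
theorem dual_sub_dual_le {i j : V} (hi : i ∈ simpleRoots R f) (hθi : θ i = i) (hpi : p i)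
    (hj : j ∈ simpleRoots R f) (hθj : θ j = j) : b (ω i - ω j) (ω j) ≤ 0 := by
  have h1 := hR.minimal_dual_le hf hω hθθ hbθ hθR hθS hv hmin hj hθj
  have h2 := hR.dual_le_of_odd hf hω hv hdom hi hθi hpi hj
  rw [map_sub, LinearMap.sub_apply] at h1 ⊢
  linarith

include hR hf hω hθθ hbθ hθR hθS hv hmin hdom in
/-- Each component of the diagram has at most one odd fixed vertex. -/
theorem eq_of_odd_of_connected {i j : V} (hi : i ∈ simpleRoots R f) (hθi : θ i = i) (hpi : p i)
    (hj : j ∈ simpleRoots R f) (hθj : θ j = j) (hpj : p j)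
    (hij : Relation.ReflTransGen
      (fun x y => x ∈ simpleRoots R f ∧ y ∈ simpleRoots R f ∧ b x y ≠ 0) i j) : i = j := by
  by_contra hne
  have hfin : (simpleRoots R f).Finite := hR.finite.subset simpleRoots_subset
  have hs : (hfin.toFinset : Set V) = simpleRoots R f := hfin.coe_toFinset
  have h1 := hR.minimal_dual_le hf hω hθθ hbθ hθR hθS hv hmin hi hθi
  -- Within one component the dual vectors have strictly positive inner products.
  have h2 : 0 < b (ω j) (ω i) := hR.dual_dual_pos hf hω hi hij
  have h3 : ∀ k ∈ hfin.toFinset, 0 ≤ b (v - ω i) k * b (ω k) (ω i) := by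
    intro k hk
    have hk' : k ∈ simpleRoots R f := by simpa using hk
    refine mul_nonneg ?_ (hR.dual_dual_nonneg hf hω hk' hi)
    rw [map_sub, LinearMap.sub_apply]
    by_cases hik : i = k
    · subst hik
      have := one_le_of_odd hv hdom hi hθi hpi
      rw [hω.self i hi]; linarith
    · rw [hω.ne i hi k hk' hik, sub_zero]; exact hdom k hk'.1
  -- Expanding `ω i` in simple roots leaves only nonnegative terms, since `v - ω i` is dominant; the
  -- term at `j` is positive and contradicts `h1`.
  have h4 : b (v - ω i) (ω i) = ∑ k ∈ hfin.toFinset, b (v - ω i) k * b (ω k) (ω i) := by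
    rw [congrArg (b (v - ω i)) (sum_dual hω hs (hω.mem_span i hi)), map_sum]
    refine Finset.sum_congr rfl fun k _ => ?_
    rw [map_smul, smul_eq_mul, mul_comm]
  have h5 : b (v - ω i) j * b (ω j) (ω i) ≤ 0 :=
    (Finset.single_le_sum h3 (by simpa using hj)).trans (h4 ▸ h1)
  have h6 : 1 ≤ b (v - ω i) j := by
    rw [map_sub, LinearMap.sub_apply, hω.ne i hi j hj hne, sub_zero]
    exact one_le_of_odd hv hdom hj hθj hpj
  nlinarith

end Involution

end IsRootSet

/-! ### Root vectors in Lie algebras with nondegenerate Killing form -/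

namespace LieAlgebra.IsKilling

open LieModule

variable {K L : Type*} [Field K] [CharZero K] [LieRing L] [LieAlgebra K L]
  [IsKilling K L] [FiniteDimensional K L]
  {H : LieSubalgebra K L} [H.IsCartanSubalgebra] [IsTriangularizable K H L]

theorem exists_smul_eq_of_mem_rootSpace {α : Weight K H L} (hα : α.IsNonZero) {x y : L}
    (hx : x ∈ rootSpace H α) (hy : y ∈ rootSpace H α) (hx0 : x ≠ 0) : ∃ c : K, y = c • x := by
  obtain ⟨c, hc⟩ := (finrank_eq_one_iff_of_nonzero' (⟨x, hx⟩ : rootSpace H α)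
    (by simpa using hx0)).mp (finrank_rootSpace_eq_one α hα) ⟨y, hy⟩
  exact ⟨c, by simpa using (congrArg Subtype.val hc).symm⟩

/-- If `α`, `β` and `α + β` are roots, then the bracket of root vectors for `α` and `β` is not
zero. -/
theorem lie_ne_zero_of_add_root {α β : Weight K H L} (hα : α.IsNonZero) (hβ : β.IsNonZero)
    (hαβ : rootSpace H (α + β : H → K) ≠ ⊥) {x y : L} (hx : x ∈ rootSpace H α)
    (hy : y ∈ rootSpace H β) (hx0 : x ≠ 0) (hy0 : y ≠ 0) : ⁅x, y⁆ ≠ 0 := by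
  -- Start at the top `v` of the `α`-string through `β`. Lowering `k + 1` times reaches the root
  -- space of `β`, and raising once multiplies `f ^ k v` by `(k + 1)(N - k)` with `N` the length of
  -- the string; this is not zero since `k < N`.
  obtain ⟨v, hv, hv0⟩ := (chainTop α β).exists_ne_zero
  obtain ⟨h, e, f, isSl2, he, hf⟩ := exists_isSl2Triple_of_weight_isNonZero hα
  obtain rfl := isSl2.h_eq_coroot hα he hf
  have prim : isSl2.HasPrimitiveVectorWith v (chainLength α β : K) :=
    have := lie_mem_genWeightSpace_of_mem_genWeightSpace he hv
    ⟨hv0, (chainLength_smul _ _ hv).symm, by rwa [genWeightSpace_add_chainTop _ _ hα] at this⟩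
  have h1 : (1 : ℤ) ≤ chainTopCoeff α β :=
    ((rootSpace_zsmul_add_ne_bot_iff α β hα 1).1 (by rwa [one_smul])).1
  have hle := chainTopCoeff_le_chainLength α β
  obtain ⟨k, hk⟩ : ∃ k, chainTopCoeff α β = k + 1 :=
    Nat.exists_eq_add_of_le' (by exact_mod_cast h1)
  have hmem := toEnd_pow_apply_mem hf hv (chainTopCoeff α β)
  rw [coe_chainTop', smul_neg, neg_add_cancel_left] at hmem
  have hne := prim.pow_toEnd_f_ne_zero_of_eq_nat rfl hle
  obtain ⟨c, rfl⟩ := exists_smul_eq_of_mem_rootSpace hβ hmem hy hne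
  obtain ⟨d, rfl⟩ := exists_smul_eq_of_mem_rootSpace hα he hx isSl2.e_ne_zero
  rw [hk, smul_lie, lie_smul, prim.lie_e_pow_succ_toEnd_f]
  have hd : d ≠ 0 := by rintro rfl; simp at hx0
  have hc : c ≠ 0 := by rintro rfl; simp at hy0
  have hn : ((chainLength α β : K) - k) ≠ 0 := by
    rw [sub_ne_zero, Ne, Nat.cast_inj]; omega
  have hk1 : ((k : K) + 1) ≠ 0 := Nat.cast_add_one_ne_zero k
  exact smul_ne_zero hd (smul_ne_zero hc (smul_ne_zero (mul_ne_zero hk1 hn)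
    (prim.pow_toEnd_f_ne_zero_of_eq_nat rfl (by omega))))

end LieAlgebra.IsKilling

/-! ### Lie algebras that split as center plus Killing ideal -/

open LieAlgebra

/-- The ideal `I` is complementary to the center and has nondegenerate Killing form. -/
structure IsKillingComplement {L : Type*} [LieRing L] [LieAlgebra ℂ L] (I : LieIdeal ℂ L) :
    Prop where
  exists_add : ∀ x : L, ∃ z ∈ center ℂ L, ∃ s ∈ I, z + s = x
  disjoint : ∀ x ∈ center ℂ L, x ∈ I → x = 0
  killing : IsKilling ℂ I

section Split

variable {L : Type*} [LieRing L] [LieAlgebra ℂ L]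

theorem mem_center_iff_lie_eq_zero {x : L} : x ∈ center ℂ L ↔ ∀ y : L, ⁅y, x⁆ = 0 :=
  LieModule.mem_maxTrivSubmodule ℂ L L x

theorem lie_eq_zero_of_mem_center {x : L} (hx : x ∈ center ℂ L) (y : L) : ⁅x, y⁆ = 0 := by
  rw [← lie_skew, mem_center_iff_lie_eq_zero.1 hx, neg_zero]

theorem killingForm_eq_zero_of_mem_center {x : L} (hx : x ∈ center ℂ L) (y : L) :
    killingForm ℂ L x y = 0 := by
  rw [killingForm_apply_apply]
  have : ad ℂ L x = 0 := by ext y; exact lie_eq_zero_of_mem_center hx y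
  rw [this, LinearMap.zero_comp, map_zero]

/-- If `ad x` maps into the center, then `ad y` kills its image, so `ad x ∘ ad y` has square zero
and trace zero. Thus `x` lies in the radical of the Killing form. -/
theorem mem_center_of_forall_lie_mem_center
    (hker : ∀ x : L, (∀ y, killingForm ℂ L x y = 0) → x ∈ center ℂ L) {x : L}
    (hx : ∀ y : L, ⁅x, y⁆ ∈ center ℂ L) : x ∈ center ℂ L := by
  refine hker x fun y => ?_
  rw [killingForm_apply_apply]
  refine (LinearMap.isNilpotent_trace_of_isNilpotent (f := ad ℂ L x ∘ₗ ad ℂ L y) ⟨2, ?_⟩).eq_zero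
  ext w
  have : ⁅y, ⁅x, ⁅y, w⁆⁆⁆ = 0 := mem_center_iff_lie_eq_zero.1 (hx _) y
  simp [pow_two, this]

/-- The center is exactly the radical of the Killing form, and comparing dimensions shows that
center and derived ideal span everything. The second form `B` is what makes the sum direct: by
invariance the derived ideal is `B`-orthogonal to the center. -/
theorem isKillingComplement_derived [FiniteDimensional ℂ L]
    (hker : ∀ x : L, (∀ y, killingForm ℂ L x y = 0) → x ∈ center ℂ L)
    {B : LinearMap.BilinForm ℂ L} (hB : B.Nondegenerate) (hsymm : ∀ x y, B x y = B y x)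
    (hinv : ∀ x y z, B ⁅x, y⁆ z = B x ⁅y, z⁆) :
    IsKillingComplement ⁅(⊤ : LieIdeal ℂ L), (⊤ : LieIdeal ℂ L)⁆ := by
  set I : LieIdeal ℂ L := ⁅(⊤ : LieIdeal ℂ L), (⊤ : LieIdeal ℂ L)⁆ with hI
  have hlie : ∀ x y : L, ⁅x, y⁆ ∈ I := fun x y =>
    LieSubmodule.lie_mem_lie (LieSubmodule.mem_top x) (LieSubmodule.mem_top y)
  set W : Submodule ℂ L := (center ℂ L).toSubmodule ⊔ I.toSubmodule with hW
  have hsymmκ : (killingForm ℂ L).IsRefl := fun x y h => by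
    rw [LieModule.traceForm_comm]; exact h
  -- If `x` is orthogonal to all brackets, invariance puts each `⁅x, y⁆` in the radical, hence in
  -- the center, and then `x` itself is central.
  have horth : (killingForm ℂ L).orthogonal W ≤ (center ℂ L).toSubmodule := by
    intro x hx
    rw [LinearMap.BilinForm.mem_orthogonal_iff] at hx
    refine mem_center_of_forall_lie_mem_center hker fun y => hker _ fun z => ?_
    rw [LieModule.traceForm_apply_lie_apply, LieModule.traceForm_comm]
    exact hx _ (Submodule.mem_sup_right (hlie y z))
  have htop : (killingForm ℂ L).orthogonal ⊤ = (center ℂ L).toSubmodule := by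
    apply le_antisymm ((LinearMap.BilinForm.orthogonal_le le_top).trans horth)
    intro x hx
    rw [LinearMap.BilinForm.mem_orthogonal_iff]
    intro y _
    change killingForm ℂ L y x = 0
    rw [LieModule.traceForm_comm]
    exact killingForm_eq_zero_of_mem_center hx y
  -- The dimension of `W` plus that of its orthogonal is `dim L + dim (center)`, and the orthogonal
  -- is contained in the center.
  have hWtop : W = ⊤ := by
    apply Submodule.eq_top_of_finrank_eq
    have h1 := LinearMap.BilinForm.finrank_add_finrank_orthogonal hsymmκ W
    rw [htop, inf_of_le_right (a := W) (by rw [hW]; exact le_sup_left)] at h1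
    have h2 := Submodule.finrank_mono horth
    have h3 := Submodule.finrank_le W
    omega
  have hadd : ∀ x : L, ∃ z ∈ center ℂ L, ∃ s ∈ I, z + s = x := fun x =>
    Submodule.mem_sup.1 (hWtop ▸ Submodule.mem_top : x ∈ W)
  have hcI : ∀ z ∈ center ℂ L, ∀ s ∈ I, B z s = 0 := by
    intro z hz s hs
    rw [hI, ← LieSubmodule.mem_toSubmodule, LieSubmodule.lieIdeal_oper_eq_linear_span'] at hs
    induction hs using Submodule.span_induction with
    | mem s hs =>
      obtain ⟨x, -, y, -, rfl⟩ := hs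
      rw [← hinv, lie_eq_zero_of_mem_center hz, map_zero, LinearMap.zero_apply]
    | zero => simp
    | add x y _ _ hx hy => rw [map_add, hx, hy, add_zero]
    | smul c x _ hx => rw [map_smul, hx, smul_zero]
  have hdisj : ∀ x ∈ center ℂ L, x ∈ I → x = 0 := by
    intro x hx hxI
    refine hB.1 x fun y => ?_
    obtain ⟨z, hz, s, hs, rfl⟩ := hadd y
    rw [map_add, hcI x hx s hs, hsymm, hcI z hz x hxI, add_zero]
  refine ⟨hadd, hdisj, ⟨?_⟩⟩
  rw [LieSubmodule.eq_bot_iff]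
  intro x hx
  rw [LieIdeal.mem_killingCompl] at hx
  apply Subtype.ext
  -- An element of `I` orthogonal to `I` is orthogonal to the whole algebra, as central elements do
  -- not contribute to the Killing form.
  refine hdisj x (hker x fun y => ?_) x.2
  obtain ⟨z, hz, s, hs, rfl⟩ := hadd y
  have h1 : killingForm ℂ L s x = 0 := by
    have h2 := hx ⟨s, hs⟩ (LieSubmodule.mem_top _)
    rw [LieIdeal.killingForm_eq] at h2
    exact h2
  rw [map_add, LieModule.traceForm_comm, killingForm_eq_zero_of_mem_center hz,
    LieModule.traceForm_comm, zero_add]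
  exact h1

end Split

open LieAlgebra LieModule LieSuperalgebra

/-! ### The even roots -/

/-- The facts about the even roots and their coroots `h α` that are used below. -/
structure EvenRootData {L : Type*} [LieRing L] [LieAlgebra ℂ L] (𝔥 : LieSubalgebra ℂ L)
    [𝔥.IsCartanSubalgebra] (h : Dual ℂ 𝔥 → 𝔥) : Prop where
  finite : (evenRoots 𝔥).Finite
  neg_mem : ∀ α ∈ evenRoots 𝔥, -α ∈ evenRoots 𝔥
  coroot : ∀ α ∈ evenRoots 𝔥, IsCoroot 𝔥 α (h α)
  coroot_unique : ∀ α ∈ evenRoots 𝔥, ∀ H, IsCoroot 𝔥 α H → H = h α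
  proportional : ∀ α ∈ evenRoots 𝔥, ∀ x ∈ weightSpace L (α : 𝔥 → ℂ),
    ∀ y ∈ weightSpace L (α : 𝔥 → ℂ), x ≠ 0 → ∃ c : ℂ, y = c • x
  integral : ∀ α ∈ evenRoots 𝔥, ∀ β ∈ evenRoots 𝔥, ∃ n : ℤ, β (h α) = n
  reflect_mem : ∀ α ∈ evenRoots 𝔥, ∀ β ∈ evenRoots 𝔥, β - β (h α) • α ∈ evenRoots 𝔥
  sub_mem : ∀ α ∈ evenRoots 𝔥, ∀ β ∈ evenRoots 𝔥, ∀ n : ℤ, β (h α) = n → 0 < n → β ≠ α →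
    β - α ∈ evenRoots 𝔥
  lie_ne_zero : ∀ α ∈ evenRoots 𝔥, ∀ β ∈ evenRoots 𝔥, α + β ∈ evenRoots 𝔥 →
    ∀ x ∈ weightSpace L (α : 𝔥 → ℂ), ∀ y ∈ weightSpace L (β : 𝔥 → ℂ), x ≠ 0 → y ≠ 0 → ⁅x, y⁆ ≠ 0
  two_mul_form : ∀ α ∈ evenRoots 𝔥, ∀ β ∈ evenRoots 𝔥,
    2 * ∑ γ ∈ finite.toFinset, α (h γ) * β (h γ) =
      β (h α) * ∑ γ ∈ finite.toFinset, α (h γ) * α (h γ)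
  eq_zero : ∀ x ∈ Submodule.span ℂ (evenRoots 𝔥), (∀ γ ∈ evenRoots 𝔥, x (h γ) = 0) → x = 0
  genWeightSpace_le : ∀ α : Dual ℂ 𝔥, α ≠ 0 →
    genWeightSpace L (α : 𝔥 → ℂ) ≤ weightSpace L (α : 𝔥 → ℂ)

theorem LieSubmodule.ne_bot_iff_exists {R L M : Type*} [CommRing R] [LieRing L] [AddCommGroup M]
    [Module R M] [LieRingModule L M] {N : LieSubmodule R L M} : N ≠ ⊥ ↔ ∃ x ∈ N, x ≠ 0 := by
  rw [Ne, LieSubmodule.eq_bot_iff]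
  push Not
  rfl

/-! ### Transfer of root theory from the Killing ideal to the whole algebra -/

section Transport

set_option linter.unusedSectionVars false

variable {L : Type*} [LieRing L] [LieAlgebra ℂ L] (I : LieIdeal ℂ L) (𝔥 : LieSubalgebra ℂ L)

/-- The intersection of a subalgebra with an ideal, as a subalgebra of the ideal. -/
def restrictSubalgebra : LieSubalgebra ℂ I := 𝔥.comap I.incl

variable {I 𝔥}

theorem mem_restrictSubalgebra {x : I} : x ∈ restrictSubalgebra I 𝔥 ↔ (x : L) ∈ 𝔥 := Iff.rfl

variable (I 𝔥) in
/-- The inclusion of `𝔥 ∩ I` into `𝔥`. -/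
def restrictIncl : restrictSubalgebra I 𝔥 →ₗ[ℂ] 𝔥 where
  toFun x := ⟨x.1.1, x.2⟩
  map_add' _ _ := rfl
  map_smul' _ _ := rfl

theorem center_le_cartan [𝔥.IsCartanSubalgebra] {z : L} (hz : z ∈ center ℂ L) : z ∈ 𝔥 := by
  rw [← LieSubalgebra.IsCartanSubalgebra.self_normalizing (H := 𝔥),
    LieSubalgebra.mem_normalizer_iff]
  intro y _
  rw [lie_eq_zero_of_mem_center hz]
  exact zero_mem _

theorem exists_add_restrictIncl [𝔥.IsCartanSubalgebra] (hI : IsKillingComplement I) (H : 𝔥) :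
    ∃ (z : 𝔥) (k : restrictSubalgebra I 𝔥), (z : L) ∈ center ℂ L ∧ H = z + restrictIncl I 𝔥 k := by
  obtain ⟨z, hz, s, hs, h⟩ := hI.exists_add H
  have hs' : s ∈ 𝔥 := by
    have : s = H - z := by rw [← h]; abel
    rw [this]; exact 𝔥.sub_mem H.2 (center_le_cartan hz)
  exact ⟨⟨z, center_le_cartan hz⟩, ⟨⟨s, hs⟩, hs'⟩, hz, Subtype.ext h.symm⟩

/-- Since `𝔥` is the sum of the center and `𝔥 ∩ I`, an element of `I` that normalizes `𝔥 ∩ I`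
normalizes `𝔥`, which is its own normalizer. -/
theorem isCartanSubalgebra_restrict [𝔥.IsCartanSubalgebra] (hI : IsKillingComplement I) :
    (restrictSubalgebra I 𝔥).IsCartanSubalgebra where
  nilpotent := by
    let f : restrictSubalgebra I 𝔥 →ₗ⁅ℂ⁆ 𝔥 := { restrictIncl I 𝔥 with map_lie' := rfl }
    have hf : Function.Injective f := fun x y h => Subtype.ext (Subtype.ext (congrArg (·.1) h))
    exact hf.lieAlgebra_isNilpotent
  self_normalizing := by
    apply le_antisymm _ (LieSubalgebra.le_normalizer _)
    intro x hx
    rw [LieSubalgebra.mem_normalizer_iff] at hx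
    rw [mem_restrictSubalgebra, ← LieSubalgebra.IsCartanSubalgebra.self_normalizing (H := 𝔥),
      LieSubalgebra.mem_normalizer_iff]
    intro y hy
    obtain ⟨z, k, hz, h⟩ := exists_add_restrictIncl hI ⟨y, hy⟩
    have h' : y = z + (k : I) := congrArg Subtype.val h
    rw [h', lie_add, mem_center_iff_lie_eq_zero.1 hz, zero_add]
    exact hx k k.2

theorem apply_center_of_mem_evenRoots {α : Dual ℂ 𝔥} (hα : α ∈ evenRoots 𝔥) {z : 𝔥}
    (hz : (z : L) ∈ center ℂ L) : α z = 0 := by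
  obtain ⟨x, hx, hx0⟩ := LieSubmodule.ne_bot_iff_exists.1 hα.2
  rw [mem_weightSpace] at hx
  have h1 := hx z
  rw [LieSubalgebra.coe_bracket_of_module, lie_eq_zero_of_mem_center hz] at h1
  exact (smul_eq_zero.1 h1.symm).resolve_right hx0

/-- A root vector is a nonzero multiple of its bracket with some `H`, and only the component of `H`
in `I` contributes to that bracket. -/
theorem mem_ideal_of_mem_weightSpace (hI : IsKillingComplement I) {α : Dual ℂ 𝔥} (hα : α ≠ 0)
    {x : L} (hx : x ∈ weightSpace L (α : 𝔥 → ℂ)) : x ∈ I := by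
  obtain ⟨H, hH⟩ : ∃ H, α H ≠ 0 := by
    by_contra! h
    exact hα (LinearMap.ext h)
  rw [mem_weightSpace] at hx
  have h1 := hx H
  obtain ⟨z, hz, s, hs, h⟩ := hI.exists_add H
  rw [LieSubalgebra.coe_bracket_of_module, ← h, add_lie, lie_eq_zero_of_mem_center hz,
    zero_add] at h1
  have h2 : x = (α H)⁻¹ • ⁅s, x⁆ := by rw [h1, smul_smul, inv_mul_cancel₀ hH, one_smul]
  rw [h2]
  exact I.smul_mem _ (lie_mem_left ℂ L I s x hs)

variable [FiniteDimensional ℂ L] [𝔥.IsCartanSubalgebra]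
  [(restrictSubalgebra I 𝔥).IsCartanSubalgebra] [IsKilling ℂ I]

omit [FiniteDimensional ℂ L] [𝔥.IsCartanSubalgebra] [IsKilling ℂ I] in
theorem mem_rootSpace_restrict {α : Dual ℂ 𝔥} {x : L} (hx : x ∈ weightSpace L (α : 𝔥 → ℂ))
    (hxI : x ∈ I) :
    (⟨x, hxI⟩ : I) ∈ rootSpace (restrictSubalgebra I 𝔥) (fun k => α (restrictIncl I 𝔥 k)) := by
  apply weightSpace_le_genWeightSpace
  rw [mem_weightSpace] at hx ⊢
  intro k
  exact Subtype.ext (hx (restrictIncl I 𝔥 k))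

theorem coe_mem_weightSpace (hI : IsKillingComplement I) {α : Dual ℂ 𝔥}
    (hα : ∀ z : 𝔥, (z : L) ∈ center ℂ L → α z = 0) {y : I}
    (hy : y ∈ rootSpace (restrictSubalgebra I 𝔥) (fun k => α (restrictIncl I 𝔥 k))) :
    (y : L) ∈ weightSpace L (α : 𝔥 → ℂ) := by
  rw [mem_weightSpace]
  intro H
  obtain ⟨z, k, hz, rfl⟩ := exists_add_restrictIncl hI H
  rw [LieSubalgebra.coe_bracket_of_module, map_add, hα z hz, zero_add]
  change ⁅(z : L) + ((k : I) : L), (y : L)⁆ = _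
  rw [add_lie, lie_eq_zero_of_mem_center hz, zero_add]
  exact congrArg Subtype.val (IsKilling.lie_eq_smul_of_mem_rootSpace hy k)

/-- The restriction of an even root to `𝔥 ∩ I`. -/
def rootWeight (hI : IsKillingComplement I) {α : Dual ℂ 𝔥} (hα : α ∈ evenRoots 𝔥) :
    Weight ℂ (restrictSubalgebra I 𝔥) I where
  toFun k := α (restrictIncl I 𝔥 k)
  genWeightSpace_ne_bot' := by
    obtain ⟨x, hx, hx0⟩ := LieSubmodule.ne_bot_iff_exists.1 hα.2
    have hxI := mem_ideal_of_mem_weightSpace hI hα.1 hx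
    exact LieSubmodule.ne_bot_iff_exists.2
      ⟨⟨x, hxI⟩, mem_rootSpace_restrict hx hxI, fun h => hx0 (congrArg Subtype.val h)⟩

omit [FiniteDimensional ℂ L] [(restrictSubalgebra I 𝔥).IsCartanSubalgebra] [IsKilling ℂ I] in
theorem dual_ext_of_restrict (hI : IsKillingComplement I) {α β : Dual ℂ 𝔥}
    (hα : ∀ z : 𝔥, (z : L) ∈ center ℂ L → α z = 0)
    (hβ : ∀ z : 𝔥, (z : L) ∈ center ℂ L → β z = 0)
    (h : ∀ k, α (restrictIncl I 𝔥 k) = β (restrictIncl I 𝔥 k)) : α = β := by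
  ext H
  obtain ⟨z, k, hz, rfl⟩ := exists_add_restrictIncl hI H
  rw [map_add, map_add, hα z hz, hβ z hz, h]

theorem rootWeight_isNonZero (hI : IsKillingComplement I) {α : Dual ℂ 𝔥}
    (hα : α ∈ evenRoots 𝔥) : (rootWeight hI hα).IsNonZero := by
  intro h
  refine hα.1 (dual_ext_of_restrict hI (fun z hz => apply_center_of_mem_evenRoots hα hz)
    (fun _ _ => rfl) fun k => ?_)
  exact congrFun h k

theorem mem_evenRoots_of_rootSpace_ne_bot (hI : IsKillingComplement I) {α : Dual ℂ 𝔥}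
    (hα : ∀ z : 𝔥, (z : L) ∈ center ℂ L → α z = 0) (hα0 : α ≠ 0)
    (h : rootSpace (restrictSubalgebra I 𝔥) (fun k => α (restrictIncl I 𝔥 k)) ≠ ⊥) :
    α ∈ evenRoots 𝔥 := by
  obtain ⟨y, hy, hy0⟩ := LieSubmodule.ne_bot_iff_exists.1 h
  exact ⟨hα0, LieSubmodule.ne_bot_iff_exists.2
    ⟨y, coe_mem_weightSpace hI hα hy, fun h => hy0 (Subtype.ext h)⟩⟩

/-- A root of the ideal extends to `𝔥` by zero on the center, that is, by composition with the
projection along the center. -/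
theorem exists_rootWeight_eq (hI : IsKillingComplement I)
    {w : Weight ℂ (restrictSubalgebra I 𝔥) I} (hw : w.IsNonZero) :
    ∃ (α : Dual ℂ 𝔥) (hα : α ∈ evenRoots 𝔥), rootWeight hI hα = w := by
  have hc : IsCompl I.toSubmodule (center ℂ L).toSubmodule := by
    constructor
    · rw [Submodule.disjoint_def]
      exact fun x h1 h2 => hI.disjoint x h2 h1
    · rw [codisjoint_iff, eq_top_iff]
      intro x _
      obtain ⟨z, hz, s, hs, rfl⟩ := hI.exists_add x
      exact add_mem (Submodule.mem_sup_right hz) (Submodule.mem_sup_left hs)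
  set π := Submodule.projectionOnto I.toSubmodule (center ℂ L).toSubmodule hc with hπ
  have hπI : ∀ s (hs : s ∈ I), π s = ⟨s, hs⟩ := fun s hs =>
    Submodule.projectionOnto_apply_of_mem_left hc hs
  have hπZ : ∀ z ∈ center ℂ L, π z = 0 := fun z hz =>
    (Submodule.projectionOnto_apply_eq_zero_iff hc).2 hz
  have hmem : ∀ H : 𝔥, π H ∈ restrictSubalgebra I 𝔥 := by
    intro H
    obtain ⟨z, k, hz, rfl⟩ := exists_add_restrictIncl hI H
    change π ((z : L) + ((k : I) : L)) ∈ _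
    rw [map_add, hπZ z hz, zero_add, hπI _ k.1.2]
    exact k.2
  let π' : 𝔥 →ₗ[ℂ] restrictSubalgebra I 𝔥 :=
    { toFun := fun H => ⟨π H, hmem H⟩
      map_add' := fun x y => Subtype.ext (map_add π (x : L) y)
      map_smul' := fun c x => Subtype.ext (map_smul π c (x : L)) }
  have hπ' : ∀ k, π' (restrictIncl I 𝔥 k) = k := fun k => Subtype.ext (hπI _ k.1.2)
  let α : Dual ℂ 𝔥 := w.toLinear ∘ₗ π'
  have hαk : ∀ k, α (restrictIncl I 𝔥 k) = w k := fun k => by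
    change w (π' _) = w k
    rw [hπ']
  have hαZ : ∀ z : 𝔥, (z : L) ∈ center ℂ L → α z = 0 := fun z hz => by
    change w (π' z) = 0
    rw [show π' z = 0 from Subtype.ext (hπZ z hz), map_zero]
  have hα0 : α ≠ 0 := by
    intro h0
    refine hw (funext fun k => ?_)
    rw [← hαk k, h0]; rfl
  refine ⟨α, mem_evenRoots_of_rootSpace_ne_bot hI hαZ hα0 ?_, ?_⟩
  · rw [show (fun k => α (restrictIncl I 𝔥 k)) = (w : restrictSubalgebra I 𝔥 → ℂ) from
      funext hαk]
    exact w.genWeightSpace_ne_bot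
  · ext k
    exact hαk k

/-- The coroot of an even root, as an element of `𝔥`. -/
def evenCoroot (hI : IsKillingComplement I) (α : Dual ℂ 𝔥) : 𝔥 :=
  open Classical in
  if hα : α ∈ evenRoots 𝔥 then restrictIncl I 𝔥 (IsKilling.coroot (rootWeight hI hα)) else 0

theorem evenCoroot_eq (hI : IsKillingComplement I) {α : Dual ℂ 𝔥} (hα : α ∈ evenRoots 𝔥) :
    evenCoroot hI α = restrictIncl I 𝔥 (IsKilling.coroot (rootWeight hI hα)) := dif_pos hα

theorem apply_evenCoroot (hI : IsKillingComplement I) {α β : Dual ℂ 𝔥} (hα : α ∈ evenRoots 𝔥)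
    (hβ : β ∈ evenRoots 𝔥) :
    β (evenCoroot hI α) = rootWeight hI hβ (IsKilling.coroot (rootWeight hI hα)) := by
  rw [evenCoroot_eq hI hα]; rfl

theorem rootWeight_injective (hI : IsKillingComplement I) {α β : Dual ℂ 𝔥}
    (hα : α ∈ evenRoots 𝔥) (hβ : β ∈ evenRoots 𝔥) (h : rootWeight hI hα = rootWeight hI hβ) :
    α = β :=
  dual_ext_of_restrict hI (fun _ => apply_center_of_mem_evenRoots hα)
    (fun _ => apply_center_of_mem_evenRoots hβ) fun k => DFunLike.congr_fun h k

theorem finite_evenRoots (hI : IsKillingComplement I) : (evenRoots 𝔥).Finite := by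
  rw [← Set.finite_coe_iff]
  exact Finite.of_injective (fun α : evenRoots 𝔥 => rootWeight hI α.2)
    fun α β h => Subtype.ext (rootWeight_injective hI α.2 β.2 h)

theorem sum_evenRoots_eq (hI : IsKillingComplement I) (hfin : (evenRoots 𝔥).Finite)
    (g : 𝔥 → ℂ) : ∑ γ ∈ hfin.toFinset, g (evenCoroot hI γ) =
      ∑ i : (restrictSubalgebra I 𝔥).root, g (restrictIncl I 𝔥 (IsKilling.coroot i.1)) := by
  rw [← Finset.sum_coe_sort]
  have hm : ∀ γ : hfin.toFinset, (γ : Dual ℂ 𝔥) ∈ evenRoots 𝔥 := fun γ =>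
    hfin.mem_toFinset.1 γ.2
  refine Fintype.sum_bijective (fun γ : hfin.toFinset => (⟨rootWeight hI (hm γ), by
    simpa using rootWeight_isNonZero hI (hm γ)⟩ : (restrictSubalgebra I 𝔥).root)) ⟨?_, ?_⟩ _ _ ?_
  · intro γ δ h
    exact Subtype.ext (rootWeight_injective hI (hm γ) (hm δ) (congrArg Subtype.val h))
  · rintro ⟨w, hw⟩
    obtain ⟨α, hα, h⟩ := exists_rootWeight_eq hI (w := w) (by simpa using hw)
    exact ⟨⟨α, by simpa using hα⟩, Subtype.ext h⟩
  · intro γ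
    rw [evenCoroot_eq hI (hm γ)]

theorem add_apply_center {α β : Dual ℂ 𝔥} {z : 𝔥} (hα : α z = 0) (hβ : β z = 0) (c : ℂ) :
    (β + c • α) z = 0 := by
  rw [LinearMap.add_apply, LinearMap.smul_apply, hα, hβ, smul_zero, add_zero]

/-- On the center `H - α(H)` acts as the scalar `-α(H)`. So a generalized weight vector for `α ≠ 0`
has no central component, and if it is nonzero then `α` vanishes on the center. What remains is a
statement inside the Killing ideal, where the Cartan subalgebra acts diagonalizably. -/
theorem genWeightSpace_le_weightSpace (hI : IsKillingComplement I) (α : Dual ℂ 𝔥) (hα : α ≠ 0) :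
    genWeightSpace L (α : 𝔥 → ℂ) ≤ weightSpace L (α : 𝔥 → ℂ) := by
  intro x hx
  obtain ⟨H, hH⟩ : ∃ H, α H ≠ 0 := by
    by_contra! h
    exact hα (LinearMap.ext h)
  rw [mem_genWeightSpace] at hx
  have hpowI : ∀ (H : 𝔥) (c : ℂ) (k : ℕ) (s : L), s ∈ I →
      ((toEnd ℂ 𝔥 L H - c • (1 : Module.End ℂ L)) ^ k) s ∈ I := by
    intro H c k s hs
    induction k with
    | zero => exact hs
    | succ k ih =>
      rw [pow_succ', Module.End.mul_apply]
      exact I.sub_mem (I.lie_mem ih) (I.smul_mem _ ih)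
  have hpowZ : ∀ (H : 𝔥) (c : ℂ) (k : ℕ) (z : L), z ∈ center ℂ L →
      ((toEnd ℂ 𝔥 L H - c • (1 : Module.End ℂ L)) ^ k) z = (-c) ^ k • z := by
    intro H c k z hz
    induction k with
    | zero => simp
    | succ k ih =>
      rw [pow_succ', Module.End.mul_apply, ih, map_smul, LinearMap.sub_apply, toEnd_apply_apply,
        LieSubalgebra.coe_bracket_of_module, mem_center_iff_lie_eq_zero.1 hz, zero_sub,
        LinearMap.smul_apply, Module.End.one_apply, ← neg_smul, smul_smul, pow_succ]
  obtain ⟨z, hz, s, hs, rfl⟩ := hI.exists_add x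
  have hz0 : z = 0 := by
    obtain ⟨k, hk⟩ := hx H
    rw [map_add, hpowZ H _ k z hz] at hk
    have h1 : (-(α H)) ^ k • z ∈ I := by
      rw [eq_neg_of_add_eq_zero_left hk]
      exact I.neg_mem (hpowI _ _ _ _ hs)
    have h2 := hI.disjoint _ ((center ℂ L).smul_mem _ hz) h1
    exact (smul_eq_zero.1 h2).resolve_left (pow_ne_zero _ (neg_ne_zero.2 hH))
  subst hz0
  rw [zero_add] at hx ⊢
  have hs' : (⟨s, hs⟩ : I) ∈
      rootSpace (restrictSubalgebra I 𝔥) (fun k => α (restrictIncl I 𝔥 k)) := by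
    rw [mem_genWeightSpace]
    intro k
    obtain ⟨n, hn⟩ := hx (restrictIncl I 𝔥 k)
    refine ⟨n, Subtype.ext ?_⟩
    have key : ∀ (n : ℕ) (s : I), (((toEnd ℂ (restrictSubalgebra I 𝔥) I k -
        α (restrictIncl I 𝔥 k) • (1 : Module.End ℂ I)) ^ n) s : L) =
        ((toEnd ℂ 𝔥 L (restrictIncl I 𝔥 k) -
          α (restrictIncl I 𝔥 k) • (1 : Module.End ℂ L)) ^ n) (s : L) := by
      intro n
      induction n with
      | zero => intro s; rfl
      | succ n ih =>
        intro s
        rw [pow_succ, pow_succ, Module.End.mul_apply, Module.End.mul_apply, ih]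
        rfl
    rw [key]
    exact hn
  by_cases hs0 : s = 0
  · subst hs0; exact zero_mem _
  rw [mem_weightSpace]
  have hker : ∀ z : 𝔥, (z : L) ∈ center ℂ L → α z = 0 := by
    intro z hz
    obtain ⟨k, hk⟩ := hx z
    have key : ∀ k : ℕ, ((toEnd ℂ 𝔥 L z - α z • (1 : Module.End ℂ L)) ^ k) s = (-(α z)) ^ k • s := by
      intro k
      induction k with
      | zero => simp
      | succ k ih =>
        rw [pow_succ', Module.End.mul_apply, ih, map_smul, LinearMap.sub_apply, toEnd_apply_apply,
          LieSubalgebra.coe_bracket_of_module, lie_eq_zero_of_mem_center hz, zero_sub,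
          LinearMap.smul_apply, Module.End.one_apply, ← neg_smul, smul_smul, pow_succ]
    rw [key k] at hk
    exact neg_eq_zero.1 (eq_zero_of_pow_eq_zero ((smul_eq_zero.1 hk).resolve_right hs0))
  exact (mem_weightSpace _ _).1 (coe_mem_weightSpace hI hker hs')

theorem evenRootData (hI : IsKillingComplement I) :
    EvenRootData 𝔥 (evenCoroot hI) where
  finite := finite_evenRoots hI
  neg_mem α hα := by
    refine mem_evenRoots_of_rootSpace_ne_bot hI (fun z hz => ?_) (neg_ne_zero.2 hα.1)
      (-(rootWeight hI hα)).genWeightSpace_ne_bot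
    rw [LinearMap.neg_apply, apply_center_of_mem_evenRoots hα hz, neg_zero]
  coroot α hα := by
    obtain ⟨h, e, f, ht, he, hf⟩ :=
      IsKilling.exists_isSl2Triple_of_weight_isNonZero (rootWeight_isNonZero hI hα)
    obtain rfl := ht.h_eq_coroot (rootWeight_isNonZero hI hα) he hf
    refine ⟨?_, e, ?_, f, ?_, ?_⟩
    · rw [apply_evenCoroot hI hα hα, IsKilling.root_apply_coroot (rootWeight_isNonZero hI hα)]
    · exact coe_mem_weightSpace hI (fun z hz => apply_center_of_mem_evenRoots hα hz) he
    · refine coe_mem_weightSpace hI (fun z hz => ?_) hf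
      rw [LinearMap.neg_apply, apply_center_of_mem_evenRoots hα hz, neg_zero]
    · rw [evenCoroot_eq hI hα]
      exact congrArg Subtype.val ht.lie_e_f
  coroot_unique α hα H := by
    rintro ⟨h2, e, he, f, hf, hef⟩
    have heI := mem_ideal_of_mem_weightSpace hI hα.1 he
    have hfI := mem_ideal_of_mem_weightSpace hI (neg_ne_zero.2 hα.1) hf
    have hHI : (H : L) ∈ I := hef ▸ I.lie_mem hfI
    let k : restrictSubalgebra I 𝔥 := ⟨⟨H, hHI⟩, H.2⟩
    have hk : restrictIncl I 𝔥 k = H := rfl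
    rw [evenCoroot_eq hI hα, ← hk]
    congr 1
    refine IsKilling.eq_coroot_of_mem_corootSpace_of_two _ ?_ h2
    rw [mem_corootSpace]
    refine Submodule.subset_span ⟨⟨e, heI⟩, mem_rootSpace_restrict he heI, ⟨f, hfI⟩,
      mem_rootSpace_restrict hf hfI, Subtype.ext hef⟩
  proportional α hα x hx y hy hx0 := by
    have hxI := mem_ideal_of_mem_weightSpace hI hα.1 hx
    have hyI := mem_ideal_of_mem_weightSpace hI hα.1 hy
    obtain ⟨c, hc⟩ := IsKilling.exists_smul_eq_of_mem_rootSpace (rootWeight_isNonZero hI hα)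
      (mem_rootSpace_restrict hx hxI) (mem_rootSpace_restrict hy hyI)
      fun h => hx0 (congrArg Subtype.val h)
    exact ⟨c, congrArg Subtype.val hc⟩
  integral α hα β hβ := ⟨_, by
    rw [apply_evenCoroot hI hα hβ, IsKilling.apply_coroot_eq_cast]⟩
  reflect_mem α hα β hβ := by
    have hnz := IsKilling.reflectRoot_isNonZero (rootWeight hI hα) _ (rootWeight_isNonZero hI hβ)
    have hfun : (fun k => (β - β (evenCoroot hI α) • α) (restrictIncl I 𝔥 k)) =
        IsKilling.reflectRoot (rootWeight hI hα) (rootWeight hI hβ) := by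
      rw [apply_evenCoroot hI hα hβ]; rfl
    refine mem_evenRoots_of_rootSpace_ne_bot hI (fun z hz => ?_) (fun h0 => hnz ?_) ?_
    · rw [sub_eq_add_neg, ← neg_smul]
      exact add_apply_center (apply_center_of_mem_evenRoots hα hz)
        (apply_center_of_mem_evenRoots hβ hz) _
    · rw [Weight.IsZero, ← hfun, h0]; rfl
    · rw [hfun]
      exact (IsKilling.reflectRoot (rootWeight hI hα) (rootWeight hI hβ)).genWeightSpace_ne_bot
  sub_mem α hα β hβ n hn hpos hne := by
    rw [apply_evenCoroot hI hα hβ, IsKilling.apply_coroot_eq_cast, Int.cast_inj] at hn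
    -- The Cartan integer is the number of steps down the `α`-string minus the number of steps up.
    -- As it is positive, at least one step down is possible.
    have hne' := (IsKilling.rootSpace_zsmul_add_ne_bot_iff (rootWeight hI hα) (rootWeight hI hβ)
      (rootWeight_isNonZero hI hα) (-1)).2 (by constructor <;> omega)
    refine mem_evenRoots_of_rootSpace_ne_bot hI (fun z hz => ?_) (sub_ne_zero.2 hne) ?_
    · rw [LinearMap.sub_apply, apply_center_of_mem_evenRoots hα hz,
        apply_center_of_mem_evenRoots hβ hz, sub_zero]
    · convert! hne' using 3
      rw [neg_one_smul, neg_add_eq_sub]; rfl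
  lie_ne_zero α hα β hβ hαβ x hx y hy hx0 hy0 := by
    have hxI := mem_ideal_of_mem_weightSpace hI hα.1 hx
    have hyI := mem_ideal_of_mem_weightSpace hI hβ.1 hy
    have := IsKilling.lie_ne_zero_of_add_root (rootWeight_isNonZero hI hα)
      (rootWeight_isNonZero hI hβ) (rootWeight hI hαβ).genWeightSpace_ne_bot
      (mem_rootSpace_restrict hx hxI) (mem_rootSpace_restrict hy hyI)
      (fun h => hx0 (congrArg Subtype.val h)) (fun h => hy0 (congrArg Subtype.val h))
    exact fun h => this (Subtype.ext h)
  two_mul_form α hα β hβ := by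
    rw [sum_evenRoots_eq hI _ (fun H => α H * β H), sum_evenRoots_eq hI _ (fun H => α H * α H),
      apply_evenCoroot hI hα hβ]
    set P := IsKilling.rootSystem (restrictSubalgebra I 𝔥)
    let a : (restrictSubalgebra I 𝔥).root :=
      ⟨rootWeight hI hα, by simpa using rootWeight_isNonZero hI hα⟩
    let c : (restrictSubalgebra I 𝔥).root :=
      ⟨rootWeight hI hβ, by simpa using rootWeight_isNonZero hI hβ⟩
    -- Invariance of the root form under the reflection in `α`, applied to `α` and `β`, is the
    -- relation `-(α, β - β(h α) α) = (α, β)`.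
    have h1 := P.rootForm_reflection_reflection_apply a (P.root a) (P.root c)
    rw [P.reflection_apply_self, P.reflection_apply, map_neg, LinearMap.neg_apply, map_sub,
      map_smul, smul_eq_mul, P.rootForm_apply_apply, P.rootForm_apply_apply] at h1
    change -(∑ i : (restrictSubalgebra I 𝔥).root, α (restrictIncl I 𝔥 (IsKilling.coroot i.1)) *
      β (restrictIncl I 𝔥 (IsKilling.coroot i.1)) -
        rootWeight hI hβ (IsKilling.coroot (rootWeight hI hα)) *
        ∑ i : (restrictSubalgebra I 𝔥).root, α (restrictIncl I 𝔥 (IsKilling.coroot i.1)) *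
          α (restrictIncl I 𝔥 (IsKilling.coroot i.1))) =
      ∑ i : (restrictSubalgebra I 𝔥).root, α (restrictIncl I 𝔥 (IsKilling.coroot i.1)) *
        β (restrictIncl I 𝔥 (IsKilling.coroot i.1)) at h1
    linear_combination -h1
  eq_zero x hx h0 := by
    have hxZ : ∀ z : 𝔥, (z : L) ∈ center ℂ L → x z = 0 := by
      intro z hz
      clear h0
      induction hx using Submodule.span_induction with
      | mem x hx => exact apply_center_of_mem_evenRoots hx hz
      | zero => rfl
      | add x y _ _ hx hy => rw [LinearMap.add_apply, hx, hy, add_zero]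
      | smul c x _ hx => rw [LinearMap.smul_apply, hx, smul_zero]
    refine dual_ext_of_restrict hI hxZ (fun _ _ => rfl) fun k => ?_
    -- The coroots span `𝔥 ∩ I`, so a functional that vanishes on the center and on all coroots is
    -- zero.
    have hk : k ∈ Submodule.span ℂ (Set.range (IsKilling.rootSystem (restrictSubalgebra I 𝔥)).coroot) := by
      rw [RootPairing.IsRootSystem.span_coroot_eq_top]; trivial
    induction hk using Submodule.span_induction with
    | mem k hk =>
      obtain ⟨⟨w, hw⟩, rfl⟩ := hk
      obtain ⟨γ, hγ, rfl⟩ := exists_rootWeight_eq hI (w := w) (by simpa using hw)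
      have := h0 γ hγ
      rw [evenCoroot_eq hI hγ] at this
      exact this
    | zero => simp
    | add k l _ _ hk hl => rw [map_add, map_add, hk, hl]; simp
    | smul c k _ hk => rw [map_smul, map_smul, hk]; simp
  genWeightSpace_le := genWeightSpace_le_weightSpace hI

end Transport

/-! ### The Euclidean form on the even roots -/

namespace EvenRootData

variable {L : Type*} [LieRing L] [LieAlgebra ℂ L] {𝔥 : LieSubalgebra ℂ L}
  [𝔥.IsCartanSubalgebra] {h : Dual ℂ 𝔥 → 𝔥} (D : EvenRootData 𝔥 h)

include D in
theorem apply_coroot_self {α : Dual ℂ 𝔥} (hα : α ∈ evenRoots 𝔥) : α (h α) = 2 :=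
  (D.coroot α hα).1

/-- The real parts of the values on the coroots. -/
def corootCoords : Dual ℂ 𝔥 →ₗ[ℝ] EuclideanSpace ℝ D.finite.toFinset where
  toFun x := WithLp.toLp 2 fun γ => (x (h γ)).re
  map_add' x y := by ext γ; simp
  map_smul' c x := by ext γ; simp

/-- The form `(x, y) ↦ ∑ Re x(h γ) Re y(h γ)`, the sum being over the even roots `γ`. -/
def form : LinearMap.BilinForm ℝ (Dual ℂ 𝔥) :=
  (innerₗ (EuclideanSpace ℝ D.finite.toFinset)).compl₁₂ D.corootCoords D.corootCoords

theorem form_eq_inner (x y : Dual ℂ 𝔥) :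
    D.form x y = inner ℝ (D.corootCoords x) (D.corootCoords y) := rfl

theorem form_apply (x y : Dual ℂ 𝔥) :
    D.form x y = ∑ γ ∈ D.finite.toFinset, (x (h γ)).re * (y (h γ)).re := by
  rw [form_eq_inner, PiLp.inner_apply,
    ← Finset.sum_coe_sort D.finite.toFinset fun γ => (x (h γ)).re * (y (h γ)).re]
  refine Finset.sum_congr rfl fun γ _ => ?_
  simp [corootCoords, mul_comm]

include D in
theorem apply_coroot_eq_re {x : Dual ℂ 𝔥} (hx : x ∈ Submodule.span ℝ (evenRoots 𝔥))
    {γ : Dual ℂ 𝔥} (hγ : γ ∈ evenRoots 𝔥) : x (h γ) = ((x (h γ)).re : ℂ) := by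
  induction hx using Submodule.span_induction with
  | mem x hx =>
    obtain ⟨n, hn⟩ := D.integral γ hγ x hx
    rw [hn]; simp
  | zero => simp
  | add x y _ _ hx hy => rw [LinearMap.add_apply, hx, hy]; simp
  | smul c x _ hx => rw [LinearMap.smul_apply, hx]; simp

theorem ofReal_form {x y : Dual ℂ 𝔥} (hx : x ∈ Submodule.span ℝ (evenRoots 𝔥))
    (hy : y ∈ Submodule.span ℝ (evenRoots 𝔥)) :
    ((D.form x y : ℝ) : ℂ) = ∑ γ ∈ D.finite.toFinset, x (h γ) * y (h γ) := by
  rw [form_apply, Complex.ofReal_sum]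
  refine Finset.sum_congr rfl fun γ hγ => ?_
  have hγ' := D.finite.mem_toFinset.1 hγ
  rw [Complex.ofReal_mul, ← D.apply_coroot_eq_re hx hγ', ← D.apply_coroot_eq_re hy hγ']

theorem two_mul_form_eq {α x : Dual ℂ 𝔥} (hα : α ∈ evenRoots 𝔥)
    (hx : x ∈ Submodule.span ℝ (evenRoots 𝔥)) :
    2 * D.form α x = (x (h α)).re * D.form α α := by
  induction hx using Submodule.span_induction with
  | mem β hβ =>
    have hα' := Submodule.subset_span (R := ℝ) hα
    have hβ' := Submodule.subset_span (R := ℝ) hβ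
    have h1 := D.two_mul_form α hα β hβ
    rw [← D.ofReal_form hα' hβ', ← D.ofReal_form hα' hα', D.apply_coroot_eq_re hβ' hα] at h1
    exact_mod_cast h1
  | zero => simp
  | add x y _ _ hx hy => rw [map_add, mul_add, hx, hy, LinearMap.add_apply, Complex.add_re, add_mul]
  | smul c x _ hx =>
    rw [map_smul, smul_eq_mul, mul_left_comm, hx, LinearMap.smul_apply, Complex.smul_re,
      smul_eq_mul, mul_assoc]

theorem form_self_pos {α : Dual ℂ 𝔥} (hα : α ∈ evenRoots 𝔥) : 0 < D.form α α := by
  rw [form_apply]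
  refine Finset.sum_pos' (fun γ _ => mul_self_nonneg _) ⟨α, D.finite.mem_toFinset.2 hα, ?_⟩
  rw [D.apply_coroot_self hα]; norm_num

/-- On the real span of the roots the form is the sum of the squares of the real values at the
coroots, and these values determine the functional. An acute angle means a positive Cartan integer,
so the root string supplies the difference. -/
theorem isRootSet : IsRootSet D.form (evenRoots 𝔥) where
  finite := D.finite
  symm x y := by rw [form_eq_inner, form_eq_inner, real_inner_comm]
  nonneg x := by rw [form_eq_inner]; exact real_inner_self_nonneg
  definite x hx h0 := by
    refine D.eq_zero x (Submodule.span_le_restrictScalars ℝ ℂ _ hx) fun γ hγ => ?_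
    rw [form_apply, Finset.sum_eq_zero_iff_of_nonneg fun γ _ => mul_self_nonneg _] at h0
    rw [D.apply_coroot_eq_re hx hγ, mul_self_eq_zero.1 (h0 γ (D.finite.mem_toFinset.2 hγ)),
      Complex.ofReal_zero]
  ne_zero α hα := hα.1
  neg_mem := D.neg_mem
  sub_mem α hα β hβ hpos hne := by
    obtain ⟨n, hn⟩ := D.integral α hα β hβ
    have h1 := D.two_mul_form_eq hα (Submodule.subset_span hβ)
    rw [hn, Complex.intCast_re] at h1
    have h2 : (0 : ℝ) < n := by
      refine pos_of_mul_pos_left (b := D.form α α) ?_ (D.form_self_pos hα).le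
      linarith
    rw [← neg_sub]
    exact D.neg_mem _ (D.sub_mem α hα β hβ n hn (by exact_mod_cast h2) hne.symm)

/-- The element `∑ Re v(h γ) h γ` of the Cartan subalgebra that represents `v`. -/
def represent (v : Dual ℂ 𝔥) : 𝔥 :=
  ∑ γ ∈ D.finite.toFinset, (((v (h γ)).re : ℝ) : ℂ) • h γ

theorem apply_represent (v : Dual ℂ 𝔥) {α : Dual ℂ 𝔥} (hα : α ∈ evenRoots 𝔥) :
    α (D.represent v) = ((D.form v α : ℝ) : ℂ) := by
  rw [represent, map_sum, form_apply, Complex.ofReal_sum]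
  refine Finset.sum_congr rfl fun γ hγ => ?_
  rw [map_smul, smul_eq_mul, Complex.ofReal_mul,
    ← D.apply_coroot_eq_re (Submodule.subset_span hα) (D.finite.mem_toFinset.1 hγ)]

include D in
theorem exists_sign_ne_zero {α : Dual ℂ 𝔥} (hα : α ∈ evenRoots 𝔥) :
    ∃ x ∈ weightSpace L (α : 𝔥 → ℂ), ∃ y ∈ weightSpace L ((-α : Dual ℂ 𝔥) : 𝔥 → ℂ),
      x ≠ 0 ∧ y ≠ 0 ∧ ⁅x, y⁆ = (h α : L) ∧ (h α : L) ≠ 0 := by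
  obtain ⟨h2, x, hx, y, hy, hxy⟩ := D.coroot α hα
  have h0 : (h α : L) ≠ 0 := by
    intro h0
    rw [show h α = 0 from Subtype.ext h0, map_zero] at h2
    exact two_ne_zero h2.symm
  refine ⟨x, hx, y, hy, ?_, ?_, hxy, h0⟩
  · rintro rfl; rw [zero_lie] at hxy; exact h0 hxy.symm
  · rintro rfl; rw [lie_zero] at hxy; exact h0 hxy.symm

/-! ### Involutions that preserve the Cartan subalgebra -/

section Theta

variable {θ : L →ₗ⁅ℂ⁆ L} (hθθ : ∀ x, θ (θ x) = x) (hθ𝔥 : ∀ x ∈ 𝔥, θ x ∈ 𝔥)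

/-- The action of `θ` on the dual of the Cartan subalgebra. -/
def thetaDual (hθ𝔥 : ∀ x ∈ 𝔥, θ x ∈ 𝔥) : Dual ℂ 𝔥 →ₗ[ℝ] Dual ℂ 𝔥 where
  toFun x := x ∘ₗ (θ : L →ₗ[ℂ] L).restrict (p := 𝔥.toSubmodule) (q := 𝔥.toSubmodule) hθ𝔥
  map_add' _ _ := rfl
  map_smul' _ _ := rfl

omit [𝔥.IsCartanSubalgebra] in
theorem thetaDual_apply (x : Dual ℂ 𝔥) (H : 𝔥) :
    thetaDual hθ𝔥 x H = x ⟨θ H, hθ𝔥 H H.2⟩ := rfl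

omit [𝔥.IsCartanSubalgebra] in
include hθθ in
theorem thetaDual_thetaDual (x : Dual ℂ 𝔥) : thetaDual hθ𝔥 (thetaDual hθ𝔥 x) = x := by
  ext H
  rw [thetaDual_apply, thetaDual_apply]
  congr 1
  exact Subtype.ext (hθθ H)

omit [𝔥.IsCartanSubalgebra] in
theorem isImaginary_iff (α : Dual ℂ 𝔥) : IsImaginary θ 𝔥 α ↔ thetaDual hθ𝔥 α = α := by
  constructor
  · intro h1
    ext H
    exact h1 H ⟨θ H, hθ𝔥 H H.2⟩ rfl
  · intro h1 H H' hH
    rw [← DFunLike.congr_fun h1 H, thetaDual_apply]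
    congr 1
    exact Subtype.ext hH

omit [𝔥.IsCartanSubalgebra] in
include hθθ in
theorem theta_mem_weightSpace {α : Dual ℂ 𝔥} {x : L} (hx : x ∈ weightSpace L (α : 𝔥 → ℂ)) :
    θ x ∈ weightSpace L (thetaDual hθ𝔥 α : 𝔥 → ℂ) := by
  rw [mem_weightSpace] at hx ⊢
  intro H
  have h1 := congrArg θ (hx ⟨θ H, hθ𝔥 H H.2⟩)
  rw [LieSubalgebra.coe_bracket_of_module, LieHom.map_lie, hθθ, map_smul] at h1
  exact h1

omit [𝔥.IsCartanSubalgebra] in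
include hθθ in
theorem thetaDual_mem {α : Dual ℂ 𝔥} (hα : α ∈ evenRoots 𝔥) :
    thetaDual hθ𝔥 α ∈ evenRoots 𝔥 := by
  refine ⟨fun h0 => hα.1 ?_, ?_⟩
  · rw [← thetaDual_thetaDual hθθ hθ𝔥 α, h0, map_zero]
  · obtain ⟨x, hx, hx0⟩ := LieSubmodule.ne_bot_iff_exists.1 hα.2
    refine LieSubmodule.ne_bot_iff_exists.2 ⟨θ x, theta_mem_weightSpace hθθ hθ𝔥 hx, fun h0 => hx0 ?_⟩
    rw [← hθθ x, h0, map_zero]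

include D hθθ in
theorem theta_coroot {α : Dual ℂ 𝔥} (hα : α ∈ evenRoots 𝔥) :
    (⟨θ (h α), hθ𝔥 _ (h α).2⟩ : 𝔥) = h (thetaDual hθ𝔥 α) := by
  refine D.coroot_unique _ (thetaDual_mem hθθ hθ𝔥 hα) _ ?_
  obtain ⟨h2, e, he, f, hf, hef⟩ := D.coroot α hα
  refine ⟨?_, θ e, theta_mem_weightSpace hθθ hθ𝔥 he, θ f, ?_, ?_⟩
  · rw [thetaDual_apply, ← h2]
    congr 1
    exact Subtype.ext (hθθ _)
  · rw [← map_neg]; exact theta_mem_weightSpace hθθ hθ𝔥 hf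
  · rw [← LieHom.map_lie, hef]

include hθθ in
theorem sum_thetaDual {M : Type*} [AddCommMonoid M] (g : Dual ℂ 𝔥 → M) :
    ∑ γ ∈ D.finite.toFinset, g (thetaDual hθ𝔥 γ) = ∑ γ ∈ D.finite.toFinset, g γ := by
  refine Finset.sum_bij' (fun γ _ => thetaDual hθ𝔥 γ) (fun γ _ => thetaDual hθ𝔥 γ)
    (fun γ hγ => ?_) (fun γ hγ => ?_) (fun γ _ => thetaDual_thetaDual hθθ hθ𝔥 γ)
    (fun γ _ => thetaDual_thetaDual hθθ hθ𝔥 γ) fun _ _ => rfl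
  all_goals
    exact D.finite.mem_toFinset.2 (thetaDual_mem hθθ hθ𝔥 (D.finite.mem_toFinset.1 hγ))

include hθθ in
-- The involution permutes the roots and, compatibly, their coroots, so it only reorders the sum
-- that defines the form.
theorem form_thetaDual (x y : Dual ℂ 𝔥) :
    D.form (thetaDual hθ𝔥 x) (thetaDual hθ𝔥 y) = D.form x y := by
  rw [form_apply, form_apply,
    ← D.sum_thetaDual hθθ hθ𝔥 fun γ => (x (h γ)).re * (y (h γ)).re]
  refine Finset.sum_congr rfl fun γ hγ => ?_
  rw [thetaDual_apply, thetaDual_apply, D.theta_coroot hθθ hθ𝔥 (D.finite.mem_toFinset.1 hγ)]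

include hθθ in
theorem theta_represent {v : Dual ℂ 𝔥} (hv : thetaDual hθ𝔥 v = v) :
    θ (D.represent v) = D.represent v := by
  have h1 : (⟨θ (D.represent v), hθ𝔥 _ (D.represent v).2⟩ : 𝔥) = D.represent v := by
    have h2 : (⟨θ (D.represent v), hθ𝔥 _ (D.represent v).2⟩ : 𝔥) =
        (θ : L →ₗ[ℂ] L).restrict (p := 𝔥.toSubmodule) (q := 𝔥.toSubmodule) hθ𝔥
          (D.represent v) := rfl
    rw [h2, represent, map_sum, ← D.sum_thetaDual hθθ hθ𝔥
      fun γ => (((v (h γ)).re : ℝ) : ℂ) • h γ]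
    refine Finset.sum_congr rfl fun γ hγ => ?_
    rw [map_smul, ← D.theta_coroot hθθ hθ𝔥 (D.finite.mem_toFinset.1 hγ), ← thetaDual_apply hθ𝔥 v,
      hv]
    rfl
  exact congrArg Subtype.val h1

/-- The root space of `α` lies in the `-1` eigenspace of `θ`. -/
def Noncompact (θ : L →ₗ⁅ℂ⁆ L) (α : Dual ℂ 𝔥) : Prop :=
  ∀ x ∈ weightSpace L (α : 𝔥 → ℂ), θ x = -x

include D hθθ in
-- A root space is a line, so `θ` acts on that of a fixed root by a scalar, whose square is `1`.
theorem exists_sign {α : Dual ℂ 𝔥} (hα : α ∈ evenRoots 𝔥) (hi : thetaDual hθ𝔥 α = α) :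
    ∃ c : ℂ, (c = 1 ∨ c = -1) ∧ (Noncompact θ α ↔ c = -1) ∧
      ∀ x ∈ weightSpace L (α : 𝔥 → ℂ), θ x = c • x := by
  obtain ⟨e, he, he0⟩ := LieSubmodule.ne_bot_iff_exists.1 hα.2
  have hθe := theta_mem_weightSpace hθθ hθ𝔥 he
  rw [hi] at hθe
  obtain ⟨c, hc⟩ := D.proportional α hα e he _ hθe he0
  have hall : ∀ x ∈ weightSpace L (α : 𝔥 → ℂ), θ x = c • x := by
    intro x hx
    obtain ⟨d, rfl⟩ := D.proportional α hα e he x hx he0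
    rw [map_smul, hc, smul_comm]
  have hcc : c * c = 1 := by
    have h1 := hθθ e
    rw [hc, map_smul, hc, smul_smul] at h1
    have h2 : (c * c - 1) • e = 0 := by rw [sub_smul, h1, one_smul, sub_self]
    exact sub_eq_zero.1 ((smul_eq_zero.1 h2).resolve_right he0)
  refine ⟨c, mul_self_eq_one_iff.1 hcc, ⟨fun hn => ?_, fun h1 x hx => ?_⟩, hall⟩
  · have h1 := hn e he
    rw [hc] at h1
    have h2 : (c + 1) • e = 0 := by rw [add_smul, h1, one_smul, neg_add_cancel]
    exact eq_neg_of_add_eq_zero_left ((smul_eq_zero.1 h2).resolve_right he0)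
  · rw [hall x hx, h1, neg_one_smul]

include D hθθ in
-- The coroot is a bracket of root vectors for `α` and `-α` and is fixed by `θ`, so the two signs
-- have product `1`.
theorem noncompact_neg {α : Dual ℂ 𝔥} (hα : α ∈ evenRoots 𝔥) (hi : thetaDual hθ𝔥 α = α) :
    Noncompact θ (-α) ↔ Noncompact θ α := by
  obtain ⟨c, hc, hcn, hcx⟩ := D.exists_sign hθθ hθ𝔥 hα hi
  obtain ⟨d, hd, hdn, hdx⟩ := D.exists_sign hθθ hθ𝔥 (D.neg_mem α hα) (by rw [map_neg, hi])
  obtain ⟨x, hx, y, hy, -, -, hxy, h0⟩ := D.exists_sign_ne_zero hα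
  have h1 : θ (h α) = h α := by
    have := D.theta_coroot hθθ hθ𝔥 hα
    rw [hi] at this
    exact congrArg Subtype.val this
  have h2 : θ ⁅x, y⁆ = (c * d) • ⁅x, y⁆ := by
    rw [LieHom.map_lie, hcx x hx, hdx y hy, smul_lie, lie_smul, smul_smul]
  rw [hxy, h1] at h2
  have h3 : c * d = 1 := by
    have h4 : (c * d - 1) • (h α : L) = 0 := by rw [sub_smul, ← h2, one_smul, sub_self]
    exact sub_eq_zero.1 ((smul_eq_zero.1 h4).resolve_right h0)
  rw [hcn, hdn]
  rcases hc with rfl | rfl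
  · rw [one_mul] at h3; rw [h3]
  · rw [neg_one_mul, neg_eq_iff_eq_neg] at h3; rw [h3]

include D hθθ in
-- The bracket of root vectors for `α` and `β` is a nonzero root vector for `α + β`, so the signs
-- multiply.
theorem noncompact_add {α β : Dual ℂ 𝔥} (hα : α ∈ evenRoots 𝔥) (hβ : β ∈ evenRoots 𝔥)
    (hiα : thetaDual hθ𝔥 α = α) (hiβ : thetaDual hθ𝔥 β = β) (hαβ : α + β ∈ evenRoots 𝔥) :
    Noncompact θ (α + β) ↔ ¬(Noncompact θ α ↔ Noncompact θ β) := by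
  obtain ⟨c, hc, hcn, hcx⟩ := D.exists_sign hθθ hθ𝔥 hα hiα
  obtain ⟨d, hd, hdn, hdx⟩ := D.exists_sign hθθ hθ𝔥 hβ hiβ
  obtain ⟨k, hk, hkn, hkx⟩ := D.exists_sign hθθ hθ𝔥 hαβ (by rw [map_add, hiα, hiβ])
  obtain ⟨x, hx, hx0⟩ := LieSubmodule.ne_bot_iff_exists.1 hα.2
  obtain ⟨y, hy, hy0⟩ := LieSubmodule.ne_bot_iff_exists.1 hβ.2
  have hne := D.lie_ne_zero α hα β hβ hαβ x hx y hy hx0 hy0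
  have hmem : ⁅x, y⁆ ∈ weightSpace L ((α + β : Dual ℂ 𝔥) : 𝔥 → ℂ) := by
    rw [mem_weightSpace] at hx hy ⊢
    intro H
    rw [LieSubalgebra.coe_bracket_of_module, leibniz_lie,
      ← LieSubalgebra.coe_bracket_of_module, ← LieSubalgebra.coe_bracket_of_module, hx, hy,
      smul_lie, lie_smul, ← add_smul]
    rfl
  have h2 : θ ⁅x, y⁆ = (c * d) • ⁅x, y⁆ := by
    rw [LieHom.map_lie, hcx x hx, hdx y hy, smul_lie, lie_smul, smul_smul]
  rw [hkx _ hmem] at h2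
  have h3 : k = c * d := by
    have h4 : (k - c * d) • ⁅x, y⁆ = 0 := by rw [sub_smul, h2, sub_self]
    exact sub_eq_zero.1 ((smul_eq_zero.1 h4).resolve_right hne)
  rw [hcn, hdn, hkn]
  have h5 : (1 : ℂ) ≠ -1 := by norm_num
  rcases hc with rfl | rfl <;> rcases hd with rfl | rfl <;> simp [h3, h5]

end Theta

end EvenRootData

/-! ### Consequences of the definiteness of the Cartan involution -/

namespace LieSuperalgebra.RealForm.IsCartanInvolution

variable {𝔤₀ 𝔤₁ : Type*} [LieRing 𝔤₀] [LieAlgebra ℂ 𝔤₀]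
  [AddCommGroup 𝔤₁] [Module ℂ 𝔤₁] [LieRingModule 𝔤₀ 𝔤₁] [LieModule ℂ 𝔤₀ 𝔤₁]
  {S : LieSuperalgebra ℂ 𝔤₀ 𝔤₁} {C : S.RealForm} {θ : 𝔤₀ →ₗ⁅ℂ⁆ 𝔤₀}
  (hθ : C.IsCartanInvolution θ)

include hθ

theorem killingForm_theta (x y : 𝔤₀) :
    killingForm ℂ 𝔤₀ (θ x) (θ y) = killingForm ℂ 𝔤₀ x y := by
  let e : 𝔤₀ ≃ₗ⁅ℂ⁆ 𝔤₀ :=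
    { θ with
      invFun := θ
      left_inv := hθ.involutive
      right_inv := hθ.involutive }
  exact killingForm_of_equiv_apply e x y

theorem killingForm_theta_right (x y : 𝔤₀) :
    killingForm ℂ 𝔤₀ x (θ y) = killingForm ℂ 𝔤₀ y (θ x) := by
  rw [← hθ.killingForm_theta, hθ.involutive, LieModule.traceForm_comm]

/-- Write `x = a + i b` with `a`, `b` real. The cross terms cancel because `κ(a, θ b) = κ(b, θ a)`,
and `κ(a, θ a) + κ(b, θ b)` is left. Real parts that are central contribute zero, and `a` and `b`
are not both central. -/
theorem killingForm_theta_conj_re_neg {x : 𝔤₀} (hx : x ∉ center ℂ 𝔤₀) :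
    (killingForm ℂ 𝔤₀ x (θ (C.conj₀ x))).re < 0 := by
  have hconj2 : (starRingEnd ℂ) 2 = 2 := map_ofNat _ 2
  obtain ⟨a, b, haσ, hbσ, hx1⟩ : ∃ a b : 𝔤₀, C.conj₀ a = a ∧ C.conj₀ b = b ∧
      x = a + Complex.I • b := by
    refine ⟨(2⁻¹ : ℂ) • (x + C.conj₀ x), (-Complex.I * 2⁻¹) • (x - C.conj₀ x), ?_, ?_, ?_⟩
    · rw [map_smulₛₗ, map_add, C.conj₀_conj₀, add_comm, map_inv₀, hconj2]
    · rw [map_smulₛₗ, map_sub, C.conj₀_conj₀, ← neg_sub, smul_neg, ← neg_smul, map_mul, map_inv₀,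
        hconj2, map_neg, Complex.conj_I, neg_neg, neg_mul]
    · rw [smul_smul, ← mul_assoc, mul_neg, Complex.I_mul_I]
      module
  have hσx : C.conj₀ x = a - Complex.I • b := by
    rw [hx1, map_add, map_smulₛₗ, haσ, hbσ, Complex.conj_I, neg_smul, sub_eq_add_neg]
  have hκ : killingForm ℂ 𝔤₀ x (θ (C.conj₀ x)) =
      killingForm ℂ 𝔤₀ a (θ a) + killingForm ℂ 𝔤₀ b (θ b) := by
    have h1 := hθ.killingForm_theta_right a b
    rw [hσx]
    nth_rewrite 1 [hx1]
    simp only [map_add, map_sub, map_smul, LinearMap.add_apply, LinearMap.smul_apply, smul_eq_mul,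
      h1]
    linear_combination -(killingForm ℂ 𝔤₀ b (θ b)) * Complex.I_mul_I
  have key : ∀ y, C.conj₀ y = y → (killingForm ℂ 𝔤₀ y (θ y)).re ≤ 0 ∧
      (y ∉ center ℂ 𝔤₀ → (killingForm ℂ 𝔤₀ y (θ y)).re < 0) := by
    intro y hy
    by_cases hyc : y ∈ center ℂ 𝔤₀
    · exact ⟨by rw [killingForm_eq_zero_of_mem_center hyc]; simp, fun h => absurd hyc h⟩
    · have := hθ.definite y hy hyc
      exact ⟨by linarith, fun _ => by linarith⟩
  rw [hκ, Complex.add_re]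
  by_cases hac : a ∈ center ℂ 𝔤₀
  · have hbc : b ∉ center ℂ 𝔤₀ := fun hbc => hx (by
      rw [hx1]; exact add_mem hac ((center ℂ 𝔤₀).smul_mem _ hbc))
    linarith [(key a haσ).1, (key b hbσ).2 hbc]
  · linarith [(key a haσ).2 hac, (key b hbσ).1]

theorem mem_center_of_killingForm_eq_zero {x : 𝔤₀} (hx : ∀ y, killingForm ℂ 𝔤₀ x y = 0) :
    x ∈ center ℂ 𝔤₀ := by
  by_contra h
  have := hθ.killingForm_theta_conj_re_neg h
  rw [hx] at this
  simp at this

theorem isKillingComplement [FiniteDimensional ℂ 𝔤₀] (hS : S.IsBasic) :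
    IsKillingComplement ⁅(⊤ : LieIdeal ℂ 𝔤₀), (⊤ : LieIdeal ℂ 𝔤₀)⁆ := by
  obtain ⟨B₀, B₁, hB⟩ := hS.form
  exact isKillingComplement_derived (fun x hx => hθ.mem_center_of_killingForm_eq_zero hx)
    hB.nondegenerate_even hB.symm_even hB.invariant_even

/-- The composite of `θ` with the conjugation is an antilinear involution; below it plays the role
of the conjugation of a compact form. -/
theorem theta_conj_theta_conj (x : 𝔤₀) : θ (C.conj₀ (θ (C.conj₀ x))) = x := by
  rw [← hθ.comm_conj, hθ.involutive, C.conj₀_conj₀]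

variable {𝔥 : LieSubalgebra ℂ 𝔤₀} (h𝔥 : C.IsStableCartan θ 𝔥)

/-- For `τ = θ ∘ conj`, the adjoint of `ad H` for the Hermitian form `κ(x, τ y)` is `-ad (τ H)`. At
a root vector `e` one has `κ(e, τ e) ≠ 0`, so the eigenvalues can be compared. -/
theorem apply_eq_neg_conj {α : Dual ℂ 𝔥} (hα : α ∈ evenRoots 𝔥) {H H' : 𝔥}
    (hH : (H' : 𝔤₀) = θ (C.conj₀ H)) : α H = -(starRingEnd ℂ) (α H') := by
  obtain ⟨e, he, he0⟩ := LieSubmodule.ne_bot_iff_exists.1 hα.2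
  rw [mem_weightSpace] at he
  have hec : e ∉ center ℂ 𝔤₀ := by
    intro hec
    refine hα.1 (LinearMap.ext fun H => ?_)
    have h1 := he H
    rw [LieSubalgebra.coe_bracket_of_module, mem_center_iff_lie_eq_zero.1 hec] at h1
    exact (smul_eq_zero.1 h1.symm).resolve_right he0
  have hκ : killingForm ℂ 𝔤₀ e (θ (C.conj₀ e)) ≠ 0 := by
    intro h0
    have := hθ.killingForm_theta_conj_re_neg hec
    rw [h0] at this
    simp at this
  have h1 : ⁅(H : 𝔤₀), θ (C.conj₀ e)⁆ = (starRingEnd ℂ) (α H') • θ (C.conj₀ e) := by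
    have h2 : (H : 𝔤₀) = θ (C.conj₀ H') := by rw [hH, hθ.theta_conj_theta_conj]
    rw [h2, ← LieHom.map_lie, ← C.conj_lie, ← LieSubalgebra.coe_bracket_of_module, he,
      map_smulₛₗ, map_smul]
  have h3 : killingForm ℂ 𝔤₀ ⁅(H : 𝔤₀), e⁆ (θ (C.conj₀ e)) =
      -killingForm ℂ 𝔤₀ e ⁅(H : 𝔤₀), θ (C.conj₀ e)⁆ := by
    rw [← lie_skew, map_neg, LinearMap.neg_apply, LieModule.traceForm_apply_lie_apply]
  rw [h1, ← LieSubalgebra.coe_bracket_of_module, he, map_smul, map_smul, LinearMap.smul_apply,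
    smul_eq_mul, smul_eq_mul, ← neg_mul] at h3
  exact mul_right_cancel₀ hκ h3

include h𝔥

theorem theta_conj_mem_weightSpace {α : Dual ℂ 𝔥} (hα : α ∈ evenRoots 𝔥) {x : 𝔤₀}
    (hx : x ∈ weightSpace 𝔤₀ (α : 𝔥 → ℂ)) :
    θ (C.conj₀ x) ∈ weightSpace 𝔤₀ ((-α : Dual ℂ 𝔥) : 𝔥 → ℂ) := by
  rw [mem_weightSpace] at hx ⊢
  intro H
  have hmem : θ (C.conj₀ H) ∈ 𝔥 := h𝔥.theta_mem _ (h𝔥.conj_mem _ H.2)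
  rw [LinearMap.neg_apply, hθ.apply_eq_neg_conj hα (H := H) (H' := ⟨_, hmem⟩) rfl, neg_neg,
    LieSubalgebra.coe_bracket_of_module, ← map_smul, ← map_smulₛₗ, ← hx,
    LieSubalgebra.coe_bracket_of_module, C.conj_lie, LieHom.map_lie, hθ.theta_conj_theta_conj]

omit h𝔥 hθ in
theorem _root_.EvenRootData.coroot_neg [𝔥.IsCartanSubalgebra] {h : Dual ℂ 𝔥 → 𝔥}
    (D : EvenRootData 𝔥 h) {α : Dual ℂ 𝔥} (hα : α ∈ evenRoots 𝔥) : h (-α) = -h α := by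
  refine (D.coroot_unique _ (D.neg_mem α hα) _ ?_).symm
  obtain ⟨h2, e, he, f, hf, hef⟩ := D.coroot α hα
  refine ⟨?_, f, hf, e, by rwa [neg_neg], ?_⟩
  · rw [LinearMap.neg_apply, map_neg, h2, neg_neg]
  · rw [← lie_skew, hef]; rfl

variable [𝔥.IsCartanSubalgebra] {h : Dual ℂ 𝔥 → 𝔥} (D : EvenRootData 𝔥 h)

include D

theorem theta_conj_coroot {α : Dual ℂ 𝔥} (hα : α ∈ evenRoots 𝔥) :
    θ (C.conj₀ (h α)) = -(h α : 𝔤₀) := by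
  have hmem : θ (C.conj₀ (h α)) ∈ 𝔥 := h𝔥.theta_mem _ (h𝔥.conj_mem _ (h α).2)
  have h1 : (⟨_, hmem⟩ : 𝔥) = h (-α) := by
    refine D.coroot_unique _ (D.neg_mem α hα) _ ?_
    obtain ⟨h2, e, he, f, hf, hef⟩ := D.coroot α hα
    refine ⟨?_, _, hθ.theta_conj_mem_weightSpace h𝔥 hα he, _,
      hθ.theta_conj_mem_weightSpace h𝔥 (D.neg_mem α hα) hf, ?_⟩
    · rw [LinearMap.neg_apply, hθ.apply_eq_neg_conj hα (H' := h α)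
        (hθ.theta_conj_theta_conj _).symm, h2, neg_neg, map_ofNat]
    · rw [← LieHom.map_lie, ← C.conj_lie, hef]
  rw [D.coroot_neg hα] at h1
  exact congrArg Subtype.val h1

/-- The representing element is a real combination of coroots, which `θ ∘ conj` negates. Since `θ`
fixes it, conjugation negates it; so it lies in `i𝔱₀`. -/
theorem conj_represent {v : Dual ℂ 𝔥} (hv : EvenRootData.thetaDual h𝔥.theta_mem v = v) :
    C.conj₀ (D.represent v) = -(D.represent v : 𝔤₀) := by
  have h1 : θ (C.conj₀ (D.represent v)) = -(D.represent v : 𝔤₀) := by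
    rw [EvenRootData.represent, AddSubmonoidClass.coe_finsetSum, map_sum, map_sum,
      ← Finset.sum_neg_distrib]
    refine Finset.sum_congr rfl fun γ hγ => ?_
    rw [SetLike.val_smul, map_smulₛₗ, map_smul, Complex.conj_ofReal,
      hθ.theta_conj_coroot h𝔥 D (D.finite.mem_toFinset.1 hγ), smul_neg]
  rw [← hθ.involutive (C.conj₀ _), h1, map_neg,
    D.theta_represent hθ.involutive h𝔥.theta_mem hv]

omit D [𝔥.IsCartanSubalgebra] in
-- A functional that vanishes on `i𝔱₀` vanishes on all `θ`-fixed elements of `𝔥`, in particular on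
-- `θ H + H`.
theorem thetaDual_eq_neg {α : Dual ℂ 𝔥}
    (hα : ∀ T : 𝔥, C.conj₀ T = -T → θ T = T → α T = 0) :
    EvenRootData.thetaDual h𝔥.theta_mem α = -α := by
  ext H
  rw [EvenRootData.thetaDual_apply, LinearMap.neg_apply, eq_neg_iff_add_eq_zero, ← map_add]
  set K : 𝔥 := ⟨θ H, h𝔥.theta_mem H H.2⟩ + H with hK
  have hθK : θ (K : 𝔤₀) = K := by
    rw [hK]
    change θ (θ H + H) = θ H + H
    rw [map_add, hθ.involutive, add_comm]
  have hθσK : θ (C.conj₀ K) = C.conj₀ K := by rw [hθ.comm_conj, hθK]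
  let K' : 𝔥 := ⟨C.conj₀ K, h𝔥.conj_mem K K.2⟩
  -- For `θ`-fixed `K` with conjugate `K'`, both `K - K'` and `i (K + K')` lie in `i𝔱₀`, and
  -- together they recover `K`.
  have h1 : α (K - K') = 0 := by
    refine hα _ ?_ ?_
    · change C.conj₀ ((K : 𝔤₀) - C.conj₀ K) = -((K : 𝔤₀) - C.conj₀ K)
      rw [map_sub, C.conj₀_conj₀, neg_sub]
    · change θ ((K : 𝔤₀) - C.conj₀ K) = (K : 𝔤₀) - C.conj₀ K
      rw [map_sub, hθK, hθσK]
  have h2 : α (Complex.I • (K + K')) = 0 := by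
    refine hα _ ?_ ?_
    · change C.conj₀ (Complex.I • ((K : 𝔤₀) + C.conj₀ K)) = -(Complex.I • ((K : 𝔤₀) + C.conj₀ K))
      rw [map_smulₛₗ, map_add, C.conj₀_conj₀, Complex.conj_I, neg_smul, add_comm]
    · change θ (Complex.I • ((K : 𝔤₀) + C.conj₀ K)) = Complex.I • ((K : 𝔤₀) + C.conj₀ K)
      rw [map_smul, map_add, hθK, hθσK]
  rw [map_smul, smul_eq_zero_iff_right Complex.I_ne_zero] at h2
  have h3 : α K + α K = 0 := by
    rw [map_sub] at h1; rw [map_add] at h2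
    linear_combination h1 + h2
  exact self_eq_neg.1 (eq_neg_of_add_eq_zero_left h3)

end LieSuperalgebra.RealForm.IsCartanInvolution

/-! ### A positive system adapted to a minimal parity vector -/

/-- On a finite set, a large multiple of `g` outweighs `f` wherever `g` does not vanish. This
expresses a lexicographic order by a single functional. -/
theorem exists_lexicographic_scale {V : Type*} [AddCommGroup V] [Module ℝ V] {F : Set V}
    (hF : F.Finite) (g f : V →ₗ[ℝ] ℝ) :
    ∃ K : ℝ, ∀ x ∈ F, (0 < g x → 0 < K * g x + f x) ∧ (g x < 0 → K * g x + f x < 0) := by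
  have h : ∀ᶠ K : ℝ in Filter.atTop,
      ∀ x ∈ F, (0 < g x → 0 < K * g x + f x) ∧ (g x < 0 → K * g x + f x < 0) := by
    rw [Set.Finite.eventually_all hF]
    intro x _
    refine Filter.Eventually.and ?_ ?_
    · by_cases h0 : 0 < g x
      · filter_upwards [(Filter.tendsto_atTop_add_const_right _ (f x)
          (Filter.tendsto_id.atTop_mul_const h0)).eventually_gt_atTop 0] with K hK _ using hK
      · exact Filter.Eventually.of_forall fun _ h => absurd h h0
    · by_cases h0 : g x < 0
      · filter_upwards [(Filter.tendsto_atBot_add_const_right _ (f x)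
          (Filter.tendsto_id.atTop_mul_const_of_neg h0)).eventually_lt_atBot 0] with K hK _ using hK
      · exact Filter.Eventually.of_forall fun _ h => absurd h h0
  exact h.exists

namespace LieSuperalgebra

variable {𝔤₀ 𝔤₁ : Type*} [LieRing 𝔤₀] [LieAlgebra ℂ 𝔤₀]
  [AddCommGroup 𝔤₁] [Module ℂ 𝔤₁] [LieRingModule 𝔤₀ 𝔤₁] [LieModule ℂ 𝔤₀ 𝔤₁]

/-- The real part of the value at `H`. -/
def evalRe {𝔥 : LieSubalgebra ℂ 𝔤₀} (H : 𝔥) : Dual ℂ 𝔥 →ₗ[ℝ] ℝ where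
  toFun x := (x H).re
  map_add' x y := by simp
  map_smul' c x := by simp

theorem evalRe_apply {𝔥 : LieSubalgebra ℂ 𝔤₀} (H : 𝔥) (x : Dual ℂ 𝔥) : evalRe H x = (x H).re := rfl

theorem finite_oddRoots [FiniteDimensional ℂ 𝔤₁] (𝔥 : LieSubalgebra ℂ 𝔤₀)
    [LieRing.IsNilpotent 𝔥] : (oddRoots 𝔤₁ 𝔥).Finite := by
  refine Set.Finite.of_finite_image (f := fun α : Dual ℂ 𝔥 => (α : 𝔥 → ℂ))
    ((finite_genWeightSpace_ne_bot ℂ 𝔥 𝔤₁).subset ?_) (DFunLike.coe_injective.injOn)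
  rintro _ ⟨α, hα, rfl⟩ h0
  exact hα.2 (le_bot_iff.1 ((weightSpace_le_genWeightSpace 𝔤₁ (α : 𝔥 → ℂ)).trans h0.le))

variable {S : LieSuperalgebra ℂ 𝔤₀ 𝔤₁} {C : S.RealForm} {θ : 𝔤₀ →ₗ⁅ℂ⁆ 𝔤₀}
  {𝔥 : LieSubalgebra ℂ 𝔤₀}

/-- The functional `f` defines a positive system of even roots that takes `i𝔱₀` before `𝔞₀` and for
which a shortest parity vector `v` is dominant. -/
structure IsAdapted (C : S.RealForm) (hθ𝔥 : ∀ x ∈ 𝔥, θ x ∈ 𝔥) [𝔥.IsCartanSubalgebra]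
    {h : Dual ℂ 𝔥 → 𝔥} (D : EvenRootData 𝔥 h) (f : Dual ℂ 𝔥 →ₗ[ℝ] ℝ) (v : Dual ℂ 𝔥) :
    Prop where
  ne_zero : ∀ α ∈ evenRoots 𝔥, f α ≠ 0
  compactFirst : ∀ P : Set (Dual ℂ 𝔥), (∀ α ∈ evenRoots 𝔥, α ∈ P ↔ 0 < f α) →
    C.TakesCompactFirst θ 𝔥 P
  theta_mem : ∀ α ∈ IsRootSet.posRoots (evenRoots 𝔥) f,
    EvenRootData.thetaDual hθ𝔥 α ∈ IsRootSet.posRoots (evenRoots 𝔥) f ∨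
      EvenRootData.thetaDual hθ𝔥 α = -α
  parity : v ∈ IsRootSet.parityVectors D.form (evenRoots 𝔥) (EvenRootData.thetaDual hθ𝔥)
    (EvenRootData.Noncompact θ)
  minimal : ∀ w ∈ IsRootSet.parityVectors D.form (evenRoots 𝔥) (EvenRootData.thetaDual hθ𝔥)
    (EvenRootData.Noncompact θ), D.form v v ≤ D.form w w
  dominant : ∀ α ∈ IsRootSet.posRoots (evenRoots 𝔥) f, 0 ≤ D.form v α

/-- The new order compares inner products with the shortest parity vector `v`, then values at the
old `T`, then at `A`, and finally `f`. The first two criteria combine into one element of `i𝔱₀`, so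
the order still takes `i𝔱₀` before `𝔞₀`. -/
theorem exists_isAdapted [FiniteDimensional ℂ 𝔤₁] [𝔥.IsCartanSubalgebra]
    (hθ : C.IsCartanInvolution θ) {P : Set (Dual ℂ 𝔥)} (hP : C.IsTriple θ 𝔥 P)
    {h : Dual ℂ 𝔥 → 𝔥} (D : EvenRootData 𝔥 h) :
    ∃ f v, IsAdapted C hP.maximallyCompact.theta_mem D f v ∧ ∀ α ∈ oddRoots 𝔤₁ 𝔥, f α ≠ 0 := by
  have h𝔥 := hP.maximallyCompact.toIsStableCartan
  have hθ𝔥 := h𝔥.theta_mem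
  obtain ⟨f, hf, hPf⟩ := hP.positive
  obtain ⟨T, A, ⟨hT1, hT2⟩, ⟨hA1, hA2⟩, hTA, hPTA⟩ := hP.compactFirst
  have hfin : (evenRoots 𝔥 ∪ oddRoots 𝔤₁ 𝔥).Finite := D.finite.union (finite_oddRoots 𝔥)
  obtain ⟨v, hv, hmin⟩ := IsRootSet.exists_minimal_parityVector (R := evenRoots 𝔥) D.corootCoords
    D.form_eq_inner (EvenRootData.thetaDual hθ𝔥) (EvenRootData.Noncompact θ)
    (D.isRootSet.parityVectors_nonempty (fun α hα => hf α (Or.inl hα)) _ _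
      (fun β hβ hi => D.noncompact_neg hθ.involutive hθ𝔥 hβ hi)
      (fun β hβ γ hγ hiβ hiγ hβγ => D.noncompact_add hθ.involutive hθ𝔥 hβ hγ hiβ hiγ hβγ))
  obtain ⟨M, hM⟩ := exists_lexicographic_scale hfin (D.form v) (evalRe T)
  set T' : 𝔥 := (M : ℂ) • D.represent v + T with hT'
  have hT'α : ∀ α ∈ evenRoots 𝔥, (α T').re = M * D.form v α + evalRe T α := by
    intro α hα
    rw [hT', map_add, map_smul, D.apply_represent v hα, Complex.add_re, smul_eq_mul,
      ← Complex.ofReal_mul, Complex.ofReal_re, evalRe_apply]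
  have hθT' : θ T' = T' := by
    rw [hT']
    change θ ((M : ℂ) • (D.represent v : 𝔤₀) + T) = (M : ℂ) • (D.represent v : 𝔤₀) + T
    rw [map_add, map_smul, hT2, D.theta_represent hθ.involutive hθ𝔥 hv.2.1]
  have hσT' : C.conj₀ T' = -T' := by
    rw [hT']
    change C.conj₀ ((M : ℂ) • (D.represent v : 𝔤₀) + T) = -((M : ℂ) • (D.represent v : 𝔤₀) + T)
    rw [map_add, map_smulₛₗ, Complex.conj_ofReal, hT1, hθ.conj_represent h𝔥 D hv.2.1, smul_neg,
      neg_add]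
  -- An even root on which the new element `T'` vanishes also vanishes at the old `T`, hence on all
  -- of `i𝔱₀`.
  have hzero : ∀ α ∈ evenRoots 𝔥, (α T').re = 0 → D.form v α = 0 ∧ (α T).re = 0 := by
    intro α hα h0
    rw [hT'α α hα] at h0
    have h1 := hM α (Or.inl hα)
    rcases lt_trichotomy (D.form v α) 0 with h2 | h2 | h2
    · linarith [h1.2 h2]
    · rw [h2, mul_zero, zero_add] at h0
      exact ⟨h2, h0⟩
    · linarith [h1.1 h2]
  obtain ⟨K, hK⟩ := exists_lexicographic_scale hfin (evalRe T') (evalRe A)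
  -- Here `f` only breaks ties, which makes the values at the odd roots nonzero too.
  obtain ⟨K', hK'⟩ := exists_lexicographic_scale hfin (K • evalRe T' + evalRe A) f
  set f' : Dual ℂ 𝔥 →ₗ[ℝ] ℝ := K' • (K • evalRe T' + evalRe A) + f with hf'
  have hf'x : ∀ x, f' x = K' * (K * (x T').re + (x A).re) + f x := fun x => rfl
  have hpos : ∀ α ∈ evenRoots 𝔥, 0 < f' α ↔ (0 < (α T').re ∨ ((α T').re = 0 ∧ 0 < (α A).re)) := by
    have hp : ∀ α ∈ evenRoots 𝔥, (0 < (α T').re ∨ ((α T').re = 0 ∧ 0 < (α A).re)) → 0 < f' α := by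
      intro α hα h0
      refine (hK' α (Or.inl hα)).1 ?_
      rcases h0 with h0 | ⟨h0, h1⟩
      · exact (hK α (Or.inl hα)).1 h0
      · change 0 < K * (α T').re + (α A).re
        rw [h0, mul_zero, zero_add]; exact h1
    intro α hα
    refine ⟨fun h0 => ?_, hp α hα⟩
    by_contra h1
    have h2 : 0 < ((-α) T').re ∨ (((-α) T').re = 0 ∧ 0 < ((-α) A).re) := by
      rw [LinearMap.neg_apply, LinearMap.neg_apply, Complex.neg_re, Complex.neg_re]
      push Not at h1
      rcases h1.1.lt_or_eq with h2 | h2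
      · left; linarith
      · right
        refine ⟨by linarith, ?_⟩
        -- The value at `A` cannot vanish as well: one of `α` and `-α` lies in the given `P`, and
        -- with value zero at `T` this root must be positive at `A`.
        have h3 := (hzero α hα h2).2
        have h4 := hf α (Or.inl hα)
        rcases lt_or_gt_of_ne h4 with h5 | h5
        · have h6 : -α ∈ P := by
            rw [hPf]
            exact ⟨Or.inl (D.neg_mem α hα), by rw [map_neg]; linarith⟩
          rw [hPTA _ (D.neg_mem α hα)] at h6
          simp only [LinearMap.neg_apply, Complex.neg_re, h3] at h6
          simpa using h6
        · have h6 : α ∈ P := by rw [hPf]; exact ⟨Or.inl hα, h5⟩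
          rw [hPTA _ hα, h3] at h6
          have h7 := h1.2 h2
          simp at h6
          linarith
    have h3 := hp (-α) (D.neg_mem α hα) h2
    rw [map_neg] at h3
    linarith
  have hne : ∀ α ∈ evenRoots 𝔥 ∪ oddRoots 𝔤₁ 𝔥, f' α ≠ 0 := by
    intro α hα
    rcases lt_trichotomy ((K • evalRe T' + evalRe A) α) 0 with h2 | h2 | h2
    · exact ((hK' α hα).2 h2).ne
    · change K' * ((K • evalRe T' + evalRe A) α) + f α ≠ 0
      rw [h2, mul_zero, zero_add]
      exact hf α hα
    · exact ((hK' α hα).1 h2).ne'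
  refine ⟨f', v, ⟨fun α hα => hne α (Or.inl hα), fun P' hP' => ?_, fun α hα => ?_, hv, hmin,
    fun α hα => ?_⟩, fun α hα => hne α (Or.inr hα)⟩
  · exact ⟨T', A, ⟨hσT', hθT'⟩, ⟨hA1, hA2⟩, fun α hα h0 => hTA α hα (hzero α hα h0).2,
      fun α hα => by rw [hP' α hα, hpos α hα]⟩
  · rcases (hpos α hα.1).1 hα.2 with h0 | ⟨h0, -⟩
    · left
      have hm := EvenRootData.thetaDual_mem hθ.involutive hθ𝔥 hα.1
      refine ⟨hm, (hpos _ hm).2 (Or.inl ?_)⟩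
      rw [EvenRootData.thetaDual_apply]
      convert h0 using 4
    · exact Or.inr (hθ.thetaDual_eq_neg h𝔥 (hTA α hα.1 (hzero α hα.1 h0).2))
  · by_contra! h1
    have h2 := (hM α (Or.inl hα.1)).2 h1
    rw [← hT'α α hα.1] at h2
    rcases (hpos α hα.1).1 hα.2 with h0 | ⟨h0, -⟩ <;> linarith

/-! ### Painted vertices in one even part -/

section Parts

variable [𝔥.IsCartanSubalgebra] {h : Dual ℂ 𝔥 → 𝔥} {D : EvenRootData 𝔥 h}
  {f : Dual ℂ 𝔥 →ₗ[ℝ] ℝ} {v : Dual ℂ 𝔥} {P : Set (Dual ℂ 𝔥)}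

omit [𝔥.IsCartanSubalgebra] in
theorem inter_evenRoots_eq (hPf : ∀ α ∈ evenRoots 𝔥, α ∈ P ↔ 0 < f α) :
    P ∩ evenRoots 𝔥 = IsRootSet.posRoots (evenRoots 𝔥) f := by
  ext α
  exact ⟨fun hα => ⟨hα.2, (hPf α hα.2).1 hα.1⟩, fun hα => ⟨(hPf α hα.1).2 hα.2, hα.1⟩⟩

omit [𝔥.IsCartanSubalgebra] in
theorem evenSimple_eq (hPf : ∀ α ∈ evenRoots 𝔥, α ∈ P ↔ 0 < f α) :
    evenSimple 𝔥 P = IsRootSet.simpleRoots (evenRoots 𝔥) f := by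
  rw [evenSimple, inter_evenRoots_eq hPf, IsRootSet.simpleRoots]

theorem reflTransGen_of_samePart (D : EvenRootData 𝔥 h)
    (hPf : ∀ α ∈ evenRoots 𝔥, α ∈ P ↔ 0 < f α) {α β : Dual ℂ 𝔥} (hαβ : SamePart 𝔥 P α β) :
    Relation.ReflTransGen (fun x y => x ∈ IsRootSet.simpleRoots (evenRoots 𝔥) f ∧
      y ∈ IsRootSet.simpleRoots (evenRoots 𝔥) f ∧ D.form x y ≠ 0) α β := by
  refine Relation.ReflTransGen.mono ?_ _ _ hαβ
  rintro x y ⟨hx, hy, H, hH, hne⟩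
  rw [evenSimple_eq hPf] at hx hy
  refine ⟨hx, hy, fun h0 => hne ?_⟩
  have h1 := D.two_mul_form_eq hx.1.1 (Submodule.subset_span hy.1.1)
  rw [h0, mul_zero] at h1
  rw [D.coroot_unique x hx.1.1 H hH, D.apply_coroot_eq_re (Submodule.subset_span hy.1.1) hx.1.1,
    (mul_eq_zero.1 h1.symm).resolve_right (D.form_self_pos hx.1.1).ne', Complex.ofReal_zero]

variable {hθ𝔥 : ∀ x ∈ 𝔥, θ x ∈ 𝔥} (had : IsAdapted C hθ𝔥 D f v)
  (hθθ : ∀ x, θ (θ x) = x) (hPf : ∀ α ∈ evenRoots 𝔥, α ∈ P ↔ 0 < f α)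

include had hθθ hPf

theorem eq_of_painted_of_samePart {α β : Dual ℂ 𝔥} (hα : α ∈ painted θ 𝔥 P)
    (hβ : β ∈ painted θ 𝔥 P) (hαβ : SamePart 𝔥 P α β) : α = β := by
  obtain ⟨ω, hω⟩ := D.isRootSet.exists_isDualFamily had.ne_zero
  have h1 := hα.1
  have h2 := hβ.1
  rw [evenSimple_eq hPf] at h1 h2
  exact D.isRootSet.eq_of_odd_of_connected had.ne_zero hω
    (EvenRootData.thetaDual_thetaDual hθθ hθ𝔥) (D.form_thetaDual hθθ hθ𝔥)
    (fun _ hγ => EvenRootData.thetaDual_mem hθθ hθ𝔥 hγ) (fun k hk => had.theta_mem k hk.1)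
    had.parity had.minimal had.dominant h1 ((EvenRootData.isImaginary_iff hθ𝔥 α).1 hα.2.1) hα.2.2
    h2 ((EvenRootData.isImaginary_iff hθ𝔥 β).1 hβ.2.1) hβ.2.2 (reflTransGen_of_samePart D hPf hαβ)

/-- On one connected component the form `B` and the Euclidean form are proportional, and `ω` is a
rescaling of the dual family of the Euclidean form. So the inequality for the latter passes to `B`.
-/
theorem normalizedDualBasis_le {ε : Dual ℂ 𝔥 → ℝ} {B : LinearMap.BilinForm ℝ (Dual ℂ 𝔥)}
    {ω : Dual ℂ 𝔥 → Dual ℂ 𝔥} (hB : IsNormalizedDualBasis 𝔥 P ε B ω) {α β : Dual ℂ 𝔥}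
    (hα : α ∈ painted θ 𝔥 P) (hβ : β ∈ evenSimple 𝔥 P) (hβi : IsImaginary θ 𝔥 β)
    (hαβ : SamePart 𝔥 P α β) : B (ω α - ω β) (ω β) ≤ 0 := by
  obtain ⟨ω', hω⟩ := D.isRootSet.exists_isDualFamily had.ne_zero
  have hS := evenSimple_eq hPf
  have hαS := hα.1
  obtain ⟨hε, hBsymm, hgram, hspan, hself, hne⟩ := hB
  rw [hS] at hε hBsymm hgram hspan hself hne hβ hαS
  set Ξ := IsRootSet.simpleRoots (evenRoots 𝔥) f with hΞ
  have hΞΔ : ∀ {k}, k ∈ Ξ → k ∈ evenRoots 𝔥 := fun hk => hk.1.1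
  have hΞspan : Submodule.span ℝ Ξ = Submodule.span ℝ (evenRoots 𝔥) :=
    D.isRootSet.span_simpleRoots had.ne_zero
  -- From `2 (k, j) = j(h k) (k, k)` and `B k j = ε k * j(h k)` one gets `(k, j) = c k * B k j`; the
  -- normalization of `ω` makes the same factor appear in `ω k = c k • ω' k`.
  set c : Dual ℂ 𝔥 → ℝ := fun k => D.form k k / (2 * ε k) with hc
  have hcpos : ∀ k ∈ Ξ, 0 < c k := fun k hk =>
    div_pos (D.form_self_pos (hΞΔ hk)) (mul_pos two_pos (hε k hk))
  have hform : ∀ k ∈ Ξ, ∀ j ∈ Ξ, D.form k j = c k * B k j := by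
    intro k hk j hj
    have h1 := hgram k hk j hj (h k) (D.coroot k (hΞΔ hk))
    have hj' := Submodule.subset_span (R := ℝ) (hΞΔ hj)
    rw [D.apply_coroot_eq_re hj' (hΞΔ hk)] at h1
    have h2 : B k j = ε k * (j (h k)).re := by exact_mod_cast h1
    have h3 := D.two_mul_form_eq (hΞΔ hk) hj'
    have h4 := (hε k hk).ne'
    rw [h2, hc]
    field_simp
    linarith
  have hωω' : ∀ k ∈ Ξ, ω k = c k • ω' k := by
    intro k hk
    refine D.isRootSet.eq_of_forall_simple_eq (hspan k hk)
      (Submodule.smul_mem _ _ (hω.mem_span k hk)) fun j hj => ?_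
    have hk' : ω k ∈ Submodule.span ℝ (evenRoots 𝔥) := hΞspan ▸ hspan k hk
    have h1 := D.two_mul_form_eq (hΞΔ hj) hk'
    rw [D.isRootSet.symm, map_smul, LinearMap.smul_apply, smul_eq_mul]
    by_cases hkj : k = j
    · subst hkj
      rw [hself k hk (h k) (D.coroot k (hΞΔ hk))] at h1
      have h2 : ((1 : ℂ) / (ε k : ℂ)).re = 1 / ε k := by
        rw [← Complex.ofReal_one, ← Complex.ofReal_div, Complex.ofReal_re]
      have h4 := (hε k hk).ne'
      rw [h2] at h1
      rw [hω.self k hk, hc]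
      field_simp at h1 ⊢
      linarith
    · rw [hne k hk j hj hkj (h j) (D.coroot j (hΞΔ hj)), Complex.zero_re, zero_mul] at h1
      rw [hω.ne k hk j hj hkj, mul_zero]
      linarith
  -- Both forms are symmetric, so `c` takes the same value at the two ends of each edge.
  have hcc : c α = c β := by
    refine Relation.ReflTransGen.rec (motive := fun j _ => c α = c j) rfl ?_
      (reflTransGen_of_samePart D hPf hαβ)
    rintro j k - ⟨hj, hk, hjk⟩ h1
    rw [h1]
    have h2 := hform j hj k hk
    have h3 := hform k hk j hj
    rw [D.isRootSet.symm, h2, hBsymm k hk j hj] at h3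
    refine mul_right_cancel₀ (fun h0 => hjk ?_) h3
    rw [h2, h0, mul_zero]
  have hBω : ∀ x ∈ Submodule.span ℝ Ξ, B x (ω β) = D.form x (ω' β) := by
    intro x hx
    induction hx using Submodule.span_induction with
    | mem k hk =>
      have hlin : ∀ y ∈ Submodule.span ℝ Ξ, D.form k y = c k * B k y := by
        intro y hy
        induction hy using Submodule.span_induction with
        | mem j hj => exact hform k hk j hj
        | zero => simp
        | add y z _ _ hy hz => rw [map_add, map_add, hy, hz, mul_add]
        | smul t y _ hy => rw [map_smul, map_smul, hy, smul_eq_mul, smul_eq_mul, mul_left_comm]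
      have h1 := hlin _ (hspan β hβ)
      refine mul_left_cancel₀ (hcpos k hk).ne' ?_
      rw [← h1, hωω' β hβ, map_smul, smul_eq_mul]
      by_cases hkβ : β = k
      · rw [hkβ]
      · rw [D.isRootSet.symm k, hω.ne β hβ k hk hkβ, mul_zero, mul_zero]
    | zero => simp
    | add y z _ _ hy hz => rw [map_add, map_add, LinearMap.add_apply, LinearMap.add_apply, hy, hz]
    | smul t y _ hy =>
      rw [map_smul, map_smul, LinearMap.smul_apply, LinearMap.smul_apply, hy]
  rw [hBω _ (Submodule.sub_mem _ (hspan α hαS) (hspan β hβ)), hωω' α hαS, hωω' β hβ, hcc,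
    ← smul_sub, map_smul, LinearMap.smul_apply, smul_eq_mul]
  refine mul_nonpos_of_nonneg_of_nonpos (hcpos β hβ).le ?_
  exact D.isRootSet.dual_sub_dual_le had.ne_zero hω
    (EvenRootData.thetaDual_thetaDual hθθ hθ𝔥) (D.form_thetaDual hθθ hθ𝔥)
    (fun _ hγ => EvenRootData.thetaDual_mem hθθ hθ𝔥 hγ) (fun k hk => had.theta_mem k hk.1)
    had.parity had.minimal had.dominant hαS ((EvenRootData.isImaginary_iff hθ𝔥 α).1 hα.2.1)
    hα.2.2 hβ ((EvenRootData.isImaginary_iff hθ𝔥 β).1 hβi)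

end Parts

end LieSuperalgebra

/-! ### Counting the even parts -/

/-- The Lie algebra is the sum of its center and the ideals `I i`, each of which contains no
nonzero proper part of an ideal. -/
structure IsSimpleCover {L : Type*} [LieRing L] [LieAlgebra ℂ L] {ι : Type*} [Fintype ι]
    (I : ι → LieIdeal ℂ L) : Prop where
  cover : ∀ x : L, ∃ z ∈ center ℂ L, ∃ y : ι → L, (∀ i, y i ∈ I i) ∧ x = z + ∑ i, y i
  minimal : ∀ i, ∀ x ∈ I i, x ≠ 0 → ∀ J : LieIdeal ℂ L, x ∈ J → I i ≤ J

/-- Surjectivity is enough; for type `A` the map is the quotient by scalar matrices. -/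
theorem IsSimpleCover.map {L L' : Type*} [LieRing L] [LieAlgebra ℂ L] [LieRing L']
    [LieAlgebra ℂ L'] {ι : Type*} [Fintype ι] {I : ι → LieIdeal ℂ L} (hI : IsSimpleCover I)
    (φ : L →ₗ⁅ℂ⁆ L') (hφ : Function.Surjective φ) : IsSimpleCover fun i => (I i).map φ where
  cover x := by
    obtain ⟨x, rfl⟩ := hφ x
    obtain ⟨z, hz, y, hy, rfl⟩ := hI.cover x
    refine ⟨φ z, mem_center_iff_lie_eq_zero.2 fun w => ?_, fun i => φ (y i),
      fun i => LieIdeal.mem_map (hy i), by rw [map_add, map_sum]⟩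
    obtain ⟨w, rfl⟩ := hφ w
    rw [← LieHom.map_lie, mem_center_iff_lie_eq_zero.1 hz, map_zero]
  minimal i x hx hx0 J hxJ := by
    obtain ⟨y, rfl⟩ := LieIdeal.mem_map_of_surjective hφ hx
    rw [LieIdeal.map_le_iff_le_comap]
    refine hI.minimal i y y.2 (fun h0 => hx0 ?_) _ (LieIdeal.mem_comap.2 hxJ)
    rw [h0, map_zero]

/-- The centralizer of an ideal, as an ideal. -/
def LieIdeal.annihilator {L : Type*} [LieRing L] [LieAlgebra ℂ L] (K : LieIdeal ℂ L) :
    LieIdeal ℂ L where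
  carrier := {y | ∀ x ∈ K, ⁅y, x⁆ = 0}
  add_mem' h1 h2 x hx := by rw [add_lie, h1 x hx, h2 x hx, add_zero]
  zero_mem' x _ := zero_lie x
  smul_mem' c y h1 x hx := by rw [smul_lie, h1 x hx, smul_zero]
  lie_mem {z y} h1 x hx := by
    rw [lie_lie, h1 x hx, lie_zero, h1 _ (lie_mem_right ℂ L K z x hx), sub_zero]

/-! ### Components of the even diagram inject into the simple ideals -/

section Components

variable {L : Type*} [LieRing L] [LieAlgebra ℂ L] {𝔥 : LieSubalgebra ℂ L}

theorem lie_mem_weightSpace_add {α β : Dual ℂ 𝔥} {x y : L} (hx : x ∈ weightSpace L (α : 𝔥 → ℂ))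
    (hy : y ∈ weightSpace L (β : 𝔥 → ℂ)) :
    ⁅x, y⁆ ∈ weightSpace L ((α + β : Dual ℂ 𝔥) : 𝔥 → ℂ) := by
  rw [mem_weightSpace] at hx hy ⊢
  intro H
  rw [LieSubalgebra.coe_bracket_of_module, leibniz_lie,
    ← LieSubalgebra.coe_bracket_of_module, ← LieSubalgebra.coe_bracket_of_module, hx, hy,
    smul_lie, lie_smul, ← add_smul]
  rfl

theorem lie_eq_zero_of_add_notMem {α β : Dual ℂ 𝔥} (hne : α + β ≠ 0) (hαβ : α + β ∉ evenRoots 𝔥)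
    {x y : L} (hx : x ∈ weightSpace L (α : 𝔥 → ℂ)) (hy : y ∈ weightSpace L (β : 𝔥 → ℂ)) :
    ⁅x, y⁆ = 0 := by
  by_contra h0
  exact hαβ ⟨hne, LieSubmodule.ne_bot_iff_exists.2 ⟨_, lie_mem_weightSpace_add hx hy, h0⟩⟩

namespace EvenRootData

variable [𝔥.IsCartanSubalgebra] {h : Dual ℂ 𝔥 → 𝔥} (D : EvenRootData 𝔥 h)
  {f : Dual ℂ 𝔥 →ₗ[ℝ] ℝ} (hf : ∀ α ∈ evenRoots 𝔥, f α ≠ 0) {P : Set (Dual ℂ 𝔥)}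
  (hPf : ∀ α ∈ evenRoots 𝔥, α ∈ P ↔ 0 < f α)

/-- A Lie subalgebra that contains the Cartan subalgebra and the root vectors of the simple roots
and of their negatives is everything. -/
theorem subalgebra_eq_top (D : EvenRootData 𝔥 h) [FiniteDimensional ℂ L]
    (hf : ∀ α ∈ evenRoots 𝔥, f α ≠ 0) (N : LieSubalgebra ℂ L) (h𝔥 : ∀ x ∈ 𝔥, x ∈ N)
    (hN : ∀ α ∈ IsRootSet.simpleRoots (evenRoots 𝔥) f, ∀ x,
      (x ∈ weightSpace L (α : 𝔥 → ℂ) ∨ x ∈ weightSpace L ((-α : Dual ℂ 𝔥) : 𝔥 → ℂ)) → x ∈ N) :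
    ∀ x, x ∈ N := by
  have hpos : ∀ β ∈ IsRootSet.posRoots (evenRoots 𝔥) f, ∀ x,
      (x ∈ weightSpace L (β : 𝔥 → ℂ) ∨ x ∈ weightSpace L ((-β : Dual ℂ 𝔥) : 𝔥 → ℂ)) → x ∈ N := by
    refine D.isRootSet.posRoots_induction hN fun β hβ γ hγ hβγ h1 h2 x hx => ?_
    have key : ∀ β γ : Dual ℂ 𝔥, β ∈ evenRoots 𝔥 → γ ∈ evenRoots 𝔥 → β + γ ∈ evenRoots 𝔥 →
        (∀ x ∈ weightSpace L (β : 𝔥 → ℂ), x ∈ N) → (∀ x ∈ weightSpace L (γ : 𝔥 → ℂ), x ∈ N) →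
        ∀ x ∈ weightSpace L ((β + γ : Dual ℂ 𝔥) : 𝔥 → ℂ), x ∈ N := by
      intro β γ hβ hγ hβγ h1 h2 x hx
      obtain ⟨y, hy, hy0⟩ := LieSubmodule.ne_bot_iff_exists.1 hβ.2
      obtain ⟨z, hz, hz0⟩ := LieSubmodule.ne_bot_iff_exists.1 hγ.2
      obtain ⟨c, rfl⟩ := D.proportional _ hβγ _ (lie_mem_weightSpace_add hy hz) x hx
        (D.lie_ne_zero β hβ γ hγ hβγ y hy z hz hy0 hz0)
      exact N.smul_mem c (N.lie_mem (h1 y hy) (h2 z hz))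
    rcases hx with hx | hx
    · exact key β γ hβ.1 hγ.1 hβγ.1 (fun y hy => h1 y (Or.inl hy)) (fun y hy => h2 y (Or.inl hy))
        x hx
    · rw [neg_add] at hx
      refine key (-β) (-γ) (D.neg_mem β hβ.1) (D.neg_mem γ hγ.1) ?_ (fun y hy => h1 y (Or.inr hy))
        (fun y hy => h2 y (Or.inr hy)) x hx
      rw [← neg_add]
      exact D.neg_mem _ hβγ.1
  have hroot : ∀ β ∈ evenRoots 𝔥, ∀ x ∈ weightSpace L (β : 𝔥 → ℂ), x ∈ N := by
    intro β hβ x hx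
    rcases D.isRootSet.pos_or_neg_mem hf hβ with h1 | h1
    · exact hpos β h1 x (Or.inl hx)
    · exact hpos _ h1 x (Or.inr (by rwa [neg_neg]))
  -- The root spaces of all roots are now in `N`, and together with `𝔥` they span the algebra.
  have htop := congrArg LieSubmodule.toSubmodule (cartan_sup_iSup_rootSpace_eq_top (K := ℂ) 𝔥)
  have hle : (⊤ : Submodule ℂ L) ≤ N.toSubmodule := by
    rw [← LieSubmodule.top_toSubmodule (R := ℂ) (L := 𝔥) (M := L), ← htop]
    simp only [LieSubmodule.sup_toSubmodule, LieSubmodule.iSup_toSubmodule]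
    refine sup_le (fun x hx => h𝔥 x hx) (iSup₂_le fun χ hχ x hx => ?_)
    have hχ0 : χ.toLinear ≠ 0 := fun h0 => hχ (by
      funext H
      exact LinearMap.congr_fun h0 H)
    have hx' := D.genWeightSpace_le χ.toLinear hχ0 hx
    by_cases hx0 : x = 0
    · rw [hx0]; exact zero_mem _
    · exact hroot χ.toLinear ⟨hχ0, LieSubmodule.ne_bot_iff_exists.2 ⟨x, hx', hx0⟩⟩ x hx'
  exact fun x => hle trivial

include D in
theorem apply_coroot_comm {α β : Dual ℂ 𝔥} (hα : α ∈ evenRoots 𝔥) (hβ : β ∈ evenRoots 𝔥)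
    (h0 : β (h α) = 0) : α (h β) = 0 := by
  have hα' := Submodule.subset_span (R := ℝ) hα
  have hβ' := Submodule.subset_span (R := ℝ) hβ
  have h1 := D.two_mul_form_eq hα hβ'
  have h2 := D.two_mul_form_eq hβ hα'
  rw [h0, Complex.zero_re, zero_mul] at h1
  rw [D.isRootSet.symm, h1] at h2
  rw [D.apply_coroot_eq_re hα' hβ,
    (mul_eq_zero.1 h2.symm).resolve_right (D.form_self_pos hβ).ne', Complex.ofReal_zero]

include D in
theorem samePart_single {α β : Dual ℂ 𝔥} (hα : α ∈ evenSimple 𝔥 P) (hβ : β ∈ evenSimple 𝔥 P)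
    (h0 : β (h α) ≠ 0) : SamePart 𝔥 P α β :=
  Relation.ReflTransGen.single ⟨hα, hβ, h α, D.coroot α hα.1.2, h0⟩

include D in
theorem samePart_symm {α β : Dual ℂ 𝔥} (hαβ : SamePart 𝔥 P α β) : SamePart 𝔥 P β α := by
  induction hαβ with
  | refl => exact Relation.ReflTransGen.refl
  | @tail γ δ _ h1 h2 =>
    obtain ⟨hγ, hδ, H, hH, hne⟩ := h1
    rw [D.coroot_unique γ hγ.1.2 H hH] at hne
    exact (D.samePart_single hδ hγ fun h0 => hne (D.apply_coroot_comm hδ.1.2 hγ.1.2 h0)).trans h2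

include D hf hPf in
-- The two simple roots are orthogonal. Their difference is not a root since both are simple, and
-- their sum is not one since reflection in `δ` would turn it into the difference. So all four
-- brackets vanish.
theorem lie_eq_zero_of_not_samePart {γ δ : Dual ℂ 𝔥} (hγ : γ ∈ evenSimple 𝔥 P)
    (hδ : δ ∈ evenSimple 𝔥 P) (hγδ : ¬ SamePart 𝔥 P γ δ) {x y : L}
    (hx : x ∈ weightSpace L (γ : 𝔥 → ℂ) ∨ x ∈ weightSpace L ((-γ : Dual ℂ 𝔥) : 𝔥 → ℂ))
    (hy : y ∈ weightSpace L (δ : 𝔥 → ℂ) ∨ y ∈ weightSpace L ((-δ : Dual ℂ 𝔥) : 𝔥 → ℂ)) :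
    ⁅y, x⁆ = 0 := by
  have hγΔ := hγ.1.2
  have hδΔ := hδ.1.2
  have h0 : γ (h δ) = 0 := by
    by_contra h1
    exact hγδ (D.samePart_symm (D.samePart_single hδ hγ h1))
  have hsub : γ - δ ∉ evenRoots 𝔥 := by
    intro hm
    rw [evenSimple_eq hPf] at hγ hδ
    rcases D.isRootSet.pos_or_neg_mem hf hm with h1 | h1
    · exact hγ.2 δ hδ.1 _ h1 (by abel)
    · exact hδ.2 γ hγ.1 _ h1 (by abel)
  have hadd : γ + δ ∉ evenRoots 𝔥 := by
    intro hm
    have h1 := D.reflect_mem δ hδΔ _ hm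
    rw [LinearMap.add_apply, h0, D.apply_coroot_self hδΔ, zero_add] at h1
    apply hsub
    convert h1 using 1
    rw [two_smul]; abel
  have hne : ∀ c : ℂ, c ≠ 0 → γ ≠ c • δ := by
    rintro c hc h1
    rw [h1, LinearMap.smul_apply, D.apply_coroot_self hδΔ] at h0
    exact hc ((mul_eq_zero.1 h0).resolve_right two_ne_zero)
  have hne1 : γ + δ ≠ 0 := fun h1 => hne (-1) (by norm_num) (by
    rw [neg_one_smul]; exact eq_neg_of_add_eq_zero_left h1)
  have hne2 : γ - δ ≠ 0 := fun h1 => hne 1 one_ne_zero (by rw [one_smul]; exact sub_eq_zero.1 h1)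
  have hneg : ∀ x : Dual ℂ 𝔥, x ∉ evenRoots 𝔥 → -x ∉ evenRoots 𝔥 := fun x hx h1 => hx (by
    rw [← neg_neg x]; exact D.neg_mem _ h1)
  rcases hx with hx | hx <;> rcases hy with hy | hy <;>
    refine lie_eq_zero_of_add_notMem (𝔥 := 𝔥) ?_ ?_ hy hx
  · rwa [add_comm]
  · rwa [add_comm]
  · rwa [neg_add_eq_sub]
  · rwa [neg_add_eq_sub]
  · rw [← sub_eq_add_neg, ← neg_sub]; exact neg_ne_zero.2 hne2
  · rw [← sub_eq_add_neg, ← neg_sub]; exact hneg _ hsub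
  · rw [← neg_add, add_comm]; exact neg_ne_zero.2 hne1
  · rw [← neg_add, add_comm]; exact hneg _ hadd

include D hf hPf in
-- Take for `K` the centralizer of the root vectors of all simple roots outside the part of `α`, and
-- of their negatives. Its stabilizer `N` is a subalgebra containing `𝔥` and the simple root
-- vectors, so it is everything and `K` is an ideal.
theorem exists_ideal_of_not_samePart [FiniteDimensional ℂ L] {α β : Dual ℂ 𝔥}
    (hα : α ∈ evenSimple 𝔥 P) (hβ : β ∈ evenSimple 𝔥 P) (hαβ : ¬ SamePart 𝔥 P α β) :
    ∃ K : LieIdeal ℂ L, (∀ x ∈ weightSpace L (α : 𝔥 → ℂ), x ∈ K) ∧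
      ∀ y ∈ weightSpace L (β : 𝔥 → ℂ), y ∈ K.annihilator := by
  let E : Set L := {y | ∃ δ ∈ evenSimple 𝔥 P, ¬ SamePart 𝔥 P α δ ∧
    (y ∈ weightSpace L (δ : 𝔥 → ℂ) ∨ y ∈ weightSpace L ((-δ : Dual ℂ 𝔥) : 𝔥 → ℂ))}
  let K : Submodule ℂ L :=
    { carrier := {x | ∀ y ∈ E, ⁅y, x⁆ = 0}
      add_mem' := fun h1 h2 y hy => by rw [lie_add, h1 y hy, h2 y hy, add_zero]
      zero_mem' := fun y _ => lie_zero y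
      smul_mem' := fun c x h1 y hy => by rw [lie_smul, h1 y hy, smul_zero] }
  have hKmem : ∀ x, x ∈ K ↔ ∀ y ∈ E, ⁅y, x⁆ = 0 := fun x => Iff.rfl
  let N : LieSubalgebra ℂ L :=
    { carrier := {z | ∀ x ∈ K, ⁅z, x⁆ ∈ K}
      add_mem' := fun h1 h2 x hx => by rw [add_lie]; exact add_mem (h1 x hx) (h2 x hx)
      zero_mem' := fun x _ => by rw [zero_lie]; exact zero_mem _
      smul_mem' := fun c z h1 x hx => by rw [smul_lie]; exact K.smul_mem c (h1 x hx)
      lie_mem' := fun {z w} h1 h2 x hx => by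
        rw [lie_lie]
        exact K.sub_mem (h1 _ (h2 x hx)) (h2 _ (h1 x hx)) }
  have hcomp : ∀ γ ∈ evenSimple 𝔥 P, SamePart 𝔥 P α γ → ∀ x,
      (x ∈ weightSpace L (γ : 𝔥 → ℂ) ∨ x ∈ weightSpace L ((-γ : Dual ℂ 𝔥) : 𝔥 → ℂ)) → x ∈ K := by
    rintro γ hγ hαγ x hx y ⟨δ, hδ, hαδ, hy⟩
    exact D.lie_eq_zero_of_not_samePart hf hPf hγ hδ (fun h1 => hαδ (hαγ.trans h1)) hx hy
  have hN : ∀ z, z ∈ N := by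
    refine D.subalgebra_eq_top hf N (fun H hH x hx y hy => ?_) fun γ hγ z hz x hx => ?_
    -- The elements of `E` are eigenvectors of `H`, so bracketing with `H` preserves their
    -- centralizer.
    · obtain ⟨δ, -, -, hyδ⟩ := id hy
      have h1 : ∃ c : ℂ, ⁅H, y⁆ = c • y := by
        rcases hyδ with h1 | h1
        · exact ⟨_, (mem_weightSpace _ _).1 h1 ⟨H, hH⟩⟩
        · exact ⟨_, (mem_weightSpace _ _).1 h1 ⟨H, hH⟩⟩
      obtain ⟨c, hc⟩ := h1
      rw [leibniz_lie, hx y hy, lie_zero, add_zero, ← lie_skew y H, hc, neg_lie, smul_lie, hx y hy,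
        smul_zero, neg_zero]
    · rw [← evenSimple_eq hPf] at hγ
      by_cases hαγ : SamePart 𝔥 P α γ
      · intro y hy
        rw [leibniz_lie, hx y hy, lie_zero, add_zero, hcomp γ hγ hαγ z hz y hy, zero_lie]
      · rw [hx z ⟨γ, hγ, hαγ, hz⟩]
        exact zero_mem _
  refine ⟨{ K with lie_mem := fun {z x} hx => hN z x hx }, fun x hx =>
    hcomp α hα Relation.ReflTransGen.refl x (Or.inl hx), fun y hy x hx =>
    hx y ⟨β, hβ, hαβ, Or.inl hy⟩⟩

include D in
-- The coroot acts on the root vector by `2` and its central component acts by zero, so one of its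
-- components in the simple ideals acts nontrivially.
theorem exists_mem_lie_ne_zero {ι : Type*} [Fintype ι] {I : ι → LieIdeal ℂ L}
    (hI : IsSimpleCover I) {α : Dual ℂ 𝔥} (hα : α ∈ evenRoots 𝔥) :
    ∃ e ∈ weightSpace L (α : 𝔥 → ℂ), ∃ i, ∃ y ∈ I i, ⁅y, e⁆ ≠ 0 := by
  obtain ⟨e, he, -, -, he0, -, -, -⟩ := D.exists_sign_ne_zero hα
  refine ⟨e, he, ?_⟩
  by_contra! h0
  have h1 := (mem_weightSpace _ _).1 he (h α)
  rw [LieSubalgebra.coe_bracket_of_module, D.apply_coroot_self hα] at h1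
  obtain ⟨z, hz, y, hy, hzy⟩ := hI.cover (h α : L)
  rw [hzy, add_lie, lie_eq_zero_of_mem_center hz, zero_add, sum_lie,
    Finset.sum_eq_zero fun i _ => h0 i (y i) (hy i)] at h1
  exact he0 ((smul_eq_zero.1 h1.symm).resolve_left two_ne_zero)

include D hf hPf in
/-- There are at most as many even simple roots in different parts as there are simple ideals that
do not centralize all of their root spaces. -/
theorem encard_le_card_of_not_samePart [FiniteDimensional ℂ L] {k : ℕ} {I : Fin k → LieIdeal ℂ L}
    (hI : IsSimpleCover I) {F : Set (Dual ℂ 𝔥)} (hF : F ⊆ evenSimple 𝔥 P)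
    (hFS : ∀ α ∈ F, ∀ β ∈ F, SamePart 𝔥 P α β → α = β) (s : Finset (Fin k))
    (hs : ∀ i ∉ s, ∀ α ∈ F, ∀ e ∈ weightSpace L (α : 𝔥 → ℂ), ∀ y ∈ I i, ⁅y, e⁆ = 0) :
    F.encard ≤ s.card := by
  have hex : ∀ α : F, ∃ i, ∃ e ∈ weightSpace L ((α : Dual ℂ 𝔥) : 𝔥 → ℂ), ∃ y ∈ I i, ⁅y, e⁆ ≠ 0 := by
    intro α
    obtain ⟨e, he, i, y, hy, hye⟩ := D.exists_mem_lie_ne_zero hI (hF α.2).1.2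
    exact ⟨i, e, he, y, hy, hye⟩
  choose g hg using hex
  have hgs : Set.range g ⊆ s := by
    rintro _ ⟨α, rfl⟩
    by_contra hi
    obtain ⟨e, he, y, hy, hye⟩ := hg α
    exact hye (hs _ hi α α.2 e he y hy)
  have hinj : Function.Injective g := by
    intro α β hαβ
    by_contra hne
    have hns : ¬ SamePart 𝔥 P (α : Dual ℂ 𝔥) β := fun h1 => hne (Subtype.ext (hFS α α.2 β β.2 h1))
    obtain ⟨K, hK, hKβ⟩ := D.exists_ideal_of_not_samePart hf hPf (hF α.2) (hF β.2) hns
    obtain ⟨e, he, y, hy, hye⟩ := hg α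
    obtain ⟨e', he', y', hy', hye'⟩ := hg β
    rw [← hαβ] at hy'
    -- If one ideal served both roots, the nonzero bracket `⁅y', e'⁆` would lie in it and in the
    -- annihilator of `K`. By minimality the whole ideal would annihilate `K`, which contains `e`.
    have hle : I (g α) ≤ K.annihilator := by
      refine hI.minimal _ _ ?_ hye' _ (lie_mem_right ℂ L _ y' e' (hKβ e' he'))
      exact lie_mem_left ℂ L _ y' e' hy'
    exact hye (hle hy e (hK e he))
  rw [← ENat.card_coe_set_eq, ← Set.encard_coe_eq_coe_finsetCard]
  exact hinj.encard_range.trans (Set.encard_le_encard hgs)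

include D hf hPf in
theorem encard_le_of_not_samePart [FiniteDimensional ℂ L] {k : ℕ} {I : Fin k → LieIdeal ℂ L}
    (hI : IsSimpleCover I) {F : Set (Dual ℂ 𝔥)} (hF : F ⊆ evenSimple 𝔥 P)
    (hFS : ∀ α ∈ F, ∀ β ∈ F, SamePart 𝔥 P α β → α = β) : F.encard ≤ k := by
  refine (D.encard_le_card_of_not_samePart hf hPf hI hF hFS Finset.univ fun i hi => ?_).trans_eq ?_
  · exact absurd (Finset.mem_univ i) hi
  · rw [Finset.card_univ, Fintype.card_fin]

end EvenRootData

end Components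

/-! ### Simple Lie algebras of matrices -/

section SimpleMatrices

attribute [local instance 100] LieRing.ofAssociativeRing

open Matrix

variable {n : Type*} [Fintype n] [DecidableEq n]

/-- The Lie algebra `N` of matrices has no ideals except `0` and itself. -/
def HasOnlyTrivialIdeals (N : LieSubalgebra ℂ (Matrix n n ℂ)) : Prop :=
  ∀ W : Submodule ℂ (Matrix n n ℂ), W ≤ N.toSubmodule →
    (∀ A ∈ N, ∀ B ∈ W, A * B - B * A ∈ W) → ∀ B ∈ W, B ≠ 0 → N.toSubmodule ≤ W

theorem HasOnlyTrivialIdeals.idealRange_le {N : LieSubalgebra ℂ (Matrix n n ℂ)}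
    (hN : HasOnlyTrivialIdeals N) {L : Type*} [LieRing L] [LieAlgebra ℂ L] {ψ : N →ₗ⁅ℂ⁆ L}
    (hψ : ψ.IsIdealMorphism) {x : L} (hx : x ∈ ψ.idealRange) (hx0 : x ≠ 0) {J : LieIdeal ℂ L}
    (hxJ : x ∈ J) : ψ.idealRange ≤ J := by
  obtain ⟨B, rfl⟩ := (ψ.mem_idealRange_iff hψ).1 hx
  have h1 := hN ((J.comap ψ).toSubmodule.map N.toSubmodule.subtype)
    (Submodule.map_subtype_le _ _) (by
      rintro A hA _ ⟨B, hB, rfl⟩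
      exact ⟨⁅(⟨A, hA⟩ : N), B⁆, lie_mem_right ℂ N _ _ _ hB, rfl⟩) B ⟨B, hxJ, rfl⟩
    (fun h0 => hx0 (by rw [show B = 0 from Subtype.ext h0, map_zero]))
  intro y hy
  obtain ⟨A, rfl⟩ := (ψ.mem_idealRange_iff hψ).1 hy
  obtain ⟨E, hE, hEA⟩ := h1 A.2
  rw [← show E = A from Subtype.ext hEA]
  exact hE

/-! #### The special linear Lie algebra -/

theorem mem_of_smul_mem {V : Type*} [AddCommGroup V] [Module ℂ V] {W : Submodule ℂ V} {c : ℂ}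
    (hc : c ≠ 0) {x : V} (hx : c • x ∈ W) : x ∈ W :=
  (W.smul_mem_iff hc).1 hx

theorem single_mem_sl {a b : n} (hab : a ≠ b) : single a b (1 : ℂ) ∈ SpecialLinear.sl n ℂ :=
  (SpecialLinear.single a b hab (1 : ℂ)).2

/-- The square of `ad E` for an element `E` of square zero. -/
theorem ad_sq_of_mul_self_eq_zero {𝒜 : Type*} [Ring 𝒜] {E : 𝒜} (hE : E * E = 0) (X : 𝒜) :
    E * (E * X - X * E) - (E * X - X * E) * E = -(2 * (E * X * E)) := by
  have h1 : E * (E * X - X * E) - (E * X - X * E) * E =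
    E * E * X - 2 * (E * X * E) + X * (E * E) := by noncomm_ring
  rw [h1, hE]
  simp

/-- For `E = E_ab` the map `(ad E)²` sends `X` to `-2 X_ba E_ab`, so an off-diagonal entry produces
an elementary matrix. If there is none, a nonzero traceless diagonal matrix has two different
entries, and one bracket suffices. A single elementary matrix generates all others. -/
theorem hasOnlyTrivialIdeals_sl : HasOnlyTrivialIdeals (SpecialLinear.sl n ℂ) := by
  intro W hW hlie B hB hB0
  have hoff : ∀ a b, a ≠ b → ∀ X ∈ W, X b a ≠ 0 → single a b (1 : ℂ) ∈ W := by
    intro a b hab X hX hX0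
    have h1 := hlie _ (single_mem_sl hab) _ (hlie _ (single_mem_sl hab) X hX)
    rw [ad_sq_of_mul_self_eq_zero (single_mul_single_of_ne 1 a b a hab.symm 1),
      single_mul_mul_single, one_mul, mul_one] at h1
    refine mem_of_smul_mem (c := -(2 * X b a)) (by simpa using hX0) ?_
    convert h1 using 1
    ext i j
    by_cases hij : a = i ∧ b = j <;> simp [two_mul, hij]
  have hlie_single : ∀ a b d, a ≠ b → d ≠ a → single a b (1 : ℂ) ∈ W → single a d (1 : ℂ) ∈ W := by
    intro a b d hab hda h1
    by_cases hbd : b = d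
    · rwa [← hbd]
    · have h2 := hlie _ (single_mem_sl hbd) _ h1
      rw [single_mul_single_same, single_mul_single_of_ne 1 b d a hda 1, one_mul, zero_sub] at h2
      exact neg_mem_iff.1 h2
  have hflip : ∀ a b, a ≠ b → single a b (1 : ℂ) ∈ W → single b a (1 : ℂ) ∈ W :=
    fun a b hab h1 => hoff b a hab.symm _ h1 (by simp)
  have hlie_single' : ∀ a b c, a ≠ b → c ≠ b → single a b (1 : ℂ) ∈ W → single c b (1 : ℂ) ∈ W :=
    fun a b c hab hcb h1 => hflip b c hcb.symm (hlie_single b a c hab.symm hcb (hflip a b hab h1))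
  obtain ⟨a, b, hab, hE⟩ : ∃ a b, a ≠ b ∧ single a b (1 : ℂ) ∈ W := by
    by_cases hex : ∃ a b, a ≠ b ∧ B b a ≠ 0
    · obtain ⟨a, b, hab, h0⟩ := hex
      exact ⟨a, b, hab, hoff a b hab B hB h0⟩
    · push Not at hex
      have hex2 : ∃ a b, a ≠ b ∧ B a a ≠ B b b := by
        by_contra! hall
        have htr : B.trace = 0 := hW hB
        apply hB0
        ext i j
        by_cases hij : i = j
        · subst hij
          have h1 : B.trace = Fintype.card n • B i i := by
            rw [Matrix.trace, Finset.sum_congr rfl (g := fun _ => B i i), Finset.sum_const,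
              Finset.card_univ]
            intro k _
            by_cases hki : k = i
            · rw [hki]; rfl
            · exact hall k i hki
          rw [h1, smul_eq_zero] at htr
          exact htr.resolve_left (Fintype.card_pos_iff.2 ⟨i⟩).ne'
        · exact hex j i (Ne.symm hij)
      obtain ⟨a, b, hab, hne⟩ := hex2
      refine ⟨a, b, hab, mem_of_smul_mem (c := B b b - B a a) (sub_ne_zero.2 hne.symm) ?_⟩
      convert hlie _ (single_mem_sl hab) B hB using 1
      have hdiag : B = diagonal fun i => B i i := by
        ext i j
        by_cases hij : i = j
        · subst hij; simp
        · rw [diagonal_apply_ne _ hij]; exact hex j i (Ne.symm hij)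
      rw [hdiag]
      ext i j
      by_cases hi : a = i
      · by_cases hj : b = j <;> simp [hi, hj]
      · by_cases hj : b = j
        · simp [hi, hj, diagonal_apply_ne _ (Ne.symm hi)]
        · simp [hi, hj]
  have hall : ∀ c d, c ≠ d → single c d (1 : ℂ) ∈ W := by
    intro c d hcd
    by_cases hda : d = a
    · subst hda
      exact hlie_single' b d c hab.symm hcd (hflip d b hab hE)
    · exact hlie_single' a d c (Ne.symm hda) hcd (hlie_single a b d hab hda hE)
  have hdiag : ∀ c d, single c c (1 : ℂ) - single d d 1 ∈ W := by
    intro c d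
    by_cases hcd : c = d
    · rw [hcd, sub_self]; exact zero_mem _
    · have h1 := hlie _ (single_mem_sl hcd) _ (hall d c (Ne.symm hcd))
      rwa [single_mul_single_same, single_mul_single_same, one_mul] at h1
  intro A hA
  have htr : A.trace = 0 := hA
  have hsum : A = ∑ i, ∑ j, A i j • (single i j (1 : ℂ) - if i = j then single a a 1 else 0) := by
    simp only [smul_sub, Finset.sum_sub_distrib, smul_ite, smul_zero, Finset.sum_ite_eq,
      Finset.mem_univ, if_true, smul_single, smul_eq_mul, mul_one]
    rw [← matrix_eq_sum_single]
    have h1 : ∑ i, single a a (A i i) = (0 : Matrix n n ℂ) := by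
      have h2 := map_sum (singleAddMonoidHom (α := ℂ) a a) (fun i => A i i) Finset.univ
      change single a a A.trace = ∑ i, single a a (A i i) at h2
      rw [← h2, htr, single_zero]
    rw [h1, sub_zero]
  rw [hsum]
  refine W.sum_mem fun i _ => W.sum_mem fun j _ => W.smul_mem _ ?_
  by_cases hij : i = j
  · subst hij; rw [if_pos rfl]; exact hdiag i a
  · rw [if_neg hij, sub_zero]; exact hall i j hij

/-! #### The symplectic Lie algebra -/

section Symplectic

variable {q : Type*} [Fintype q] [DecidableEq q]

theorem mem_sp_iff {A : Matrix (q ⊕ q) (q ⊕ q) ℂ} :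
    A ∈ Symplectic.sp q ℂ ↔ Aᵀ * J q ℂ = -(J q ℂ * A) := by
  rw [Symplectic.sp, mem_skewAdjointMatricesLieSubalgebra, mem_skewAdjointMatricesSubmodule]
  simp only [Matrix.IsSkewAdjoint, Matrix.IsAdjointPair, mul_neg]

/-- The element `v vᵀ J` of the symplectic Lie algebra. -/
def sqElement (v : q ⊕ q → ℂ) : Matrix (q ⊕ q) (q ⊕ q) ℂ := vecMulVec v v * J q ℂ

theorem sqElement_mem_sp (v : q ⊕ q → ℂ) : sqElement v ∈ Symplectic.sp q ℂ := by
  rw [mem_sp_iff, sqElement, transpose_mul, J_transpose, transpose_vecMulVec]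
  simp only [neg_mul, mul_assoc]

theorem sqElement_mulVec (v w : q ⊕ q → ℂ) :
    sqElement v *ᵥ w = (v ⬝ᵥ J q ℂ *ᵥ w) • v := by
  rw [sqElement, ← mulVec_mulVec, vecMulVec_mulVec, op_smul_eq_smul]

theorem sqElement_mul_mul (v : q ⊕ q → ℂ) (X : Matrix (q ⊕ q) (q ⊕ q) ℂ) :
    sqElement v * X * sqElement v = (v ⬝ᵥ (J q ℂ * X) *ᵥ v) • sqElement v := by
  have h1 : X * sqElement v = vecMulVec (X *ᵥ v) v * J q ℂ := by
    rw [sqElement, ← mul_assoc, mul_vecMulVec]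
  rw [mul_assoc, h1, ← mul_assoc, mul_vecMulVec, sqElement_mulVec, mulVec_mulVec, smul_vecMulVec,
    smul_mul_assoc, ← sqElement]

theorem dotProduct_J_mulVec_self (v : q ⊕ q → ℂ) : v ⬝ᵥ J q ℂ *ᵥ v = 0 := by
  have h1 : v ⬝ᵥ J q ℂ *ᵥ v = -(v ⬝ᵥ J q ℂ *ᵥ v) := by
    conv_lhs => rw [dotProduct_mulVec, ← mulVec_transpose, J_transpose, neg_mulVec,
      neg_dotProduct, dotProduct_comm]
  exact self_eq_neg.1 h1

theorem sqElement_mul_self (v : q ⊕ q → ℂ) : sqElement v * sqElement v = 0 := by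
  have h1 := sqElement_mul_mul v 1
  rwa [mul_one, mul_one, dotProduct_J_mulVec_self, zero_smul] at h1

theorem J_mulVec_injective {v : q ⊕ q → ℂ} (hv : J q ℂ *ᵥ v = 0) : v = 0 := by
  have h1 : J q ℂ *ᵥ (J q ℂ *ᵥ v) = -v := by rw [mulVec_mulVec, J_squared, neg_mulVec, one_mulVec]
  rw [hv, mulVec_zero] at h1
  exact neg_eq_zero.1 h1.symm

/-- A vector space is not the union of two proper subspaces. -/
theorem exists_dotProduct_J_ne_zero {v w : q ⊕ q → ℂ} (hv : v ≠ 0) (hw : w ≠ 0) :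
    ∃ u, u ⬝ᵥ J q ℂ *ᵥ v ≠ 0 ∧ u ⬝ᵥ J q ℂ *ᵥ w ≠ 0 := by
  have key : ∀ v : q ⊕ q → ℂ, v ≠ 0 → ∃ u, u ⬝ᵥ J q ℂ *ᵥ v ≠ 0 := by
    intro v hv
    by_contra! h0
    exact hv (J_mulVec_injective (dotProduct_eq_zero _ fun u => by rw [dotProduct_comm]; exact h0 u))
  obtain ⟨u, hu⟩ := key v hv
  obtain ⟨u', hu'⟩ := key w hw
  by_cases h1 : u ⬝ᵥ J q ℂ *ᵥ w = 0
  · by_cases h2 : u' ⬝ᵥ J q ℂ *ᵥ v = 0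
    · exact ⟨u + u', by rwa [add_dotProduct, h2, add_zero], by rwa [add_dotProduct, h1, zero_add]⟩
    · exact ⟨u', h2, hu'⟩
  · exact ⟨u, hu, h1⟩

/-- The elements `v vᵀ J` have square zero and span the algebra by polarization. Applying the double
bracket with one of them to `X` gives a multiple of it with factor `-2 vᵀ J X v`. As `J X` is
symmetric and nonzero, some `v` occurs, and any other nonzero vector is reached through an
intermediate `u` not orthogonal to either. -/
theorem hasOnlyTrivialIdeals_sp : HasOnlyTrivialIdeals (Symplectic.sp q ℂ) := by
  intro W hW hlie B hB hB0
  have hstep : ∀ X ∈ W, ∀ v : q ⊕ q → ℂ, v ⬝ᵥ (J q ℂ * X) *ᵥ v ≠ 0 → sqElement v ∈ W := by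
    intro X hX v hv
    have h1 := hlie _ (sqElement_mem_sp v) _ (hlie _ (sqElement_mem_sp v) X hX)
    rw [ad_sq_of_mul_self_eq_zero (sqElement_mul_self v), sqElement_mul_mul, two_mul, ← two_smul ℂ,
      smul_smul, ← neg_smul] at h1
    exact mem_of_smul_mem (by simpa using hv) h1
  have hlink : ∀ u v : q ⊕ q → ℂ, v ⬝ᵥ J q ℂ *ᵥ u ≠ 0 → sqElement u ∈ W → sqElement v ∈ W := by
    intro u v huv hu
    refine hstep _ hu v ?_
    have h1 : u ⬝ᵥ J q ℂ *ᵥ v = -(v ⬝ᵥ J q ℂ *ᵥ u) := by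
      conv_lhs => rw [dotProduct_mulVec, ← mulVec_transpose, J_transpose, neg_mulVec,
        neg_dotProduct, dotProduct_comm]
    rw [← mulVec_mulVec, sqElement_mulVec, mulVec_smul, dotProduct_smul, h1, smul_eq_mul, neg_mul]
    exact neg_ne_zero.2 (mul_ne_zero huv huv)
  obtain ⟨v, hv⟩ : ∃ v : q ⊕ q → ℂ, v ⬝ᵥ (J q ℂ * B) *ᵥ v ≠ 0 := by
    have hne : J q ℂ * B ≠ 0 := by
      intro h0
      have h1 : J q ℂ * (J q ℂ * B) = -B := by rw [← mul_assoc, J_squared, neg_mul, one_mul]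
      rw [h0, mul_zero] at h1
      exact hB0 (neg_eq_zero.1 h1.symm)
    have hsymm : (J q ℂ * B)ᵀ = J q ℂ * B := by
      rw [transpose_mul, J_transpose, mul_neg, mem_sp_iff.1 (hW hB), neg_neg]
    by_contra! h0
    apply hne
    ext i j
    have hii : ∀ i, (J q ℂ * B) i i = 0 := fun i => by simpa using h0 (Pi.single i 1)
    have h1 := h0 (Pi.single i 1 + Pi.single j 1)
    have h2 : (J q ℂ * B) j i = (J q ℂ * B) i j := congrFun (congrFun hsymm i) j
    simp only [mulVec_add, dotProduct_add, add_dotProduct, mulVec_single_one, single_one_dotProduct,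
      col_apply, hii, h2] at h1
    rw [Matrix.zero_apply]
    have h3 : (2 : ℂ) * (J q ℂ * B) i j = 0 := by linear_combination h1
    exact (mul_eq_zero.1 h3).resolve_left two_ne_zero
  have hv0 : v ≠ 0 := by rintro rfl; simp at hv
  have hvW := hstep B hB v hv
  have hall : ∀ w : q ⊕ q → ℂ, sqElement w ∈ W := by
    intro w
    by_cases hw : w = 0
    · rw [hw, sqElement, zero_vecMulVec, zero_mul]; exact zero_mem _
    · obtain ⟨u, h1, h2⟩ := exists_dotProduct_J_ne_zero hv0 hw
      refine hlink u w ?_ (hlink v u h1 hvW)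
      rw [dotProduct_mulVec, ← mulVec_transpose, J_transpose, neg_mulVec, neg_dotProduct,
        dotProduct_comm]
      exact neg_ne_zero.2 h2
  intro A hA
  have hsymm : (A * J q ℂ)ᵀ = A * J q ℂ := by
    rw [transpose_mul, J_transpose, neg_mul]
    have h1 : J q ℂ * (Aᵀ * J q ℂ) * J q ℂ = J q ℂ * (-(J q ℂ * A)) * J q ℂ := by
      rw [mem_sp_iff.1 hA]
    rw [mul_assoc, mul_assoc, J_squared, mul_neg, mul_neg, mul_neg, neg_mul, ← mul_assoc (J q ℂ) (J q ℂ) A,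
      J_squared] at h1
    simpa using h1
  have hpol : ∀ i j : q ⊕ q, (single i j (1 : ℂ) + single j i 1) * J q ℂ ∈ W := by
    intro i j
    have h1 := W.sub_mem (W.sub_mem (hall (Pi.single i 1 + Pi.single j 1)) (hall (Pi.single i 1)))
      (hall (Pi.single j 1))
    convert h1 using 1
    rw [sqElement, sqElement, sqElement, single_eq_single_vecMulVec_single,
      single_eq_single_vecMulVec_single, ← sub_mul, ← sub_mul, add_vecMulVec, vecMulVec_add,
      vecMulVec_add]
    congr 1
    abel
  have hsum : (2 : ℂ) • (A * J q ℂ) =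
      ∑ i, ∑ j, (A * J q ℂ) i j • (single i j (1 : ℂ) + single j i 1) := by
    simp only [smul_add, smul_single, smul_eq_mul, mul_one, Finset.sum_add_distrib]
    rw [← matrix_eq_sum_single, Finset.sum_comm, two_smul]
    congr 1
    conv_lhs => rw [← hsymm, matrix_eq_sum_single (A * J q ℂ)ᵀ]
    rfl
  have h2 : (2 : ℂ) • A = -((2 : ℂ) • (A * J q ℂ) * J q ℂ) := by
    rw [smul_mul_assoc, mul_assoc, J_squared, mul_neg, mul_one, smul_neg, neg_neg]
  refine mem_of_smul_mem (c := 2) two_ne_zero ?_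
  rw [h2, hsum, Finset.sum_mul]
  refine W.neg_mem (W.sum_mem fun i _ => ?_)
  rw [Finset.sum_mul]
  refine W.sum_mem fun j _ => ?_
  rw [smul_mul_assoc]
  exact W.smul_mem _ (hpol i j)

end Symplectic

end SimpleMatrices

section OrthogonalMatrices

attribute [local instance 100] LieRing.ofAssociativeRing

open Matrix

/-! #### The orthogonal Lie algebra -/

variable {n : Type*} [Fintype n] [DecidableEq n]

/-- The elementary skew-symmetric matrix. -/
def skewSingle (a b : n) : Matrix n n ℂ := single a b 1 - single b a 1

theorem skewSingle_mem_so (a b : n) : skewSingle a b ∈ Orthogonal.so n ℂ := by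
  rw [Orthogonal.mem_so, skewSingle, transpose_sub, transpose_single, transpose_single, neg_sub]

omit [Fintype n] in
theorem skewSingle_swap (a b : n) : skewSingle b a = -skewSingle a b := by
  rw [skewSingle, skewSingle, neg_sub]

/-- The indicator function of `{a, b}`. -/
def pairIndicator (a b k : n) : ℂ := if k = a ∨ k = b then 1 else 0

theorem skewSingle_mul_self {a b : n} (hab : a ≠ b) :
    skewSingle a b * skewSingle a b = -diagonal (pairIndicator a b) := by
  rw [skewSingle, sub_mul, mul_sub, mul_sub, single_mul_single_of_ne 1 a b a hab.symm 1,
    single_mul_single_of_ne 1 b a b hab 1, single_mul_single_same, single_mul_single_same]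
  ext i j
  by_cases hij : i = j
  · subst hij
    by_cases h1 : a = i
    · subst h1; simp [pairIndicator, hab, hab.symm]
    · by_cases h2 : b = i
      · subst h2; simp [pairIndicator, h1]
      · simp [pairIndicator, h1, h2, Ne.symm h1, Ne.symm h2]
  · have h1 : ¬(a = i ∧ a = j) := fun h => hij (h.1.symm.trans h.2)
    have h2 : ¬(b = i ∧ b = j) := fun h => hij (h.1.symm.trans h.2)
    simp [h1, h2, hij]

theorem skewSingle_mul_mul {a b : n} (hab : a ≠ b) {X : Matrix n n ℂ} (hX : Xᵀ = -X) :
    skewSingle a b * X * skewSingle a b =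
      -(diagonal (pairIndicator a b) * X * diagonal (pairIndicator a b)) := by
  have hXij : ∀ i j, X j i = -X i j := fun i j => congrFun (congrFun hX i) j
  have hXii : ∀ i, X i i = 0 := fun i => self_eq_neg.1 (hXij i i)
  rw [skewSingle, sub_mul, mul_sub, sub_mul, sub_mul, single_mul_mul_single, single_mul_mul_single,
    single_mul_mul_single, single_mul_mul_single]
  ext i j
  rw [Matrix.neg_apply, mul_diagonal, diagonal_mul]
  simp only [Matrix.sub_apply, single_apply, one_mul, mul_one, hXii, pairIndicator]
  by_cases h1 : a = i
  · subst h1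
    by_cases h2 : b = j
    · subst h2; simp [hab, hab.symm, hXij a b]
    · by_cases h3 : a = j
      · subst h3; simp [hab, hab.symm, hXii]
      · simp [hab, hab.symm, h2, h3, Ne.symm h2, Ne.symm h3]
  · by_cases h2 : b = i
    · subst h2
      by_cases h3 : a = j
      · subst h3; simp [hab, hab.symm, hXij a b]
      · by_cases h4 : b = j
        · subst h4; simp [hab, hab.symm, hXii]
        · simp [hab, hab.symm, h3, h4, Ne.symm h3, Ne.symm h4]
    · simp [h1, h2, Ne.symm h1, Ne.symm h2]

/-- The factor is `1` when exactly one of `i`, `j` belongs to `{a, b}` and `0` otherwise, so up to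
sign the double bracket is a projection onto these entries. -/
theorem ad_skewSingle_sq {a b : n} (hab : a ≠ b) {X : Matrix n n ℂ} (hX : Xᵀ = -X) (i j : n) :
    (skewSingle a b * (skewSingle a b * X - X * skewSingle a b) -
      (skewSingle a b * X - X * skewSingle a b) * skewSingle a b) i j =
      -((pairIndicator a b i + pairIndicator a b j -
        2 * pairIndicator a b i * pairIndicator a b j) * X i j) := by
  have h1 : skewSingle a b * (skewSingle a b * X - X * skewSingle a b) -
      (skewSingle a b * X - X * skewSingle a b) * skewSingle a b =
      skewSingle a b * skewSingle a b * X - (2 : ℂ) • (skewSingle a b * X * skewSingle a b) +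
        X * (skewSingle a b * skewSingle a b) := by
    rw [two_smul]; noncomm_ring
  rw [h1, skewSingle_mul_self hab, skewSingle_mul_mul hab hX]
  simp only [neg_mul, mul_neg, Matrix.add_apply, Matrix.sub_apply, Matrix.neg_apply, Matrix.smul_apply,
    diagonal_mul, mul_diagonal, smul_eq_mul]
  ring

/-- Double brackets with elementary skew matrices project onto sets of entries, and four such
projections isolate one entry. Five indices are needed: in dimension four the algebra splits into
self-dual and anti-self-dual matrices. -/
theorem hasOnlyTrivialIdeals_so (hn : 5 ≤ Fintype.card n) :
    HasOnlyTrivialIdeals (Orthogonal.so n ℂ) := by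
  intro W hW hlie B hB hB0
  have hskew : ∀ X ∈ W, Xᵀ = -X := fun X hX => (Orthogonal.mem_so _ _ X).1 (hW hX)
  have hproj : ∀ a b, a ≠ b → ∀ X ∈ W,
      (of fun i j => if ¬(i = a ∨ i = b ↔ j = a ∨ j = b) then X i j else 0) ∈ W := by
    intro a b hab X hX
    have h1 := hlie _ (skewSingle_mem_so a b) _ (hlie _ (skewSingle_mem_so a b) X hX)
    refine neg_mem_iff.1 ?_
    convert h1 using 1
    ext i j
    rw [ad_skewSingle_sq hab (hskew X hX), Matrix.neg_apply, of_apply, pairIndicator, pairIndicator]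
    by_cases h2 : i = a ∨ i = b <;> by_cases h3 : j = a ∨ j = b <;>
      (simp [h2, h3]; try norm_num)
  obtain ⟨i, j, hij⟩ : ∃ i j, B i j ≠ 0 := by
    by_contra! h0
    exact hB0 (Matrix.ext h0)
  have hBij : ∀ i j, B j i = -B i j := fun i j => congrFun (congrFun (hskew B hB) i) j
  have hne : i ≠ j := by
    rintro rfl
    exact hij (self_eq_neg.1 (hBij i i))
  have hfresh : ∀ s : Finset n, s.card < 5 → ∃ e, e ∉ s := fun s hs => by
    by_contra! h0
    have := Finset.card_le_card (fun x _ => h0 x : Finset.univ ⊆ s)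
    rw [Finset.card_univ] at this
    omega
  obtain ⟨e, he⟩ := hfresh {i, j} (lt_of_le_of_lt Finset.card_le_two (by norm_num))
  obtain ⟨b, hb⟩ := hfresh {i, j, e} (lt_of_le_of_lt Finset.card_le_three (by norm_num))
  obtain ⟨d, hd⟩ := hfresh {i, j, e, b} (lt_of_le_of_lt Finset.card_le_four (by norm_num))
  simp only [Finset.mem_insert, Finset.mem_singleton, not_or] at he hb hd
  have hF : skewSingle i j ∈ W := by
    -- The index pair `{i, j}` is the only one that meets each of `{i, e}`, `{j, e}`, `{i, b}`, `{i,
    -- d}` in exactly one element.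
    have h1 := hproj i d (Ne.symm hd.1) _ (hproj i b (Ne.symm hb.1) _
      (hproj j e (Ne.symm he.2) _ (hproj i e (Ne.symm he.1) B hB)))
    refine mem_of_smul_mem hij ?_
    convert h1 using 1
    ext k l
    have hiff : (¬(k = i ∨ k = d ↔ l = i ∨ l = d) ∧ ¬(k = i ∨ k = b ↔ l = i ∨ l = b) ∧
        ¬(k = j ∨ k = e ↔ l = j ∨ l = e) ∧ ¬(k = i ∨ k = e ↔ l = i ∨ l = e)) ↔
        (k = i ∧ l = j) ∨ (k = j ∧ l = i) := by
      grind
    simp only [of_apply, ← ite_and, hiff]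
    by_cases h2 : k = i ∧ l = j
    · obtain ⟨rfl, rfl⟩ := h2
      simp [skewSingle, hne]
    · by_cases h3 : k = j ∧ l = i
      · obtain ⟨rfl, rfl⟩ := h3
        simp [skewSingle, hne, hBij l k]
      · have h4 : ¬(i = k ∧ j = l) := fun h => h2 ⟨h.1.symm, h.2.symm⟩
        have h5 : ¬(j = k ∧ i = l) := fun h => h3 ⟨h.1.symm, h.2.symm⟩
        simp [skewSingle, h2, h3, h4, h5]
  have hstep : ∀ i j k, k ≠ i → k ≠ j → i ≠ j → skewSingle i j ∈ W → skewSingle i k ∈ W := by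
    intro i j k hki hkj hij h1
    have h2 := hlie _ (skewSingle_mem_so j k) _ h1
    refine neg_mem_iff.1 ?_
    convert h2 using 1
    simp only [skewSingle, sub_mul, mul_sub, single_mul_single_same,
      single_mul_single_of_ne _ _ _ _ hki, single_mul_single_of_ne _ _ _ _ hkj,
      single_mul_single_of_ne _ _ _ _ hij, single_mul_single_of_ne _ _ _ _ (Ne.symm hki),
      single_mul_single_of_ne _ _ _ _ (Ne.symm hkj), single_mul_single_of_ne _ _ _ _ (Ne.symm hij)]
    simp
  have hstep' : ∀ i j k, k ≠ i → i ≠ j → skewSingle i j ∈ W → skewSingle i k ∈ W := by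
    intro i j k hki hij h1
    by_cases hkj : k = j
    · rwa [hkj]
    · exact hstep i j k hki hkj hij h1
  have hswap : ∀ i j, skewSingle i j ∈ W → skewSingle j i ∈ W := fun i j h1 => by
    rw [skewSingle_swap]; exact W.neg_mem h1
  have hall : ∀ k l, skewSingle k l ∈ W := by
    intro k l
    by_cases hkl : k = l
    · rw [hkl, skewSingle, sub_self]; exact zero_mem _
    · by_cases hki : k = i
      · subst hki
        exact hstep' k j l (Ne.symm hkl) hne hF
      · exact hstep' k i l (Ne.symm hkl) hki (hswap i k (hstep' i j k hki hne hF))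
  intro A hA
  have hAsymm : Aᵀ = -A := (Orthogonal.mem_so _ _ A).1 hA
  have hsum : (2 : ℂ) • A = ∑ i, ∑ j, A i j • skewSingle i j := by
    simp only [skewSingle, smul_sub, smul_single, smul_eq_mul, mul_one, Finset.sum_sub_distrib]
    rw [← matrix_eq_sum_single, Finset.sum_comm, two_smul, sub_eq_add_neg]
    congr 1
    have h1 : -A = ∑ x, ∑ y, single x y (A y x) := by
      rw [← hAsymm]; exact matrix_eq_sum_single Aᵀ
    rw [← h1, neg_neg]
  refine mem_of_smul_mem (c := 2) two_ne_zero ?_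
  rw [hsum]
  exact W.sum_mem fun i _ => W.sum_mem fun j _ => W.smul_mem _ (hall i j)

end OrthogonalMatrices

section Quaternions

attribute [local instance 100] LieRing.ofAssociativeRing

open Matrix

/-! #### The two ideals of the orthogonal Lie algebra in dimension four -/

/-- For `s = 1` the self-dual, for `s = -1` the anti-self-dual skew-symmetric matrices. -/
def quat (s x y z : ℂ) : Matrix (Fin 4) (Fin 4) ℂ :=
  !![0, x, y, z; -x, 0, s * z, -(s * y); -y, -(s * z), 0, s * x; -z, s * y, -(s * x), 0]

set_option maxHeartbeats 1000000 in
-- As for imaginary quaternions, the anticommutator is scalar. This is why coroots in this algebra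
-- have square one.
theorem quat_mul_add {s : ℂ} (hs : s * s = 1) (x y z x' y' z' : ℂ) :
    quat s x y z * quat s x' y' z' + quat s x' y' z' * quat s x y z =
      (-2 * (x * x' + y * y' + z * z')) • (1 : Matrix (Fin 4) (Fin 4) ℂ) := by
  rcases mul_self_eq_one_iff.1 hs with rfl | rfl <;>
  · ext i j
    fin_cases i <;> fin_cases j <;>
      simp [quat] <;> ring

set_option maxHeartbeats 1000000 in
theorem quat_lie {s : ℂ} (hs : s * s = 1) (x y z x' y' z' : ℂ) :
    quat s x y z * quat s x' y' z' - quat s x' y' z' * quat s x y z =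
      quat s (-2 * s * (y * z' - z * y')) (-2 * s * (z * x' - x * z'))
        (-2 * s * (x * y' - y * x')) := by
  rcases mul_self_eq_one_iff.1 hs with rfl | rfl <;>
  · ext i j
    fin_cases i <;> fin_cases j <;>
      simp [quat] <;> ring

theorem quat_commute (x y z x' y' z' : ℂ) :
    quat 1 x y z * quat (-1) x' y' z' = quat (-1) x' y' z' * quat 1 x y z := by
  ext i j
  fin_cases i <;> fin_cases j <;>
    simp [quat, Matrix.mul_apply, Fin.sum_univ_four] <;> ring

theorem quat_add (s x y z x' y' z' : ℂ) :
    quat s x y z + quat s x' y' z' = quat s (x + x') (y + y') (z + z') := by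
  ext i j
  fin_cases i <;> fin_cases j <;> simp [quat] <;> ring

theorem quat_smul (s c x y z : ℂ) : c • quat s x y z = quat s (c * x) (c * y) (c * z) := by
  ext i j
  fin_cases i <;> fin_cases j <;> simp [quat] <;> ring

theorem quat_zero (s : ℂ) : quat s 0 0 0 = 0 := by
  ext i j
  fin_cases i <;> fin_cases j <;> simp [quat]

theorem quat_transpose (s x y z : ℂ) : (quat s x y z)ᵀ = -quat s x y z := by
  ext i j
  fin_cases i <;> fin_cases j <;> simp [quat]

theorem eq_quat_add_quat {A : Matrix (Fin 4) (Fin 4) ℂ} (hA : Aᵀ = -A) :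
    A = quat 1 ((A 0 1 + A 2 3) / 2) ((A 0 2 - A 1 3) / 2) ((A 0 3 + A 1 2) / 2) +
      quat (-1) ((A 0 1 - A 2 3) / 2) ((A 0 2 + A 1 3) / 2) ((A 0 3 - A 1 2) / 2) := by
  have h : ∀ i j, A j i = -A i j := fun i j => congrFun (congrFun hA i) j
  have h0 : ∀ i, A i i = 0 := fun i => self_eq_neg.1 (h i i)
  ext i j
  fin_cases i <;> fin_cases j <;> simp [quat, h0] <;>
    ring_nf
  exacts [h 0 1, h 0 2, h 1 2, h 0 3, h 1 3, h 2 3]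

/-- The Lie algebra of self-dual or anti-self-dual matrices. -/
def quatLie {s : ℂ} (hs : s * s = 1) : LieSubalgebra ℂ (Matrix (Fin 4) (Fin 4) ℂ) where
  carrier := {A | ∃ x y z, A = quat s x y z}
  add_mem' := by
    rintro _ _ ⟨x, y, z, rfl⟩ ⟨x', y', z', rfl⟩
    exact ⟨_, _, _, quat_add ..⟩
  zero_mem' := ⟨0, 0, 0, (quat_zero s).symm⟩
  smul_mem' := by
    rintro c _ ⟨x, y, z, rfl⟩
    exact ⟨_, _, _, quat_smul ..⟩
  lie_mem' := by
    rintro _ _ ⟨x, y, z, rfl⟩ ⟨x', y', z', rfl⟩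
    exact ⟨_, _, _, quat_lie hs ..⟩

/-- The bracket is a multiple of the cross product. The double bracket with a basis vector removes
one coordinate and multiplies the other two by `-4`; a single coordinate is isolated in this way and
then rotated to the others. -/
theorem hasOnlyTrivialIdeals_quatLie {s : ℂ} (hs : s * s = 1) :
    HasOnlyTrivialIdeals (quatLie hs) := by
  intro W hW hlie B hB hB0
  obtain ⟨x, y, z, rfl⟩ := hW hB
  have h1 : ∀ x y z, quat s x y z ∈ W → quat s 0 y z ∈ W := by
    intro x y z h
    have h2 := hlie _ ⟨1, 0, 0, rfl⟩ _ (hlie _ ⟨1, 0, 0, rfl⟩ _ h)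
    rw [quat_lie hs, quat_lie hs] at h2
    refine mem_of_smul_mem (c := -4) (by norm_num) ?_
    rw [quat_smul]
    convert h2 using 2
    · ring
    · linear_combination (4 * y) * hs
    · linear_combination (4 * z) * hs
  have h2 : ∀ x y z, quat s x y z ∈ W → quat s x 0 z ∈ W := by
    intro x y z h
    have h2 := hlie _ ⟨0, 1, 0, rfl⟩ _ (hlie _ ⟨0, 1, 0, rfl⟩ _ h)
    rw [quat_lie hs, quat_lie hs] at h2
    refine mem_of_smul_mem (c := -4) (by norm_num) ?_
    rw [quat_smul]
    convert h2 using 2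
    · linear_combination (4 * x) * hs
    · ring
    · linear_combination (4 * z) * hs
  have h3 : ∀ x y z, quat s x y z ∈ W → quat s x y 0 ∈ W := by
    intro x y z h
    have h2 := hlie _ ⟨0, 0, 1, rfl⟩ _ (hlie _ ⟨0, 0, 1, rfl⟩ _ h)
    rw [quat_lie hs, quat_lie hs] at h2
    refine mem_of_smul_mem (c := -4) (by norm_num) ?_
    rw [quat_smul]
    convert h2 using 2
    · linear_combination (4 * x) * hs
    · linear_combination (4 * y) * hs
    · ring
  have hs0 : s ≠ 0 := by rintro rfl; simp at hs
  have hrot1 : quat s 1 0 0 ∈ W → quat s 0 1 0 ∈ W := by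
    intro h
    have h4 := hlie _ ⟨0, 0, 1, rfl⟩ _ h
    rw [quat_lie hs] at h4
    refine mem_of_smul_mem (c := -2 * s) (by simpa using hs0) ?_
    rw [quat_smul]
    convert h4 using 2 <;> ring
  have hrot2 : quat s 0 1 0 ∈ W → quat s 0 0 1 ∈ W := by
    intro h
    have h4 := hlie _ ⟨1, 0, 0, rfl⟩ _ h
    rw [quat_lie hs] at h4
    refine mem_of_smul_mem (c := -2 * s) (by simpa using hs0) ?_
    rw [quat_smul]
    convert h4 using 2 <;> ring
  have hrot3 : quat s 0 0 1 ∈ W → quat s 1 0 0 ∈ W := by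
    intro h
    have h4 := hlie _ ⟨0, 1, 0, rfl⟩ _ h
    rw [quat_lie hs] at h4
    refine mem_of_smul_mem (c := -2 * s) (by simpa using hs0) ?_
    rw [quat_smul]
    convert h4 using 2 <;> ring
  have hone : quat s 1 0 0 ∈ W := by
    by_cases hx : x = 0
    · by_cases hy : y = 0
      · have hz : z ≠ 0 := by
          rintro rfl
          exact hB0 (by rw [hx, hy, quat_zero])
        refine hrot3 (mem_of_smul_mem hz ?_)
        rw [quat_smul]
        convert hB using 2 <;> simp [hx, hy]
      · refine hrot3 (hrot2 (mem_of_smul_mem hy ?_))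
        rw [quat_smul]
        convert h3 _ _ _ hB using 2 <;> simp [hx]
    · refine mem_of_smul_mem hx ?_
      rw [quat_smul]
      convert h3 _ _ _ (h2 _ _ _ hB) using 2 <;> simp
  rintro _ ⟨x', y', z', rfl⟩
  have h4 := W.add_mem (W.add_mem (W.smul_mem x' hone) (W.smul_mem y' (hrot1 hone)))
    (W.smul_mem z' (hrot2 (hrot1 hone)))
  rw [quat_smul, quat_smul, quat_smul, quat_add, quat_add] at h4
  convert h4 using 2 <;> simp

/-- The coroot of a root vector of the quaternions has square one. -/
theorem quat_mul_self_eq_one {s : ℂ} (hs : s * s = 1) {h e : Matrix (Fin 4) (Fin 4) ℂ}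
    (hh : h ∈ quatLie hs) (he : e ∈ quatLie hs) (he0 : e ≠ 0) (hhe : h * e - e * h = (2 : ℂ) • e) :
    h * h = 1 := by
  obtain ⟨x, y, z, rfl⟩ := hh
  obtain ⟨x', y', z', rfl⟩ := he
  set h := quat s x y z
  set e := quat s x' y' z'
  have h1 : ∃ c : ℂ, h * e + e * h = c • (1 : Matrix (Fin 4) (Fin 4) ℂ) := ⟨_, quat_mul_add hs ..⟩
  have h2 : ∃ c : ℂ, h * h + h * h = c • (1 : Matrix (Fin 4) (Fin 4) ℂ) := ⟨_, quat_mul_add hs ..⟩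
  obtain ⟨c, hc⟩ := h1
  obtain ⟨d, hd⟩ := h2
  -- The anticommutator of `h` and `e` has eigenvalue `2` under `ad h`, but as a scalar it commutes
  -- with `h`, so it vanishes. With `h e - e h = 2 e` this gives `h e = e`, and the scalar `h²` is
  -- then `1`.
  have h3 : h * (h * e + e * h) - (h * e + e * h) * h = (2 : ℂ) • (h * e + e * h) := by
    have h4 : h * (h * e + e * h) - (h * e + e * h) * h =
      h * (h * e - e * h) + (h * e - e * h) * h := by noncomm_ring
    rw [h4, hhe, mul_smul_comm, smul_mul_assoc, smul_add]
  have h5 : h * e + e * h = 0 := by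
    rw [hc, mul_smul_comm, smul_mul_assoc, mul_one, one_mul, sub_self] at h3
    rw [hc]
    exact (smul_eq_zero.1 h3.symm).resolve_left two_ne_zero
  have h6 : h * e = e := by
    have h7 : (2 : ℂ) • (h * e) = (2 : ℂ) • e := by
      rw [← hhe, two_smul]
      nth_rewrite 2 [eq_neg_of_add_eq_zero_left h5]
      rw [sub_eq_add_neg]
    exact smul_right_injective _ (two_ne_zero' ℂ) h7
  have h8 : d • e = (2 : ℂ) • e := by
    have h9 : (h * h + h * h) * e = (2 : ℂ) • e := by
      rw [add_mul, mul_assoc, h6, h6, two_smul]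
    rw [← h9, hd, smul_mul_assoc, one_mul]
  have h10 : d = 2 := smul_left_injective _ he0 h8
  rw [h10, ← two_smul ℂ] at hd
  exact smul_right_injective _ (two_ne_zero' ℂ) hd

end Quaternions

section BlockMatrices

attribute [local instance 100] LieRing.ofAssociativeRing

open Matrix

/-! ### The simple ideals of the even parts of the models -/

theorem fromBlocks_diagonal_sub {p q : Type*} (A A' : Matrix p p ℂ) (D D' : Matrix q q ℂ) :
    fromBlocks A 0 0 D - fromBlocks A' 0 0 D' = fromBlocks (A - A') 0 0 (D - D') := by
  rw [sub_eq_add_neg, fromBlocks_neg, fromBlocks_add]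
  simp [sub_eq_add_neg]

theorem fromBlocks_diagonal_mul {p q : Type*} [Fintype p] [Fintype q] (A A' : Matrix p p ℂ) (D D' : Matrix q q ℂ) :
    fromBlocks A 0 0 D * fromBlocks A' 0 0 D' = fromBlocks (A * A') 0 0 (D * D') := by
  rw [fromBlocks_multiply]
  simp

variable {p q : Type} [Fintype p] [DecidableEq p] [Fintype q] [DecidableEq q]

/-- The inclusion of a Lie algebra of matrices as upper left block. -/
def upperHom (E : LieSubalgebra ℂ (Matrix (p ⊕ q) (p ⊕ q) ℂ)) (N : LieSubalgebra ℂ (Matrix p p ℂ))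
    (hN : ∀ A ∈ N, fromBlocks A 0 0 0 ∈ E) : N →ₗ⁅ℂ⁆ E where
  toFun A := ⟨fromBlocks A 0 0 0, hN A A.2⟩
  map_add' A B := Subtype.ext (by simp [fromBlocks_add])
  map_smul' c A := Subtype.ext (by simp [fromBlocks_smul])
  map_lie' {A B} := Subtype.ext (by
    simp [LieRing.of_associative_ring_bracket, fromBlocks_diagonal_mul, fromBlocks_diagonal_sub])

/-- The inclusion of a Lie algebra of matrices as lower right block. -/
def lowerHom (E : LieSubalgebra ℂ (Matrix (p ⊕ q) (p ⊕ q) ℂ)) (N : LieSubalgebra ℂ (Matrix q q ℂ))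
    (hN : ∀ A ∈ N, fromBlocks 0 0 0 A ∈ E) : N →ₗ⁅ℂ⁆ E where
  toFun A := ⟨fromBlocks 0 0 0 A, hN A A.2⟩
  map_add' A B := Subtype.ext (by simp [fromBlocks_add])
  map_smul' c A := Subtype.ext (by simp [fromBlocks_smul])
  map_lie' {A B} := Subtype.ext (by
    simp [LieRing.of_associative_ring_bracket, fromBlocks_diagonal_mul, fromBlocks_diagonal_sub])

theorem coe_upperHom (E : LieSubalgebra ℂ (Matrix (p ⊕ q) (p ⊕ q) ℂ))
    (N : LieSubalgebra ℂ (Matrix p p ℂ)) (hN : ∀ A ∈ N, fromBlocks A 0 0 0 ∈ E) (A : N) :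
    (upperHom E N hN A : Matrix (p ⊕ q) (p ⊕ q) ℂ) = fromBlocks A 0 0 0 := rfl

theorem coe_lowerHom (E : LieSubalgebra ℂ (Matrix (p ⊕ q) (p ⊕ q) ℂ))
    (N : LieSubalgebra ℂ (Matrix q q ℂ)) (hN : ∀ A ∈ N, fromBlocks 0 0 0 A ∈ E) (A : N) :
    (lowerHom E N hN A : Matrix (p ⊕ q) (p ⊕ q) ℂ) = fromBlocks 0 0 0 A := rfl

theorem upperHom_isIdealMorphism {E : LieSubalgebra ℂ (Matrix (p ⊕ q) (p ⊕ q) ℂ)}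
    {N : LieSubalgebra ℂ (Matrix p p ℂ)} (hN : ∀ A ∈ N, fromBlocks A 0 0 0 ∈ E)
    (hE : ∀ X ∈ E, ∃ Y Z, X = fromBlocks Y 0 0 Z ∧ ∀ A ∈ N, Y * A - A * Y ∈ N) :
    (upperHom E N hN).IsIdealMorphism := by
  rw [LieHom.isIdealMorphism_iff]
  rintro ⟨X, hX⟩ ⟨A, hA⟩
  obtain ⟨Y, Z, rfl, hY⟩ := hE X hX
  refine ⟨⟨_, hY A hA⟩, Subtype.ext ?_⟩
  rw [coe_upperHom, LieSubalgebra.coe_bracket, coe_upperHom, LieRing.of_associative_ring_bracket,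
    fromBlocks_diagonal_mul, fromBlocks_diagonal_mul, fromBlocks_diagonal_sub]
  simp

theorem lowerHom_isIdealMorphism {E : LieSubalgebra ℂ (Matrix (p ⊕ q) (p ⊕ q) ℂ)}
    {N : LieSubalgebra ℂ (Matrix q q ℂ)} (hN : ∀ A ∈ N, fromBlocks 0 0 0 A ∈ E)
    (hE : ∀ X ∈ E, ∃ Y Z, X = fromBlocks Y 0 0 Z ∧ ∀ A ∈ N, Z * A - A * Z ∈ N) :
    (lowerHom E N hN).IsIdealMorphism := by
  rw [LieHom.isIdealMorphism_iff]
  rintro ⟨X, hX⟩ ⟨A, hA⟩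
  obtain ⟨Y, Z, rfl, hZ⟩ := hE X hX
  refine ⟨⟨_, hZ A hA⟩, Subtype.ext ?_⟩
  rw [coe_lowerHom, LieSubalgebra.coe_bracket, coe_lowerHom, LieRing.of_associative_ring_bracket,
    fromBlocks_diagonal_mul, fromBlocks_diagonal_mul, fromBlocks_diagonal_sub]
  simp

theorem eq_fromBlocks_of_commute_parityOp {X : Matrix (p ⊕ q) (p ⊕ q) ℂ}
    (hX : parityOp p q * X = X * parityOp p q) :
    X = fromBlocks X.toBlocks₁₁ 0 0 X.toBlocks₂₂ := by
  have h1 := hX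
  rw [parityOp, ← fromBlocks_toBlocks X, fromBlocks_multiply, fromBlocks_multiply,
    fromBlocks_inj] at h1
  obtain ⟨-, h2, h3, -⟩ := h1
  rw [Matrix.zero_mul, add_zero, Matrix.mul_zero, zero_add, Matrix.one_mul, Matrix.mul_neg,
    Matrix.mul_one] at h2
  rw [Matrix.zero_mul, zero_add, Matrix.mul_zero, add_zero, Matrix.neg_mul, Matrix.one_mul,
    Matrix.mul_one] at h3
  conv_lhs => rw [← fromBlocks_toBlocks X]
  have h4 : X.toBlocks₁₂ = 0 := by
    ext i j
    exact self_eq_neg.1 (congrFun (congrFun h2 i) j)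
  have h5 : X.toBlocks₂₁ = 0 := by
    ext i j
    exact self_eq_neg.1 (congrFun (congrFun h3.symm i) j)
  rw [h4, h5]

theorem fromBlocks_commute_parityOp (A : Matrix p p ℂ) (D : Matrix q q ℂ) :
    parityOp p q * fromBlocks A 0 0 D = fromBlocks A 0 0 D * parityOp p q := by
  rw [parityOp, fromBlocks_multiply, fromBlocks_multiply]
  simp

/-! #### Type A -/

theorem fromBlocks_mem_slSuper (A : Matrix p p ℂ) (D : Matrix q q ℂ) :
    fromBlocks A 0 0 D ∈ (slSuper p q).even ↔ A.trace = D.trace := by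
  change _ ∧ _ ↔ _
  rw [and_iff_right (fromBlocks_commute_parityOp A D), parityOp, fromBlocks_multiply]
  simp [Matrix.trace, Fintype.sum_sum_type, ← sub_eq_add_neg, sub_eq_zero]

theorem exists_of_mem_slSuper {X : Matrix (p ⊕ q) (p ⊕ q) ℂ} (hX : X ∈ (slSuper p q).even) :
    ∃ A D, X = fromBlocks A 0 0 D ∧ A.trace = D.trace := by
  have h1 := eq_fromBlocks_of_commute_parityOp hX.1
  refine ⟨_, _, h1, ?_⟩
  rw [h1] at hX
  exact (fromBlocks_mem_slSuper _ _).1 hX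

theorem mul_sub_mul_mem_sl {n : Type*} [Fintype n] [DecidableEq n] (A B : Matrix n n ℂ) :
    A * B - B * A ∈ SpecialLinear.sl n ℂ :=
  LinearMap.mem_ker.2 (matrix_trace_commutator_zero n ℂ A B)

theorem upper_mem_slSuper (A : Matrix p p ℂ) (hA : A ∈ SpecialLinear.sl p ℂ) :
    fromBlocks A 0 0 0 ∈ (slSuper p q).even :=
  (fromBlocks_mem_slSuper A 0).2 ((LinearMap.mem_ker.1 hA).trans (trace_zero q ℂ).symm)

theorem lower_mem_slSuper (A : Matrix q q ℂ) (hA : A ∈ SpecialLinear.sl q ℂ) :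
    fromBlocks 0 0 0 A ∈ (slSuper p q).even :=
  (fromBlocks_mem_slSuper 0 A).2 ((trace_zero p ℂ).trans (LinearMap.mem_ker.1 hA).symm)

/-- The two simple ideals of the even part of `sl(p|q)`. -/
def slSuperIdeals : Fin 2 → LieIdeal ℂ (slSuper p q).even :=
  ![(upperHom (slSuper p q).even (SpecialLinear.sl p ℂ) upper_mem_slSuper).idealRange,
    (lowerHom (slSuper p q).even (SpecialLinear.sl q ℂ) lower_mem_slSuper).idealRange]

theorem sub_smul_one_mem_sl {n : Type*} [Fintype n] [DecidableEq n] [Nonempty n]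
    (A : Matrix n n ℂ) :
    A - (A.trace / Fintype.card n) • (1 : Matrix n n ℂ) ∈ SpecialLinear.sl n ℂ := by
  refine LinearMap.mem_ker.2 ?_
  rw [traceLinearMap_apply, trace_sub, trace_smul, trace_one, smul_eq_mul, div_mul_cancel₀,
    sub_self]
  exact Nat.cast_ne_zero.2 Fintype.card_ne_zero

theorem isSimpleCover_slSuper [Nonempty p] [Nonempty q] :
    IsSimpleCover (slSuperIdeals (p := p) (q := q)) where
  cover := by
    rintro ⟨X, hX⟩
    obtain ⟨A, D, rfl, hAD⟩ := exists_of_mem_slSuper hX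
    -- The central component is scalar on each block and has the same block traces as `X`, so its
    -- supertrace is zero as well.
    have hz : fromBlocks ((A.trace / Fintype.card p) • (1 : Matrix p p ℂ)) 0 0
        ((D.trace / Fintype.card q) • (1 : Matrix q q ℂ)) ∈ (slSuper p q).even := by
      rw [fromBlocks_mem_slSuper, trace_smul, trace_smul, trace_one, trace_one, smul_eq_mul,
        smul_eq_mul, div_mul_cancel₀, div_mul_cancel₀, hAD] <;>
      exact Nat.cast_ne_zero.2 Fintype.card_ne_zero
    refine ⟨⟨_, hz⟩, mem_center_iff_lie_eq_zero.2 ?_, ![upperHom _ _ upper_mem_slSuper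
      ⟨_, sub_smul_one_mem_sl A⟩, lowerHom _ _ lower_mem_slSuper ⟨_, sub_smul_one_mem_sl D⟩], ?_, ?_⟩
    · rintro ⟨Y, hY⟩
      obtain ⟨B, E, rfl, -⟩ := exists_of_mem_slSuper hY
      refine Subtype.ext ?_
      rw [LieSubalgebra.coe_bracket, LieRing.of_associative_ring_bracket,
        fromBlocks_diagonal_mul, fromBlocks_diagonal_mul, fromBlocks_diagonal_sub]
      simp
    · intro i
      fin_cases i
      · exact LieHom.mem_idealRange (upperHom _ _ upper_mem_slSuper) _
      · exact LieHom.mem_idealRange (lowerHom _ _ lower_mem_slSuper) _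
    · refine Subtype.ext ?_
      rw [Fin.sum_univ_two]
      change fromBlocks A 0 0 D = fromBlocks _ 0 0 _ + (fromBlocks _ 0 0 0 + fromBlocks 0 0 0 _)
      rw [fromBlocks_add, fromBlocks_add]
      simp
  minimal i x hx hx0 J hxJ := by
    fin_cases i
    · refine hasOnlyTrivialIdeals_sl.idealRange_le (upperHom_isIdealMorphism _ fun X hX => ?_)
        hx hx0 hxJ
      obtain ⟨A, D, rfl, -⟩ := exists_of_mem_slSuper hX
      exact ⟨A, D, rfl, fun B _ => mul_sub_mul_mem_sl A B⟩
    · refine hasOnlyTrivialIdeals_sl.idealRange_le (lowerHom_isIdealMorphism _ fun X hX => ?_)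
        hx hx0 hxJ
      obtain ⟨A, D, rfl, -⟩ := exists_of_mem_slSuper hX
      exact ⟨A, D, rfl, fun B _ => mul_sub_mul_mem_sl D B⟩

/-! #### Type D -/

theorem fromBlocks_mem_ospSuper (A : Matrix p p ℂ) (D : Matrix (q ⊕ q) (q ⊕ q) ℂ) :
    fromBlocks A 0 0 D ∈ (ospSuper p q).even ↔
      A ∈ Orthogonal.so p ℂ ∧ D ∈ Symplectic.sp q ℂ := by
  change _ ∧ _ ↔ _
  rw [and_iff_right (fromBlocks_commute_parityOp A D), ospGram, fromBlocks_transpose,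
    fromBlocks_multiply, fromBlocks_multiply, fromBlocks_add, ← fromBlocks_zero, fromBlocks_inj,
    Orthogonal.mem_so, mem_sp_iff]
  simp [← eq_neg_iff_add_eq_zero]

theorem exists_of_mem_ospSuper {X : Matrix (p ⊕ (q ⊕ q)) (p ⊕ (q ⊕ q)) ℂ}
    (hX : X ∈ (ospSuper p q).even) :
    ∃ A D, X = fromBlocks A 0 0 D ∧ A ∈ Orthogonal.so p ℂ ∧ D ∈ Symplectic.sp q ℂ := by
  have h1 := eq_fromBlocks_of_commute_parityOp hX.1
  refine ⟨_, _, h1, ?_⟩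
  rw [h1] at hX
  exact (fromBlocks_mem_ospSuper _ _).1 hX

theorem upper_mem_ospSuper {N : LieSubalgebra ℂ (Matrix p p ℂ)} (hN : N ≤ Orthogonal.so p ℂ)
    (A : Matrix p p ℂ) (hA : A ∈ N) : fromBlocks A 0 0 0 ∈ (ospSuper p q).even :=
  (fromBlocks_mem_ospSuper A 0).2 ⟨hN hA, zero_mem _⟩

theorem lower_mem_ospSuper (A : Matrix (q ⊕ q) (q ⊕ q) ℂ) (hA : A ∈ Symplectic.sp q ℂ) :
    fromBlocks 0 0 0 A ∈ (ospSuper p q).even :=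
  (fromBlocks_mem_ospSuper 0 A).2 ⟨zero_mem _, hA⟩

/-- The ideal of the even part of `osp(p|2q)` given by an ideal of `so(p)`. -/
def ospUpperIdeal (q : Type) [Fintype q] [DecidableEq q] (N : LieSubalgebra ℂ (Matrix p p ℂ))
    (hN : N ≤ Orthogonal.so p ℂ) : LieIdeal ℂ (ospSuper p q).even :=
  (upperHom (ospSuper p q).even N (upper_mem_ospSuper hN)).idealRange

/-- The symplectic ideal of the even part of `osp(p|2q)`. -/
def ospLowerIdeal (p q : Type) [Fintype p] [DecidableEq p] [Fintype q] [DecidableEq q] :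
    LieIdeal ℂ (ospSuper p q).even :=
  (lowerHom (ospSuper p q).even (Symplectic.sp q ℂ) lower_mem_ospSuper).idealRange

theorem ospUpperIdeal_le {N : LieSubalgebra ℂ (Matrix p p ℂ)} (hN : N ≤ Orthogonal.so p ℂ)
    (hlie : ∀ Y ∈ Orthogonal.so p ℂ, ∀ A ∈ N, Y * A - A * Y ∈ N) (hsimple : HasOnlyTrivialIdeals N)
    {x : (ospSuper p q).even} (hx : x ∈ ospUpperIdeal q N hN) (hx0 : x ≠ 0)
    {J : LieIdeal ℂ (ospSuper p q).even} (hxJ : x ∈ J) : ospUpperIdeal q N hN ≤ J := by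
  refine hsimple.idealRange_le (upperHom_isIdealMorphism _ fun X hX => ?_) hx hx0 hxJ
  obtain ⟨A, D, rfl, hA, -⟩ := exists_of_mem_ospSuper hX
  exact ⟨A, D, rfl, hlie A hA⟩

theorem ospLowerIdeal_le {x : (ospSuper p q).even} (hx : x ∈ ospLowerIdeal p q) (hx0 : x ≠ 0)
    {J : LieIdeal ℂ (ospSuper p q).even} (hxJ : x ∈ J) : ospLowerIdeal p q ≤ J := by
  refine hasOnlyTrivialIdeals_sp.idealRange_le (lowerHom_isIdealMorphism _ fun X hX => ?_)
    hx hx0 hxJ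
  obtain ⟨A, D, rfl, -, hD⟩ := exists_of_mem_ospSuper hX
  exact ⟨A, D, rfl, fun B hB => (Symplectic.sp q ℂ).lie_mem hD hB⟩

theorem isSimpleCover_ospSuper (hp : 5 ≤ Fintype.card p) :
    IsSimpleCover ![ospUpperIdeal q (Orthogonal.so p ℂ) le_rfl, ospLowerIdeal p q] where
  cover := by
    rintro ⟨X, hX⟩
    obtain ⟨A, D, rfl, hA, hD⟩ := exists_of_mem_ospSuper hX
    refine ⟨0, zero_mem _, ![upperHom _ _ (upper_mem_ospSuper le_rfl) ⟨A, hA⟩,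
      lowerHom _ _ lower_mem_ospSuper ⟨D, hD⟩], ?_, ?_⟩
    · intro i
      fin_cases i
      · exact LieHom.mem_idealRange (upperHom _ _ (upper_mem_ospSuper le_rfl)) _
      · exact LieHom.mem_idealRange (lowerHom _ _ lower_mem_ospSuper) _
    · refine Subtype.ext ?_
      rw [Fin.sum_univ_two]
      change fromBlocks A 0 0 D = 0 + (fromBlocks _ 0 0 0 + fromBlocks 0 0 0 _)
      rw [fromBlocks_add]
      simp
  minimal i x hx hx0 J hxJ := by
    fin_cases i
    · exact ospUpperIdeal_le le_rfl (fun Y hY A hA => (Orthogonal.so p ℂ).lie_mem hY hA)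
        (hasOnlyTrivialIdeals_so hp) hx hx0 hxJ
    · exact ospLowerIdeal_le hx hx0 hxJ

end BlockMatrices

/-! ### The three ideals of the even part of `osp(4|2n)` -/

section EvenParts

attribute [local instance 100] LieRing.ofAssociativeRing

open Matrix

variable {q : Type} [Fintype q] [DecidableEq q]

theorem quatLie_le_so {s : ℂ} (hs : s * s = 1) : quatLie hs ≤ Orthogonal.so (Fin 4) ℂ := by
  rintro _ ⟨x, y, z, rfl⟩
  exact (Orthogonal.mem_so _ _ _).2 (quat_transpose s x y z)

theorem quatLie_lie_mem {s : ℂ} (hs : s * s = 1) {Y A : Matrix (Fin 4) (Fin 4) ℂ}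
    (hY : Y ∈ Orthogonal.so (Fin 4) ℂ) (hA : A ∈ quatLie hs) : Y * A - A * Y ∈ quatLie hs := by
  obtain ⟨x, y, z, rfl⟩ := hA
  rw [eq_quat_add_quat ((Orthogonal.mem_so _ _ _).1 hY)]
  rcases mul_self_eq_one_iff.1 hs with rfl | rfl
  · rw [add_mul, mul_add, add_sub_add_comm, quat_lie hs, ← quat_commute, sub_self, add_zero]
    exact ⟨_, _, _, rfl⟩
  · rw [add_mul, mul_add, add_sub_add_comm, quat_lie hs, quat_commute, sub_self, zero_add]
    exact ⟨_, _, _, rfl⟩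

theorem finrank_quatLie_le {s : ℂ} (hs : s * s = 1) : finrank ℂ (quatLie hs) ≤ 3 := by
  have h1 : (quatLie hs).toSubmodule ≤
      Submodule.span ℂ (Set.range ![quat s 1 0 0, quat s 0 1 0, quat s 0 0 1]) := by
    rintro _ ⟨x, y, z, rfl⟩
    have h2 : quat s x y z = x • quat s 1 0 0 + y • quat s 0 1 0 + z • quat s 0 0 1 := by
      simp only [quat_smul, quat_add]
      simp
    rw [h2]
    refine add_mem (add_mem ?_ ?_) ?_ <;> refine Submodule.smul_mem _ _ (Submodule.subset_span ?_)
    · exact ⟨0, rfl⟩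
    · exact ⟨1, rfl⟩
    · exact ⟨2, rfl⟩
  exact (Submodule.finrank_mono h1).trans
    ((finrank_range_le_card _).trans_eq (Fintype.card_fin 3))

/-- The three simple ideals of the even part of `osp(4|2q)`. -/
def ospFourIdeals (q : Type) [Fintype q] [DecidableEq q] :
    Fin 3 → LieIdeal ℂ (ospSuper (Fin 4) q).even :=
  ![ospUpperIdeal q (quatLie (s := 1) (by norm_num)) (quatLie_le_so _),
    ospUpperIdeal q (quatLie (s := -1) (by norm_num)) (quatLie_le_so _),
    ospLowerIdeal (Fin 4) q]

theorem isSimpleCover_ospFour : IsSimpleCover (ospFourIdeals q) where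
  cover := by
    rintro ⟨X, hX⟩
    obtain ⟨A, D, rfl, hA, hD⟩ := exists_of_mem_ospSuper hX
    obtain ⟨B, hB, C, hC, rfl⟩ : ∃ B ∈ quatLie (s := 1) (by norm_num),
        ∃ C ∈ quatLie (s := -1) (by norm_num), A = B + C :=
      ⟨_, ⟨_, _, _, rfl⟩, _, ⟨_, _, _, rfl⟩, eq_quat_add_quat ((Orthogonal.mem_so _ _ _).1 hA)⟩
    refine ⟨0, zero_mem _, ![upperHom _ _ (upper_mem_ospSuper (quatLie_le_so _)) ⟨B, hB⟩,
      upperHom _ _ (upper_mem_ospSuper (quatLie_le_so _)) ⟨C, hC⟩,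
      lowerHom _ _ lower_mem_ospSuper ⟨D, hD⟩], ?_, ?_⟩
    · intro i
      fin_cases i
      · exact LieHom.mem_idealRange (upperHom _ _ (upper_mem_ospSuper (quatLie_le_so _))) _
      · exact LieHom.mem_idealRange (upperHom _ _ (upper_mem_ospSuper (quatLie_le_so _))) _
      · exact LieHom.mem_idealRange (lowerHom _ _ lower_mem_ospSuper) _
    · refine Subtype.ext ?_
      rw [Fin.sum_univ_three]
      change fromBlocks (B + C) 0 0 D =
        0 + (fromBlocks B 0 0 0 + fromBlocks C 0 0 0 + fromBlocks 0 0 0 D)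
      rw [fromBlocks_add, fromBlocks_add]
      simp
  minimal i x hx hx0 J hxJ := by
    fin_cases i
    · exact ospUpperIdeal_le (quatLie_le_so _) (fun Y hY A hA => quatLie_lie_mem _ hY hA)
        (hasOnlyTrivialIdeals_quatLie _) hx hx0 hxJ
    · exact ospUpperIdeal_le (quatLie_le_so _) (fun Y hY A hA => quatLie_lie_mem _ hY hA)
        (hasOnlyTrivialIdeals_quatLie _) hx hx0 hxJ
    · exact ospLowerIdeal_le hx hx0 hxJ

theorem mem_ospFourIdeals_zero {x : (ospSuper (Fin 4) q).even} (hx : x ∈ ospFourIdeals q 0) :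
    ∃ A ∈ quatLie (s := 1) (by norm_num), x.1 = fromBlocks A 0 0 0 := by
  have hψ : (upperHom (ospSuper (Fin 4) q).even (quatLie (s := 1) (by norm_num))
      (upper_mem_ospSuper (quatLie_le_so _))).IsIdealMorphism := by
    refine upperHom_isIdealMorphism _ fun X hX => ?_
    obtain ⟨A, D, rfl, hA, -⟩ := exists_of_mem_ospSuper hX
    exact ⟨A, D, rfl, fun B hB => quatLie_lie_mem _ hA hB⟩
  obtain ⟨A, rfl⟩ := (LieHom.mem_idealRange_iff _ hψ).1 hx
  exact ⟨A, A.2, rfl⟩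

theorem finrank_ospFourIdeals_zero_le : finrank ℂ (ospFourIdeals q 0) ≤ 3 := by
  have h1 : (ospFourIdeals q 0).toSubmodule ≤
      LinearMap.range (upperHom (ospSuper (Fin 4) q).even (quatLie (s := 1) (by norm_num))
        (upper_mem_ospSuper (quatLie_le_so _))).toLinearMap := by
    intro x hx
    obtain ⟨A, hA, hxA⟩ := mem_ospFourIdeals_zero hx
    exact ⟨⟨A, hA⟩, Subtype.ext hxA.symm⟩
  exact (Submodule.finrank_mono h1).trans
    ((LinearMap.finrank_range_le _).trans (finrank_quatLie_le _))

/-- The upper block of `h` has square one. An odd matrix has only off-diagonal blocks, and on these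
`h` acts by left or right multiplication with that block alone. -/
theorem ospFourIdeals_zero_lie_lie {h e : (ospSuper (Fin 4) q).even}
    (hh : h ∈ ospFourIdeals q 0) (he : e ∈ ospFourIdeals q 0) (he0 : e ≠ 0)
    (hhe : ⁅h, e⁆ = (2 : ℂ) • e) (a : (ospSuper (Fin 4) q).odd) : ⁅h, ⁅h, a⁆⁆ = a := by
  obtain ⟨A, hA, hhA⟩ := mem_ospFourIdeals_zero hh
  obtain ⟨B, hB, heB⟩ := mem_ospFourIdeals_zero he
  have hB0 : B ≠ 0 := by
    rintro rfl
    exact he0 (Subtype.ext (heB.trans fromBlocks_zero))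
  have hAB : A * B - B * A = (2 : ℂ) • B := by
    have h1 := congrArg Subtype.val hhe
    rw [LieSubalgebra.coe_bracket, LieRing.of_associative_ring_bracket, hhA, heB,
      fromBlocks_diagonal_mul, fromBlocks_diagonal_mul, fromBlocks_diagonal_sub] at h1
    change _ = (2 : ℂ) • e.1 at h1
    rw [heB, fromBlocks_smul, fromBlocks_inj] at h1
    exact h1.1
  have hAA := quat_mul_self_eq_one _ hA hB hB0 hAB
  obtain ⟨a, ha⟩ := a
  refine Subtype.ext ?_
  rw [SuperSub.coe_lie, SuperSub.coe_lie, hhA]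
  have h1 := ha.1
  rw [parityOp, ← fromBlocks_toBlocks a, fromBlocks_multiply, fromBlocks_multiply, fromBlocks_neg,
    fromBlocks_inj] at h1
  obtain ⟨h2, -, -, h3⟩ := h1
  rw [Matrix.zero_mul, add_zero, Matrix.mul_zero, add_zero, Matrix.one_mul, Matrix.mul_one] at h2
  rw [Matrix.zero_mul, zero_add, Matrix.mul_zero, zero_add, Matrix.neg_mul, Matrix.one_mul,
    Matrix.mul_neg, Matrix.mul_one, neg_neg] at h3
  have h4 : a.toBlocks₁₁ = 0 := by
    ext i j
    exact self_eq_neg.1 (congrFun (congrFun h2 i) j)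
  have h5 : a.toBlocks₂₂ = 0 := by
    ext i j
    exact self_eq_neg.1 (congrFun (congrFun h3.symm i) j)
  change _ = a
  simp only
  rw [← fromBlocks_toBlocks a, h4, h5]
  simp only [fromBlocks_multiply, Matrix.mul_zero, Matrix.zero_mul, add_zero, mul_sub,
    sub_mul]
  have h6 : A * (A * a.toBlocks₁₂) = a.toBlocks₁₂ := by
    rw [← Matrix.mul_assoc, hAA, Matrix.one_mul]
  have h7 : a.toBlocks₂₁ * A * A = a.toBlocks₂₁ := by
    rw [Matrix.mul_assoc, hAA, Matrix.mul_one]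
  simp only [add_zero, zero_add, h6, h7, sub_eq_add_neg, fromBlocks_neg, fromBlocks_add, neg_zero, neg_neg]

/-! #### The exceptional family -/

/-- The inclusions of the three factors of the even part of `D(2,1;α)`. -/
def D21.factor : Fin 3 → (SpecialLinear.sl (Fin 2) ℂ →ₗ⁅ℂ⁆ D21Even) :=
  ![LieHom.inl ℂ _ _, (LieHom.inr ℂ _ _).comp (LieHom.inl ℂ _ _),
    (LieHom.inr ℂ _ _).comp (LieHom.inr ℂ _ _)]

theorem D21.factor_isIdealMorphism (i : Fin 3) : (D21.factor i).IsIdealMorphism := by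
  rw [LieHom.isIdealMorphism_iff]
  rintro ⟨x, y, z⟩ w
  fin_cases i
  · exact ⟨⁅x, w⁆, Prod.ext rfl (Prod.ext (lie_zero y) (lie_zero z))⟩
  · exact ⟨⁅y, w⁆, Prod.ext (lie_zero x) (Prod.ext rfl (lie_zero z))⟩
  · exact ⟨⁅z, w⁆, Prod.ext (lie_zero x) (Prod.ext (lie_zero y) rfl)⟩

theorem D21.isSimpleCover : IsSimpleCover fun i => (D21.factor i).idealRange where
  cover := by
    rintro ⟨x, y, z⟩
    refine ⟨0, zero_mem _, fun i => D21.factor i (![x, y, z] i),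
      fun i => LieHom.mem_idealRange _ _, ?_⟩
    rw [Fin.sum_univ_three, zero_add]
    change (x, y, z) = (x, 0, 0) + (0, y, 0) + (0, 0, z)
    simp
  minimal i x hx hx0 J hxJ :=
    hasOnlyTrivialIdeals_sl.idealRange_le (D21.factor_isIdealMorphism i) hx hx0 hxJ

end EvenParts

/-! ### Transfer to the types -/

section Transfer

variable {𝔤₀ 𝔤₁ : Type*} [LieRing 𝔤₀] [LieAlgebra ℂ 𝔤₀]
  [AddCommGroup 𝔤₁] [Module ℂ 𝔤₁] [LieRingModule 𝔤₀ 𝔤₁] [LieModule ℂ 𝔤₀ 𝔤₁]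
  {S : LieSuperalgebra ℂ 𝔤₀ 𝔤₁}

theorem LieSuperalgebra.IsTypeA.exists_isSimpleCover {m n : ℕ} (hS : S.IsTypeA m n) :
    ∃ I : Fin 2 → LieIdeal ℂ 𝔤₀, IsSimpleCover I := by
  obtain ⟨φ₀, -, -, hφ, -⟩ := hS
  exact ⟨_, isSimpleCover_slSuper.map φ₀ hφ⟩

theorem LieSuperalgebra.IsTypeD.exists_isSimpleCover {m n : ℕ} (hS : S.IsTypeD m n)
    (hm : 3 ≤ m) : ∃ I : Fin 2 → LieIdeal ℂ 𝔤₀, IsSimpleCover I := by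
  obtain ⟨φ₀, -, -, hφ, -⟩ := hS
  let e := LieEquiv.ofBijective φ₀ hφ
  refine ⟨_, (isSimpleCover_ospSuper (p := Fin (2 * m)) ?_).map e.symm.toLieHom e.symm.surjective⟩
  rw [Fintype.card_fin]
  omega

theorem LieSuperalgebra.IsTypeD21.exists_isSimpleCover {α : ℂ} (hS : S.IsTypeD21 α) :
    ∃ I : Fin 3 → LieIdeal ℂ 𝔤₀, IsSimpleCover I := by
  obtain ⟨φ₀, -, -, hφ, -⟩ := hS
  let e := LieEquiv.ofBijective φ₀ hφ
  exact ⟨_, D21.isSimpleCover.map e.symm.toLieHom e.symm.surjective⟩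

/-- An ideal of the even part that is at most three-dimensional and acts on the odd part by copies
of the two-dimensional representation of `sl₂`. -/
structure LieSuperalgebra.IsSpinIdeal (𝔤₁ : Type*) [AddCommGroup 𝔤₁] [LieRingModule 𝔤₀ 𝔤₁]
    (J : LieIdeal ℂ 𝔤₀) : Prop where
  finrank_le : finrank ℂ J ≤ 3
  lie_lie : ∀ h ∈ J, ∀ e ∈ J, e ≠ 0 → ⁅h, e⁆ = (2 : ℂ) • e → ∀ a : 𝔤₁, ⁅h, ⁅h, a⁆⁆ = a

theorem LieSuperalgebra.IsTypeD.exists_isSpinIdeal {n : ℕ} (hS : S.IsTypeD 2 n) :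
    ∃ I : Fin 3 → LieIdeal ℂ 𝔤₀, IsSimpleCover I ∧ IsSpinIdeal 𝔤₁ (I 0) := by
  obtain ⟨φ₀, φ₁, hom, hφ, hφ₁⟩ := hS
  let e := LieEquiv.ofBijective φ₀ hφ
  have hsymm : Function.Surjective e.symm.toLieHom := e.symm.surjective
  have hcover : IsSimpleCover (ospFourIdeals (Fin n)) := isSimpleCover_ospFour
  refine ⟨_, hcover.map e.symm.toLieHom hsymm, ⟨?_, fun h hh x hx hx0 hhx a => ?_⟩⟩
  · have h1 := LieIdeal.coe_map_of_surjective (I := ospFourIdeals (Fin n) 0) hsymm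
    change finrank ℂ (LieSubmodule.toSubmodule
      ((ospFourIdeals (Fin n) 0).map e.symm.toLieHom)) ≤ 3
    rw [h1]
    exact (Submodule.finrank_map_le _ _).trans finrank_ospFourIdeals_zero_le
  · have hφe : ∀ y, φ₀ (e.symm.toLieHom y) = y := fun y => e.apply_symm_apply y
    obtain ⟨h, rfl⟩ := LieIdeal.mem_map_of_surjective hsymm hh
    obtain ⟨x, rfl⟩ := LieIdeal.mem_map_of_surjective hsymm hx
    apply hφ₁.1
    rw [hom.map_lie, hom.map_lie, hφe]
    refine ospFourIdeals_zero_lie_lie h.2 x.2 (fun h0 => hx0 (by rw [h0, map_zero])) ?_ _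
    have h1 := congrArg φ₀ hhx
    rwa [LieHom.map_lie, map_smul, hφe, hφe] at h1

end Transfer

/-! ### Roots inside and outside a given ideal -/

section SpinIdeals

variable {L : Type*} [LieRing L] [LieAlgebra ℂ L] {𝔥 : LieSubalgebra ℂ L} [𝔥.IsCartanSubalgebra]
  {h : Dual ℂ 𝔥 → 𝔥}

namespace EvenRootData

theorem coroot_lie (D : EvenRootData 𝔥 h) {α : Dual ℂ 𝔥} (hα : α ∈ evenRoots 𝔥) {e : L}
    (he : e ∈ weightSpace L (α : 𝔥 → ℂ)) : ⁅(h α : L), e⁆ = (2 : ℂ) • e := by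
  have h1 := (mem_weightSpace _ _).1 he (h α)
  rwa [LieSubalgebra.coe_bracket_of_module, D.apply_coroot_self hα] at h1

theorem coroot_mem (D : EvenRootData 𝔥 h) {I : LieIdeal ℂ L} {α : Dual ℂ 𝔥}
    (hα : α ∈ evenRoots 𝔥) {e : L} (he : e ∈ weightSpace L (α : 𝔥 → ℂ)) (he0 : e ≠ 0)
    (heI : e ∈ I) : (h α : L) ∈ I := by
  obtain ⟨x, hx, y, -, -, -, hxy, -⟩ := D.exists_sign_ne_zero hα
  obtain ⟨c, rfl⟩ := D.proportional α hα e he x hx he0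
  rw [← hxy]
  exact lie_mem_left ℂ L I _ _ (I.smul_mem c heI)

omit [𝔥.IsCartanSubalgebra] in
theorem mem_of_apply_ne_zero {I : LieIdeal ℂ L} {β : Dual ℂ 𝔥} {H : 𝔥}
    (hHI : (H : L) ∈ I) (hβ : β H ≠ 0) {e : L} (he : e ∈ weightSpace L (β : 𝔥 → ℂ)) :
    e ∈ I := by
  have h1 := (mem_weightSpace _ _).1 he H
  rw [LieSubalgebra.coe_bracket_of_module] at h1
  rw [← inv_smul_smul₀ hβ e, ← h1]
  exact I.smul_mem _ (lie_mem_left ℂ L I _ _ hHI)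

/-- An ideal that does not contain a root space centralizes it. -/
theorem lie_eq_zero_of_notMem (D : EvenRootData 𝔥 h) [FiniteDimensional ℂ L] {I : LieIdeal ℂ L}
    {α : Dual ℂ 𝔥} (hα : α ∈ evenRoots 𝔥) {e : L} (he : e ∈ weightSpace L (α : 𝔥 → ℂ))
    (heI : e ∉ I) {y : L} (hy : y ∈ I) : ⁅y, e⁆ = 0 := by
  have he0 : e ≠ 0 := by rintro rfl; exact heI (zero_mem _)
  let K : Submodule ℂ L :=
    { carrier := {y | ⁅y, e⁆ = 0}
      add_mem' := fun {a b} ha hb => by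
        change ⁅a + b, e⁆ = 0
        rw [add_lie, show ⁅a, e⁆ = 0 from ha, show ⁅b, e⁆ = 0 from hb, add_zero]
      zero_mem' := zero_lie e
      smul_mem' := fun c a ha => by
        change ⁅c • a, e⁆ = 0
        rw [smul_lie, show ⁅a, e⁆ = 0 from ha, smul_zero] }
  -- The ideal is the sum of its intersections with `𝔥` and with the root spaces, so it suffices to
  -- treat these pieces.
  have hI := congrArg LieSubmodule.toSubmodule
    (lieIdeal_eq_inf_cartan_sup_biSup_inf_rootSpace (K := ℂ) 𝔥 I)
  have hIK : (I.restr 𝔥).toSubmodule ≤ K := by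
    rw [hI]
    simp only [LieSubmodule.sup_toSubmodule, LieSubmodule.iSup_toSubmodule]
    refine sup_le (fun x hx => ?_) (iSup₂_le fun χ hχ x hx => ?_)
    · have hxI : x ∈ I := hx.1
      have hx𝔥 : x ∈ 𝔥 := hx.2
      have h1 : ⁅x, e⁆ = α ⟨x, hx𝔥⟩ • e := (mem_weightSpace _ _).1 he ⟨x, hx𝔥⟩
      change ⁅x, e⁆ = 0
      by_contra h2
      rw [h1] at h2
      exact heI (mem_of_apply_ne_zero (H := ⟨x, hx𝔥⟩) hxI (left_ne_zero_of_smul h2) he)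
    · have hxI : x ∈ I := hx.1
      have hχ0 : χ.toLinear ≠ 0 := fun h0 => hχ (by
        funext H
        exact LinearMap.congr_fun h0 H)
      have hxw := D.genWeightSpace_le χ.toLinear hχ0 hx.2
      change ⁅x, e⁆ = 0
      by_contra h2
      have hx0 : x ≠ 0 := by rintro rfl; exact h2 (zero_lie e)
      have hβ : χ.toLinear ∈ evenRoots 𝔥 :=
        ⟨hχ0, LieSubmodule.ne_bot_iff_exists.2 ⟨x, hxw, hx0⟩⟩
      set β : Dual ℂ 𝔥 := χ.toLinear
      by_cases hsum : β + α = 0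
      -- If `β = -α`, the coroot of `β` lies in the ideal and acts on `e` by `-2`, which would put
      -- `e` into the ideal.
      · refine heI (mem_of_apply_ne_zero (D.coroot_mem hβ hxw hx0 hxI) ?_ he)
        rw [eq_neg_of_add_eq_zero_right hsum, LinearMap.neg_apply, D.apply_coroot_self hβ]
        norm_num
      · have hsum' : β + α ∈ evenRoots 𝔥 := by
          by_contra h3
          exact h2 (lie_eq_zero_of_add_notMem hsum h3 hxw he)
        have hw := lie_mem_weightSpace_add hxw he
        -- Otherwise bracket back with a root vector for `-β`: the result is a nonzero element of
        -- the ideal in the root space of `α`, hence proportional to `e`.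
        obtain ⟨z, hz, hz0⟩ := LieSubmodule.ne_bot_iff_exists.1 (D.neg_mem β hβ).2
        have hα' : -β + (β + α) = α := by abel
        have h3 := lie_mem_weightSpace_add hz hw
        have h4 := D.lie_ne_zero _ (D.neg_mem β hβ) _ hsum' (by rwa [hα']) z hz _ hw hz0 h2
        rw [hα'] at h3
        obtain ⟨c, hc⟩ := D.proportional α hα _ h3 e he h4
        refine heI ?_
        rw [hc]
        exact I.smul_mem c (lie_mem_right ℂ L I _ _ (lie_mem_left ℂ L I _ _ hxI))
  exact hIK hy

/-- The coroot of a root of an ideal of dimension three annihilates all other roots. -/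
theorem apply_coroot_eq_zero_of_finrank_le (D : EvenRootData 𝔥 h) [FiniteDimensional ℂ L]
    {I : LieIdeal ℂ L} (hI : finrank ℂ I ≤ 3) {α β : Dual ℂ 𝔥} (hα : α ∈ evenRoots 𝔥)
    (hβ : β ∈ evenRoots 𝔥) (hαI : ∀ e ∈ weightSpace L (α : 𝔥 → ℂ), e ∈ I) (hβα : β ≠ α)
    (hβα' : β ≠ -α) : β (h α) = 0 := by
  by_contra h0
  obtain ⟨x, hx, y, hy, hx0, hy0, -, h1⟩ := D.exists_sign_ne_zero hα
  obtain ⟨z, hz, hz0⟩ := LieSubmodule.ne_bot_iff_exists.1 hβ.2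
  have hhI := D.coroot_mem hα hx hx0 (hαI x hx)
  have hyI : y ∈ I := mem_of_apply_ne_zero hhI (by
    rw [LinearMap.neg_apply, D.apply_coroot_self hα]
    norm_num) hy
  have hzI : z ∈ I := mem_of_apply_ne_zero hhI h0 hz
  have hα2 : α ≠ -α := fun h2 => by
    have h3 := LinearMap.congr_fun h2 (h α)
    rw [LinearMap.neg_apply, D.apply_coroot_self hα] at h3
    norm_num at h3
  -- If `β` did not vanish at the coroot, the ideal would contain nonzero vectors of the four
  -- different weights `α`, `-α`, `0`, `β`, too many for dimension three.
  let w : Fin 4 → Dual ℂ 𝔥 := ![α, -α, 0, β]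
  have hw : Function.Injective w := by
    intro i j hij
    fin_cases i <;> fin_cases j <;> simp [w] at hij ⊢
    · exact hα2 hij
    · exact hα.1 hij
    · exact hβα hij.symm
    · exact hα2 hij.symm
    · exact hα.1 hij
    · exact hβα' hij.symm
    · exact hα.1 hij.symm
    · exact hα.1 hij
    · exact hβ.1 hij.symm
    · exact hβα hij
    · exact hβα' hij
    · exact hβ.1 hij
  let v : Fin 4 → I := ![⟨x, hαI x hx⟩, ⟨y, hyI⟩, ⟨h α, hhI⟩, ⟨z, hzI⟩]
  have hind := iSupIndep.linearIndependent _ ((LieSubmodule.iSupIndep_toSubmodule.2 (iSupIndep_genWeightSpace ℂ 𝔥 L)).comp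
    (DFunLike.coe_injective.comp hw)) (v := fun i => (v i : L)) (fun i => by
      fin_cases i
      · exact weightSpace_le_genWeightSpace L _ hx
      · exact weightSpace_le_genWeightSpace L _ hy
      · change (h α : L) ∈ genWeightSpace L (0 : 𝔥 → ℂ)
        exact (rootSpace_zero_eq ℂ L 𝔥).ge (h α).2
      · exact weightSpace_le_genWeightSpace L _ hz) (fun i => by
      fin_cases i
      · exact hx0
      · exact hy0
      · exact h1
      · exact hz0)
  have h2 := (LinearIndependent.of_comp I.toSubmodule.subtype hind).fintype_card_le_finrank
  rw [Fintype.card_fin] at h2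
  exact absurd (h2.trans hI) (by norm_num)

end EvenRootData

end SpinIdeals

namespace LieSuperalgebra

/-! ### Weights of the even part as sums of odd weights -/

section OddWeights

variable {𝔤₀ 𝔤₁ : Type*} [LieRing 𝔤₀] [LieAlgebra ℂ 𝔤₀]
  [AddCommGroup 𝔤₁] [Module ℂ 𝔤₁] [LieRingModule 𝔤₀ 𝔤₁] [LieModule ℂ 𝔤₀ 𝔤₁]

/-- The brackets of odd elements together with the whole odd part form a graded ideal, which is not
zero. -/
theorem span_odd_eq_top {S : LieSuperalgebra ℂ 𝔤₀ 𝔤₁} (hS : S.IsSimple) [Nontrivial 𝔤₁] :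
    Submodule.span ℂ {x | ∃ a b, S.odd a b = x} = ⊤ := by
  have hideal : S.IsGradedIdeal (Submodule.span ℂ {x | ∃ a b, S.odd a b = x}) ⊤ := by
    refine ⟨fun x y hy => ?_, fun _ _ _ => trivial, fun _ _ _ => trivial,
      fun a b _ => Submodule.subset_span ⟨a, b, rfl⟩⟩
    induction hy using Submodule.span_induction with
    | mem y hy =>
      obtain ⟨a, b, rfl⟩ := hy
      rw [S.lie_odd]
      exact add_mem (Submodule.subset_span ⟨_, _, rfl⟩) (Submodule.subset_span ⟨_, _, rfl⟩)
    | zero => rw [lie_zero]; exact zero_mem _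
    | add y z _ _ hy hz => rw [lie_add]; exact add_mem hy hz
    | smul c y _ hy => rw [lie_smul]; exact Submodule.smul_mem _ c hy
  rcases hS.eq_bot_or_eq_top _ _ hideal with h1 | h1
  · exact absurd h1.2 top_ne_bot
  · exact h1.1

variable {𝔥 : LieSubalgebra ℂ 𝔤₀} [LieRing.IsNilpotent 𝔥]

theorem odd_mem_genWeightSpace (S : LieSuperalgebra ℂ 𝔤₀ 𝔤₁) {χ ψ : 𝔥 → ℂ} {a b : 𝔤₁}
    (ha : a ∈ genWeightSpace 𝔤₁ χ) (hb : b ∈ genWeightSpace 𝔤₁ ψ) :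
    S.odd a b ∈ genWeightSpace 𝔤₀ (χ + ψ) := by
  let g : 𝔤₁ →ₗ⁅ℂ,𝔥⁆ 𝔤₁ →ₗ[ℂ] 𝔤₀ :=
    { S.odd with
      map_lie' := fun {x m} => by
        ext n
        have h1 := S.lie_odd x m n
        change S.odd ⁅(x : 𝔤₀), m⁆ n = ⁅(x : 𝔤₀), S.odd m n⁆ - S.odd m ⁅(x : 𝔤₀), n⁆
        rw [h1, add_sub_cancel_right] }
  simp only [genWeightSpace, LieSubmodule.mem_iInf] at ha hb ⊢
  intro x
  refine LieModule.weight_vector_multiplication 𝔤₁ 𝔤₁ 𝔤₀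
    (TensorProduct.LieModule.liftLie ℂ 𝔥 𝔤₁ 𝔤₁ 𝔤₀ g) (χ x) (ψ x) x ?_
  refine ⟨⟨a, ha x⟩ ⊗ₜ ⟨b, hb x⟩, ?_⟩
  rw [LinearMap.comp_apply]
  exact TensorProduct.LieModule.liftLie_apply ℂ 𝔥 𝔤₁ 𝔤₁ 𝔤₀ g a b

/-- Every weight of the even part is the sum of two weights of the odd part. -/
theorem exists_weight_add_eq [FiniteDimensional ℂ 𝔤₁] {S : LieSuperalgebra ℂ 𝔤₀ 𝔤₁}
    (hS : S.IsSimple) [Nontrivial 𝔤₁] {α : 𝔥 → ℂ} (hα : genWeightSpace 𝔤₀ α ≠ ⊥) :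
    ∃ χ ψ : Weight ℂ 𝔥 𝔤₁, (χ : 𝔥 → ℂ) + (ψ : 𝔥 → ℂ) = α := by
  by_contra! hne
  -- If no two odd weights add up to `α`, all brackets of odd elements lie in the sum of the other
  -- generalized weight spaces. These brackets span `𝔤₀`, so the space for `α` would be zero.
  have hdisj := iSupIndep_genWeightSpace ℂ 𝔥 𝔤₀ α
  refine hα (disjoint_self.1 (hdisj.mono_right ?_))
  refine le_top.trans ?_
  rw [← LieSubmodule.toSubmodule_le_toSubmodule, LieSubmodule.top_toSubmodule,
    ← span_odd_eq_top hS, Submodule.span_le]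
  rintro _ ⟨a, b, rfl⟩
  set W := ⨆ j, ⨆ (_ : j ≠ α), genWeightSpace 𝔤₀ j
  have htop := iSup_genWeightSpace_eq_top' ℂ 𝔥 𝔤₁
  have ha : a ∈ ⨆ χ : Weight ℂ 𝔥 𝔤₁, genWeightSpace 𝔤₁ χ := by rw [htop]; trivial
  have hb : b ∈ ⨆ χ : Weight ℂ 𝔥 𝔤₁, genWeightSpace 𝔤₁ χ := by rw [htop]; trivial
  change S.odd a b ∈ W
  induction ha using LieSubmodule.iSup_induction' with
  | zero => rw [map_zero, LinearMap.zero_apply]; exact zero_mem _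
  | add x y _ _ hx hy => rw [map_add, LinearMap.add_apply]; exact add_mem hx hy
  | mem χ x hx =>
    induction hb using LieSubmodule.iSup_induction' with
    | zero => rw [map_zero]; exact zero_mem _
    | add y z _ _ hy hz => rw [map_add]; exact add_mem hy hz
    | mem ψ y hy =>
      have hle : genWeightSpace 𝔤₀ ((χ : 𝔥 → ℂ) + (ψ : 𝔥 → ℂ)) ≤ W :=
        le_iSup₂_of_le (f := fun j (_ : j ≠ α) => genWeightSpace 𝔤₀ j) _ (hne χ ψ) le_rfl
      exact hle (odd_mem_genWeightSpace S hx hy)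

end OddWeights

end LieSuperalgebra

namespace LieSuperalgebra

/-! ### Removing an even root from the simple system in type `D(2,n)` -/

section SpinRoots

variable {𝔤₀ 𝔤₁ : Type*} [LieRing 𝔤₀] [LieAlgebra ℂ 𝔤₀]
  [AddCommGroup 𝔤₁] [Module ℂ 𝔤₁] [LieRingModule 𝔤₀ 𝔤₁] [LieModule ℂ 𝔤₀ 𝔤₁]
  [FiniteDimensional ℂ 𝔤₀] [FiniteDimensional ℂ 𝔤₁] {S : LieSuperalgebra ℂ 𝔤₀ 𝔤₁}
  {𝔥 : LieSubalgebra ℂ 𝔤₀} [𝔥.IsCartanSubalgebra] {h : Dual ℂ 𝔥 → 𝔥}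

omit [FiniteDimensional ℂ 𝔤₀] [FiniteDimensional ℂ 𝔤₁] [𝔥.IsCartanSubalgebra] in
theorem mul_self_eq_one_of_lie_lie {H : 𝔥} (hH : ∀ a : 𝔤₁, ⁅(H : 𝔤₀), ⁅(H : 𝔤₀), a⁆⁆ = a)
    {a : 𝔤₁} (ha0 : a ≠ 0) {c : ℂ} (ha : ⁅(H : 𝔤₀), a⁆ = c • a) : c * c = 1 := by
  have h1 := hH a
  rw [ha, lie_smul, ha, smul_smul] at h1
  exact smul_left_injective ℂ ha0 (h1.trans (one_smul ℂ a).symm)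

omit [FiniteDimensional ℂ 𝔤₀] [FiniteDimensional ℂ 𝔤₁] [𝔥.IsCartanSubalgebra] in
theorem apply_mul_self_eq_one_of_mem_oddRoots {H : 𝔥}
    (hH : ∀ a : 𝔤₁, ⁅(H : 𝔤₀), ⁅(H : 𝔤₀), a⁆⁆ = a) {β : Dual ℂ 𝔥} (hβ : β ∈ oddRoots 𝔤₁ 𝔥) :
    β H * β H = 1 := by
  obtain ⟨a, ha, ha0⟩ := LieSubmodule.ne_bot_iff_exists.1 hβ.2
  exact mul_self_eq_one_of_lie_lie hH ha0 ((mem_weightSpace _ _).1 ha H)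

omit [FiniteDimensional ℂ 𝔤₀] in
/-- An even root whose coroot has the eigenvalues `±1` on the odd part is the sum of two odd roots
that take the value `1` at the coroot. -/
theorem exists_oddRoots_add_eq (hS : S.IsSimple) [Nontrivial 𝔤₁] {α : Dual ℂ 𝔥}
    (hα : α ∈ evenRoots 𝔥) {H : 𝔥} (hαH : α H = 2)
    (hH : ∀ a : 𝔤₁, ⁅(H : 𝔤₀), ⁅(H : 𝔤₀), a⁆⁆ = a) :
    ∃ β ∈ oddRoots 𝔤₁ 𝔥, ∃ γ ∈ oddRoots 𝔤₁ 𝔥, α = β + γ ∧ β H = 1 ∧ γ H = 1 := by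
  have hα0 : genWeightSpace 𝔤₀ (α : 𝔥 → ℂ) ≠ ⊥ := fun h0 =>
    hα.2 (le_bot_iff.1 ((weightSpace_le_genWeightSpace 𝔤₀ (α : 𝔥 → ℂ)).trans h0.le))
  obtain ⟨χ, ψ, hχψ⟩ := exists_weight_add_eq hS hα0
  have hsq : ∀ χ : Weight ℂ 𝔥 𝔤₁, χ H = 1 ∨ χ H = -1 := by
    intro χ
    obtain ⟨a, ha0, ha⟩ := exists_forall_lie_eq_smul ℂ 𝔥 𝔤₁ χ
    exact mul_self_eq_one_iff.1 (mul_self_eq_one_of_lie_lie hH ha0 (ha H))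
  have hsum : χ H + ψ H = 2 := (congrFun hχψ H).trans hαH
  have hroot : ∀ χ : Weight ℂ 𝔥 𝔤₁, χ H = 1 → χ.toLinear ∈ oddRoots 𝔤₁ 𝔥 := by
    intro χ hχ
    refine ⟨fun h0 => ?_, LieSubmodule.ne_bot_iff_exists.2 ?_⟩
    · have h1 := LinearMap.congr_fun h0 H
      rw [Weight.toLinear_apply, hχ, LinearMap.zero_apply] at h1
      exact one_ne_zero h1
    · obtain ⟨a, ha0, ha⟩ := exists_forall_lie_eq_smul ℂ 𝔥 𝔤₁ χ
      exact ⟨a, (mem_weightSpace _ _).2 ha, ha0⟩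
  -- Two signs with sum `2` are both `1`. In particular neither weight is zero, so both are odd
  -- roots.
  have hval : χ H = 1 ∧ ψ H = 1 := by
    rcases hsq χ with h1 | h1 <;> rcases hsq ψ with h2 | h2 <;> rw [h1, h2] at hsum
    · exact ⟨h1, h2⟩
    all_goals norm_num at hsum
  refine ⟨χ.toLinear, hroot χ hval.1, ψ.toLinear, hroot ψ hval.2, ?_, hval.1, hval.2⟩
  ext K
  exact (congrFun hχψ K).symm

omit [FiniteDimensional ℂ 𝔤₀] in
theorem eq_of_samePart_of_isolated (D : EvenRootData 𝔥 h) {P : Set (Dual ℂ 𝔥)} {α β : Dual ℂ 𝔥}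
    (hα : α ∈ evenSimple 𝔥 P) (hiso : ∀ γ ∈ evenSimple 𝔥 P, γ ≠ α → γ (h α) = 0)
    (hαβ : SamePart 𝔥 P α β) : α = β := by
  induction hαβ with
  | refl => rfl
  | @tail γ δ _ h1 h2 =>
    subst h2
    obtain ⟨-, hδ, H, hH, hne⟩ := h1
    rw [D.coroot_unique α hα.1.2 H hH] at hne
    by_contra h3
    exact hne (hiso δ hδ fun h4 => h3 h4.symm)

omit [𝔥.IsCartanSubalgebra] [FiniteDimensional ℂ 𝔤₁] [FiniteDimensional ℂ 𝔤₀] in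
-- Without odd part a graded ideal is just an ideal of `𝔤₀`. This settles the degenerate case in
-- which `𝔤₁` vanishes.
theorem isSimpleCover_top_of_subsingleton (hS : S.IsSimple) [Subsingleton 𝔤₁] :
    IsSimpleCover fun _ : Fin 1 => (⊤ : LieIdeal ℂ 𝔤₀) where
  cover x := ⟨0, zero_mem _, fun _ => x, fun _ => trivial, by simp⟩
  minimal _ x _ hx0 J hxJ := by
    have hideal : S.IsGradedIdeal J.toSubmodule ⊥ :=
      ⟨fun x y hy => lie_mem_right ℂ 𝔤₀ J x y hy, fun _ _ _ => Subsingleton.elim _ (0 : 𝔤₁),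
        fun _ _ _ => Subsingleton.elim _ (0 : 𝔤₁), fun a b _ => by
          rw [Subsingleton.elim a 0, map_zero, LinearMap.zero_apply]; exact zero_mem _⟩
    rcases hS.eq_bot_or_eq_top _ _ hideal with h1 | h1
    · have h2 : x ∈ J.toSubmodule := hxJ
      rw [h1.1] at h2
      exact absurd h2 hx0
    · intro y _
      have h2 : y ∈ J.toSubmodule := by rw [h1.1]; trivial
      exact h2

/-- For type `D(2,n)` the functional can be changed, without a change of the positive even roots, so
that at most two simple roots are even, in different even parts. -/
theorem IsTypeD.exists_functional {n : ℕ} (hD : S.IsTypeD 2 n) (hS : S.IsSimple)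
    (D : EvenRootData 𝔥 h) {f : Dual ℂ 𝔥 →ₗ[ℝ] ℝ} (hf : ∀ α ∈ evenRoots 𝔥, f α ≠ 0)
    (hf₁ : ∀ α ∈ oddRoots 𝔤₁ 𝔥, f α ≠ 0) :
    ∃ g : Dual ℂ 𝔥 →ₗ[ℝ] ℝ, (∀ α ∈ evenRoots 𝔥, 0 < g α ↔ 0 < f α) ∧
      (∀ α ∈ evenRoots 𝔥 ∪ oddRoots 𝔤₁ 𝔥, g α ≠ 0) ∧
      ∀ P, P = {α | α ∈ evenRoots 𝔥 ∪ oddRoots 𝔤₁ 𝔥 ∧ 0 < g α} → ∀ F ⊆ evenSimple 𝔥 P,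
        (∀ α ∈ F, ∀ β ∈ F, SamePart 𝔥 P α β → α = β) → (F ∩ simpleSystem P).encard ≤ 2 := by
  have hmem : ∀ g : Dual ℂ 𝔥 →ₗ[ℝ] ℝ, (∀ α ∈ evenRoots 𝔥, 0 < g α ↔ 0 < f α) →
      ∀ P, P = {α | α ∈ evenRoots 𝔥 ∪ oddRoots 𝔤₁ 𝔥 ∧ 0 < g α} →
      ∀ α ∈ evenRoots 𝔥, α ∈ P ↔ 0 < f α := by
    rintro g hg P rfl α hα
    rw [← hg α hα]
    exact ⟨fun h1 => h1.2, fun h1 => ⟨Or.inl hα, h1⟩⟩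
  have hne : ∀ α ∈ evenRoots 𝔥 ∪ oddRoots 𝔤₁ 𝔥, f α ≠ 0 := fun α hα => hα.elim (hf α) (hf₁ α)
  rcases subsingleton_or_nontrivial 𝔤₁ with hsub | hnon
  · refine ⟨f, fun _ _ => Iff.rfl, hne, fun P hP F hF hFS => ?_⟩
    refine (Set.encard_le_encard Set.inter_subset_left).trans
      ((D.encard_le_of_not_samePart hf (hmem f (fun _ _ => Iff.rfl) P hP)
        (isSimpleCover_top_of_subsingleton hS) hF hFS).trans ?_)
    norm_num
  obtain ⟨I, hI, hspin⟩ := hD.exists_isSpinIdeal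
  by_cases hex : ∃ α ∈ IsRootSet.simpleRoots (evenRoots 𝔥) f,
      ∀ e ∈ weightSpace 𝔤₀ (α : 𝔥 → ℂ), e ∈ I 0
  · obtain ⟨α, hα, hαI⟩ := hex
    have hαΔ : α ∈ evenRoots 𝔥 := hα.1.1
    have hfα : 0 < f α := hα.1.2
    have hiso : ∀ β ∈ evenRoots 𝔥, β ≠ α → β ≠ -α → β (h α) = 0 := fun β hβ =>
      D.apply_coroot_eq_zero_of_finrank_le hspin.finrank_le hαΔ hβ hαI
    have hαα := D.apply_coroot_self hαΔ
    obtain ⟨e, he, -, -, he0, -, -, -⟩ := D.exists_sign_ne_zero hαΔ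
    have hH : ∀ a : 𝔤₁, ⁅(h α : 𝔤₀), ⁅(h α : 𝔤₀), a⁆⁆ = a :=
      hspin.lie_lie _ (D.coroot_mem hαΔ he he0 (hαI e he)) e (hαI e he) he0 (D.coroot_lie hαΔ he)
    -- Even roots other than `±α` vanish at the coroot, so they keep their signs, and so does `α`.
    -- Odd roots take the values `±1` there, and this value decides their new sign.
    obtain ⟨K, hK⟩ := exists_lexicographic_scale (D.finite.union (finite_oddRoots (𝔤₁ := 𝔤₁) 𝔥))
      (evalRe (h α)) f
    have hgα : 0 < K * evalRe (h α) α + f α := (hK α (Or.inl hαΔ)).1 (by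
      rw [evalRe_apply, hαα]; norm_num)
    have heven : ∀ β ∈ evenRoots 𝔥, (0 < K * evalRe (h α) β + f β ↔ 0 < f β) ∧
        K * evalRe (h α) β + f β ≠ 0 := by
      intro β hβ
      by_cases h1 : β = α
      · rw [h1]
        exact ⟨iff_of_true hgα hfα, hgα.ne'⟩
      by_cases h2 : β = -α
      · rw [h2, map_neg, map_neg]
        exact ⟨iff_of_false (by linarith) (by linarith), by linarith⟩
      · rw [evalRe_apply, hiso β hβ h1 h2, Complex.zero_re, mul_zero, zero_add]
        exact ⟨Iff.rfl, hf β hβ⟩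
    have hodd : ∀ β ∈ oddRoots 𝔤₁ 𝔥, K * evalRe (h α) β + f β ≠ 0 := by
      intro β hβ
      rcases mul_self_eq_one_iff.1 (apply_mul_self_eq_one_of_mem_oddRoots hH hβ) with h1 | h1
      · exact ((hK β (Or.inr hβ)).1 (by rw [evalRe_apply, h1]; norm_num)).ne'
      · exact ((hK β (Or.inr hβ)).2 (by rw [evalRe_apply, h1]; norm_num)).ne
    refine ⟨K • evalRe (h α) + f, fun β hβ => (heven β hβ).1,
      fun β hβ => hβ.elim (fun h1 => (heven β h1).2) (hodd β), fun P hP F hF hFS => ?_⟩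
    have hPf := hmem _ (fun β hβ => (heven β hβ).1) P hP
    have hαP : α ∈ evenSimple 𝔥 P := by rwa [evenSimple_eq hPf]
    -- Two odd roots with value `1` at the coroot add up to `α`, and both have become positive.
    have hnot : α ∉ simpleSystem P := by
      obtain ⟨β, hβ, γ, hγ, hβγ, hβ1, hγ1⟩ := exists_oddRoots_add_eq hS hαΔ hαα hH
      intro h1
      have hpos : ∀ δ ∈ oddRoots 𝔤₁ 𝔥, δ (h α) = 1 → δ ∈ P := by
        intro δ hδ hδ1
        rw [hP]
        exact ⟨Or.inr hδ, (hK δ (Or.inr hδ)).1 (by rw [evalRe_apply, hδ1]; norm_num)⟩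
      exact h1.2 β (hpos β hβ hβ1) γ (hpos γ hγ hγ1) hβγ
    have hisoP : ∀ γ ∈ evenSimple 𝔥 P, γ ≠ α → γ (h α) = 0 := by
      intro γ hγ h1
      refine hiso γ hγ.1.2 h1 ?_
      rintro rfl
      have h2 := (hPf _ hγ.1.2).1 hγ.1.1
      rw [map_neg] at h2
      linarith
    have hsub : F ∩ simpleSystem P ⊆ F \ {α} := fun β hβ => ⟨hβ.1, fun h1 => hnot (by
      rw [← Set.mem_singleton_iff.1 h1]; exact hβ.2)⟩
    -- The root `α` is a part by itself, so it can be added to `F` without putting two elements in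
    -- one part. Three ideals then leave room for at most two elements besides `α`.
    have h3 : (insert α (F \ {α})).encard ≤ 3 := by
      refine D.encard_le_of_not_samePart hf hPf hI ?_ ?_
      · rintro β (rfl | hβ)
        · exact hαP
        · exact hF hβ.1
      · rintro β (rfl | hβ) γ (rfl | hγ) hβγ
        · rfl
        · exact eq_of_samePart_of_isolated D hαP hisoP hβγ
        · exact (eq_of_samePart_of_isolated D hαP hisoP (D.samePart_symm hβγ)).symm
        · exact hFS β hβ.1 γ hγ.1 hβγ
    rw [Set.encard_insert_of_notMem (fun h1 => h1.2 rfl)] at h3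
    refine (Set.encard_le_encard hsub).trans ?_
    rw [show (3 : ℕ∞) = 2 + 1 from rfl] at h3
    exact (ENat.add_le_add_iff_right (by simp)).1 h3
  -- Now no simple root space lies in `I 0`, so this ideal centralizes all of them and only the
  -- other two ideals count.
  · push Not at hex
    refine ⟨f, fun _ _ => Iff.rfl, hne, fun P hP F hF hFS => ?_⟩
    have hPf := hmem f (fun _ _ => Iff.rfl) P hP
    refine (Set.encard_le_encard Set.inter_subset_left).trans
      ((D.encard_le_card_of_not_samePart hf hPf hI hF hFS {1, 2} ?_).trans ?_)
    · intro i hi α hα e he y hy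
      obtain rfl : i = 0 := by fin_cases i <;> simp_all
      have hαS := hF hα
      obtain ⟨x, hx, hxI⟩ := hex α (by rwa [evenSimple_eq hPf] at hαS)
      have hx0 : x ≠ 0 := by rintro rfl; exact hxI (zero_mem _)
      obtain ⟨c, rfl⟩ := D.proportional α hαS.1.2 x hx e he hx0
      rw [lie_smul, D.lie_eq_zero_of_notMem hαS.1.2 hx hxI hy, smul_zero]
    · simp

end SpinRoots

end LieSuperalgebra

end

/-! ### The theorem -/

theorem mainTheorem1 {𝔤₀ 𝔤₁ : Type*} [LieRing 𝔤₀] [LieAlgebra ℂ 𝔤₀]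
    [AddCommGroup 𝔤₁] [Module ℂ 𝔤₁] [LieRingModule 𝔤₀ 𝔤₁] [LieModule ℂ 𝔤₀ 𝔤₁]
    [FiniteDimensional ℂ 𝔤₀] [FiniteDimensional ℂ 𝔤₁]
    (S : LieSuperalgebra ℂ 𝔤₀ 𝔤₁) (hS : S.IsBasic)
    (C : S.RealForm) (θ : 𝔤₀ →ₗ⁅ℂ⁆ 𝔤₀) (hθ : C.IsCartanInvolution θ)
    (𝔥 : LieSubalgebra ℂ 𝔤₀) (P : Set (Module.Dual ℂ 𝔥)) (hP : C.IsTriple θ 𝔥 P) :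
    ∃ P' : Set (Module.Dual ℂ 𝔥), C.IsTriple θ 𝔥 P' ∧
      (∀ m n : ℕ, S.IsTypeA m n → (LieSuperalgebra.painted θ 𝔥 P').encard ≤ 2) ∧
      (∀ m n : ℕ, 3 ≤ m → S.IsTypeD m n → (LieSuperalgebra.painted θ 𝔥 P').encard ≤ 2) ∧
      (∀ n : ℕ, S.IsTypeD 2 n → (LieSuperalgebra.painted θ 𝔥 P').encard ≤ 3 ∧
        (LieSuperalgebra.painted θ 𝔥 P' ∩ LieSuperalgebra.simpleSystem P').encard ≤ 2) ∧
      (∀ a : ℂ, a ≠ 0 → a ≠ -1 → S.IsTypeD21 a →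
        (LieSuperalgebra.painted θ 𝔥 P').encard ≤ 3) ∧
      (LieSuperalgebra.TrivialAutomorphism θ 𝔥 P' →
        (∀ α ∈ LieSuperalgebra.painted θ 𝔥 P', ∀ β ∈ LieSuperalgebra.painted θ 𝔥 P',
          LieSuperalgebra.SamePart 𝔥 P' α β → α = β) ∧
        ∀ (ε : Module.Dual ℂ 𝔥 → ℝ) (B : LinearMap.BilinForm ℝ (Module.Dual ℂ 𝔥))
          (ω : Module.Dual ℂ 𝔥 → Module.Dual ℂ 𝔥),
          LieSuperalgebra.IsNormalizedDualBasis 𝔥 P' ε B ω →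
          ∀ α ∈ LieSuperalgebra.painted θ 𝔥 P', ∀ β ∈ LieSuperalgebra.evenSimple 𝔥 P',
            LieSuperalgebra.SamePart 𝔥 P' α β → ¬ 0 < B (ω α - ω β) (ω β)) := by
  have hcartan : 𝔥.IsCartanSubalgebra := hP.maximallyCompact.cartan
  have hK := hθ.isKillingComplement hS
  have hrestr := isCartanSubalgebra_restrict (𝔥 := 𝔥) hK
  have hkilling := hK.killing
  have D := evenRootData (𝔥 := 𝔥) hK
  obtain ⟨f, v, had, hodd⟩ := LieSuperalgebra.exists_isAdapted hθ hP D
  -- Only type `D(2,n)` needs a new functional `g`; in all other cases `g = f`.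
  obtain ⟨g, hgf, hg0, hg⟩ : ∃ g : Module.Dual ℂ 𝔥 →ₗ[ℝ] ℝ,
      (∀ α ∈ LieSuperalgebra.evenRoots 𝔥, 0 < g α ↔ 0 < f α) ∧
      (∀ α ∈ LieSuperalgebra.evenRoots 𝔥 ∪ LieSuperalgebra.oddRoots 𝔤₁ 𝔥, g α ≠ 0) ∧
      ∀ P, P = {α | α ∈ LieSuperalgebra.evenRoots 𝔥 ∪ LieSuperalgebra.oddRoots 𝔤₁ 𝔥 ∧ 0 < g α} →
        ∀ n : ℕ, S.IsTypeD 2 n → ∀ F ⊆ LieSuperalgebra.evenSimple 𝔥 P,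
          (∀ α ∈ F, ∀ β ∈ F, LieSuperalgebra.SamePart 𝔥 P α β → α = β) →
            (F ∩ LieSuperalgebra.simpleSystem P).encard ≤ 2 := by
    by_cases hex : ∃ n, S.IsTypeD 2 n
    · obtain ⟨n, hn⟩ := hex
      obtain ⟨g, h1, h2, h3⟩ := hn.exists_functional hS.simple D had.ne_zero hodd
      exact ⟨g, h1, h2, fun P hP _ _ => h3 P hP⟩
    · exact ⟨f, fun _ _ => Iff.rfl, fun α hα => hα.elim (had.ne_zero α) (hodd α),
        fun _ _ n hn => absurd ⟨n, hn⟩ hex⟩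
  set P' : Set (Module.Dual ℂ 𝔥) :=
    {α | α ∈ LieSuperalgebra.evenRoots 𝔥 ∪ LieSuperalgebra.oddRoots 𝔤₁ 𝔥 ∧ 0 < g α} with hP'
  -- The change from `f` to `g` affects odd roots only, so everything proved about even roots for
  -- the adapted `f` holds for `P'`.
  have hPf : ∀ α ∈ LieSuperalgebra.evenRoots 𝔥, α ∈ P' ↔ 0 < f α := fun α hα =>
    ⟨fun h1 => (hgf α hα).1 h1.2, fun h1 => ⟨Or.inl hα, (hgf α hα).2 h1⟩⟩
  have hsub : LieSuperalgebra.painted θ 𝔥 P' ⊆ LieSuperalgebra.evenSimple 𝔥 P' := fun α hα => hα.1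
  have hpart : ∀ α ∈ LieSuperalgebra.painted θ 𝔥 P', ∀ β ∈ LieSuperalgebra.painted θ 𝔥 P',
      LieSuperalgebra.SamePart 𝔥 P' α β → α = β := fun α hα β hβ hαβ =>
    LieSuperalgebra.eq_of_painted_of_samePart had hθ.involutive hPf hα hβ hαβ
  have hcount : ∀ {k : ℕ}, (∃ I : Fin k → LieIdeal ℂ 𝔤₀, IsSimpleCover I) →
      (LieSuperalgebra.painted θ 𝔥 P').encard ≤ k := fun ⟨_, hI⟩ =>
    D.encard_le_of_not_samePart had.ne_zero hPf hI hsub hpart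
  refine ⟨P', ⟨hP.maximallyCompact, ⟨g, hg0, rfl⟩, had.compactFirst P' hPf⟩,
    fun m n hA => hcount hA.exists_isSimpleCover,
    fun m n hm hD => hcount (hD.exists_isSimpleCover hm),
    fun n hD => ⟨hcount (hD.exists_isSpinIdeal.imp fun _ hI => hI.1), hg P' hP' n hD _ hsub hpart⟩,
    fun a _ _ hD => hcount hD.exists_isSimpleCover,
    fun htriv => ⟨hpart, fun ε B ω hB α hα β hβ hαβ => not_lt.2 ?_⟩⟩
  exact LieSuperalgebra.normalizedDualBasis_le had hθ.involutive hPf hB hα hβ (htriv β hβ) hαβ
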